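/- **Setting.** Let $x\in\mathbb R^d$ ($d\ge 1$) be a random vector with positive definite second-moment matrix $\Sigma=\mathbb E\,xx^\top$ (not necessarily centered) that is sub-Gaussian with parameter $K$, i.e. $\|\langle v,x\rangle\|_{\psi_2}\le K\,(v^\top\Sigma v)^{1/2}$ for all $v$, where $\|X\|_{\psi_2}=\inf\{t>0:\mathbb E e^{X^2/t^2}\le 2\}$. A sample is $(x,y)$ with $y=x^\top\beta+\varepsilon$ and $\varepsilon\sim\mathcal N(0,\sigma^2)$ independent of $x$ ($\sigma\ge 0$). The private data $(\mathbf A,\mathbf y_A)$ and the public data $(\mathbf B,\mathbf y_B)$ consist of $n_A$ and $n_B$ such samples, all independent, $n_A,n_B>d$. Put $\hat\Sigma_A=\mathbf A^\top\mathbf A/n_A$, $\hat\Sigma_B=\mathbf B^\top\mathbf B/n_B$, $\hat\sigma_B=(\|\mathbf y_B\|^2/n_B)^{1/2}$, $\hat\beta_A=\hat\Sigma_A^{-1}\mathbf A^\top\mathbf y_A/n_A$ and $\tilde\beta_A=\hat\sigma_B^{-1}\hat\Sigma_B^{1/2}\hat\beta_A$. Vector norms are Euclidean, matrix norms are operator norms.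 **Algorithm (DP-PMTOLSE).** Let $\rho>0$, $\eta\in(0,1)$ and let $\tau>0$ be a truncation constant. Replace each private feature vector $\mathbf A_i$ by $\hat\Sigma_B^{-1/2}\mathbf A_i$ and each response $y_{A_i}$ by $y_{A_i}/\hat\sigma_B$; then rescale each transformed feature vector of norm at least $\sqrt{\tau d(1+\log(2n_A/\eta))}$ to that norm, and each transformed response of absolute value at least $\sqrt{\tau(1+\log(2n_A/\eta))}$ to that absolute value. With the resulting data $\tilde{\mathbf A},\tilde{\mathbf y}_A$ set $$\tilde\beta_A^{DP}=\Big(\tfrac{\tilde{\mathbf A}^\top\tilde{\mathbf A}}{n_A}+\mathbf G\Big)^{-1}\Big(\tfrac{\tilde{\mathbf A}^\top\tilde{\mathbf y}_A}{n_A}+\mathbf g\Big),\qquad \hat\beta_A^{DP}=\hat\sigma_B\hat\Sigma_B^{-1/2}\tilde\beta_A^{DP},$$ where $\mathbf G$ is a symmetric random matrix whose entries on and above the diagonal are i.i.d. $\mathcal N(0,\sigma_1^2)$, $\mathbf g\sim\mathcal N(0,\sigma_2^2\mathbf I)$, $\mathbf G$ and $\mathbf g$ are independent of each other and of the data, and $$\sigma_1=\frac{2\tau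 d(1+\log(2n_A/\eta))}{\sqrt{2\rho}\,n_A},\qquad \sigma_2=\frac{2\tau\sqrt d\,(1+\log(2n_A/\eta))}{\sqrt{2\rho}\,n_A}.$$ The output is $\hat\beta_A^{DP}$. **Theorem.** 1. *Privacy.* For all $d\ge1$, $n_A$, $n_B$, $\tau,\rho>0$, $\eta\in(0,1)$ and every fixed public dataset, the algorithm is $2\rho$-zCDP as a randomized function of the private dataset: if two private datasets differ in only one sample, the Rényi divergence of order $\alpha$ between the laws of the outputs is at most $2\rho\alpha$, for every $\alpha>1$. For every $K>0$ there are positive constants $\tau_0,C_1,C_2,C_3,c_1$, depending only on $K$, such that the following holds, where $$L=\frac{n_B}{\big(\sqrt{n_B}+C_2(\sqrt d+\sqrt{2\log(1/\eta)})\big)^2},\qquad q=1-C_3\,\frac{\sqrt d+\sqrt{\log(1/\eta)}}{\sqrt{n_A}} .$$ 2. *No truncation loss.* If $\tau\ge\tau_0$, $(\beta,\sigma)\ne(0,0)$, $\eta\in(0,1)$ and $\sqrt{n_B}\ge C_1(\sqrt d+\sqrt{2\log(1/\eta)})$, then with probability at least $1-c_1\eta$: $\hat\Sigma_B$ is positive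 definite, $\hat\sigma_B>0$, the truncation changes no transformed feature vector and no transformed response, and hence the ordinary least squares estimator of $(\tilde{\mathbf A},\tilde{\mathbf y}_A)$ equals $\tilde\beta_A$. 3. *Accuracy.* For every $\tau\ge\tau_0$ there is a constant $c_2>0$ depending only on $K,\tau$, and for every $s>0$ a constant $C>0$ depending only on $K,\tau,s$, such that the following holds for all $\rho>0$ and $\eta\in(0,1)$. Let $\beta\neq0$ and $\sigma\le s\,\|\Sigma\|^{1/2}\|\beta\|$, let $\sqrt{n_B}\ge C_1(\sqrt d+\sqrt{2\log(1/\eta)})$, and let $n_A$ be such that $$q>0\qquad\text{and}\qquad\frac{d^{3/2}(1+\log(2n_A/\eta))\log(1/\eta)}{\sqrt\rho\,n_A\,L\,q^2}\le\frac12 .$$ Then with probability at least $1-c_2\eta$: $\hat\Sigma_A$ and $\hat\Sigma_B$ are positive definite, $\hat\sigma_B>0$, $\tilde{\mathbf A}^\top\tilde{\mathbf A}/n_A+\mathbf G$ is invertible, $$\|\tilde\beta_A^{DP}-\tilde\beta_A\|\le C\,\frac{d^{3/2}\|\beta\|\,\|\hat\Sigma_A\|\,\|\hat\Sigma_B^{-1/2}\|\log(1/\eta)}{\hat\sigma_B\sqrt\rho\,n_A\,q^4}\cdot\frac{1+\log(2n_A/\eta)}{L^2}$$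 and $$\|\hat\beta_A^{DP}-\hat\beta_A\|\le C\,\frac{d^{3/2}\|\beta\|\,\|\hat\Sigma_A\|\,\|\hat\Sigma_B^{-1}\|\log(1/\eta)}{\sqrt\rho\,n_A\,q^4}\cdot\frac{1+\log(2n_A/\eta)}{L^2}.$$ -/

import Mathlib

open MeasureTheory ProbabilityTheory
open scoped Matrix ENNReal MatrixOrder

noncomputable section

namespace DPOLS

/-! ### Data, empirical moments, ordinary least squares -/

/-- Column vectors with the Euclidean norm. -/
abbrev Vec (d : ℕ) := EuclideanSpace ℝ (Fin d)

/-- A dataset of `n` samples, each a feature vector together with a real response. -/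
abbrev Dataset (n d : ℕ) := Fin n → Vec d × ℝ

/-- Operator (spectral) norm of a square matrix. -/
def opNorm {d : ℕ} (M : Matrix (Fin d) (Fin d) ℝ) : ℝ :=
  ‖Matrix.toEuclideanCLM (𝕜 := ℝ) M‖

/-- Matrix-vector product, as a map of Euclidean spaces. -/
def act {d : ℕ} (M : Matrix (Fin d) (Fin d) ℝ) (v : Vec d) : Vec d :=
  Matrix.toEuclideanCLM (𝕜 := ℝ) M v

/-- `S^{-1/2}`, for a positive definite matrix `S`. -/
def invSqrt {d : ℕ} (S : Matrix (Fin d) (Fin d) ℝ) : Matrix (Fin d) (Fin d) ℝ :=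
  (CFC.sqrt S)⁻¹

/-- The `n × d` data matrix, whose rows are the samples. -/
def designMatrix {n d : ℕ} (D : Dataset n d) : Matrix (Fin n) (Fin d) ℝ :=
  Matrix.of fun i j => (D i).1 j

/-- `XᵀX / n`. -/
def secondMoment {n d : ℕ} (D : Dataset n d) : Matrix (Fin d) (Fin d) ℝ :=
  (n : ℝ)⁻¹ • ((designMatrix D)ᵀ * designMatrix D)

/-- `Xᵀy / n`. -/
def crossMoment {n d : ℕ} (D : Dataset n d) : Vec d :=
  WithLp.toLp 2 ((n : ℝ)⁻¹ • ((designMatrix D)ᵀ *ᵥ fun i => (D i).2))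

/-- `√(∑ yᵢ² / n)`. -/
def responseScale {n d : ℕ} (D : Dataset n d) : ℝ :=
  √((n : ℝ)⁻¹ * ∑ i, (D i).2 ^ 2)

/-- The ordinary least squares estimator `(XᵀX/n)⁻¹ (Xᵀy/n)`. -/
def ols {n d : ℕ} (D : Dataset n d) : Vec d :=
  act (secondMoment D)⁻¹ (crossMoment D)

/-! ### Public-moment transformation and truncation -/

/-- Projection onto the ball of radius `R`: vectors of norm at least `R` are rescaled to
norm `R`, all others are kept. -/
def clip {V : Type*} [NormedAddCommGroup V] [NormedSpace ℝ V] (R : ℝ) (v : V) : V :=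
  open Classical in if R ≤ ‖v‖ then (R / ‖v‖) • v else v

/-- The truncation radius `√(τ m (1 + log (2n/η)))` in dimension `m`. -/
def truncRadius (τ : ℝ) (m n : ℕ) (η : ℝ) : ℝ :=
  √(τ * m * (1 + Real.log (2 * n / η)))

/-- Features multiplied by `Σ̂_B^{-1/2}`, responses divided by `σ̂_B`. -/
def transform {nA nB d : ℕ} (pub : Dataset nB d) (priv : Dataset nA d) : Dataset nA d :=
  fun i => (act (invSqrt (secondMoment pub)) (priv i).1, (priv i).2 / responseScale pub)

/-- Transformed features and responses, truncated (in dimensions `d` and `1`). -/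
def pmt (τ η : ℝ) {nA nB d : ℕ} (pub : Dataset nB d) (priv : Dataset nA d) : Dataset nA d :=
  fun i => (clip (truncRadius τ d nA η) (transform pub priv i).1,
    clip (truncRadius τ 1 nA η) (transform pub priv i).2)

/-- The transformed OLSE `(Σ̂_B^{1/2} / σ̂_B) β̂_A`. -/
def transformedOLS {nA nB d : ℕ} (pub : Dataset nB d) (priv : Dataset nA d) : Vec d :=
  (responseScale pub)⁻¹ • act (CFC.sqrt (secondMoment pub)) (ols priv)

/-! ### Gaussian perturbation and recovery -/

/-- Standard deviation of the entries of the noise matrix. -/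
def noiseScale₁ (τ ρ η : ℝ) (d n : ℕ) : ℝ :=
  2 * τ * d * (1 + Real.log (2 * n / η)) / (√(2 * ρ) * n)

/-- Standard deviation of the entries of the noise vector. -/
def noiseScale₂ (τ ρ η : ℝ) (d n : ℕ) : ℝ :=
  2 * τ * √d * (1 + Real.log (2 * n / η)) / (√(2 * ρ) * n)

/-- The symmetric matrix with the same entries as `W` on and above the diagonal. -/
def symMatrix {d : ℕ} (W : Fin d → Fin d → ℝ) : Matrix (Fin d) (Fin d) ℝ :=
  Matrix.of fun i j => W (min i j) (max i j)

/-- Law of the independent noises: an array with i.i.d. `N(0, σ₁²)` entries, to be symmetrized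
by `symMatrix`, and a vector `N(0, σ₂² I)`. -/
def noiseLaw (τ ρ η : ℝ) (d n : ℕ) : Measure ((Fin d → Fin d → ℝ) × Vec d) :=
  (Measure.pi fun _ => Measure.pi fun _ =>
      gaussianReal 0 (noiseScale₁ τ ρ η d n ^ 2).toNNReal).prod
    ((Measure.pi fun _ => gaussianReal 0 (noiseScale₂ τ ρ η d n ^ 2).toNNReal).map
      (WithLp.toLp 2))

/-- The perturbed second moment `ÃᵀÃ/n + G` of the transformed and truncated data. -/
def noisyMoment (τ η : ℝ) {nA nB d : ℕ} (pub : Dataset nB d) (priv : Dataset nA d)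
    (w : (Fin d → Fin d → ℝ) × Vec d) : Matrix (Fin d) (Fin d) ℝ :=
  secondMoment (pmt τ η pub priv) + symMatrix w.1

/-- `(ÃᵀÃ/n + G)⁻¹ (Ãᵀỹ/n + g)`, for given values `w = (G, g)` of the noises. -/
def dpTransformed (τ η : ℝ) {nA nB d : ℕ} (pub : Dataset nB d) (priv : Dataset nA d)
    (w : (Fin d → Fin d → ℝ) × Vec d) : Vec d :=
  act (noisyMoment τ η pub priv w)⁻¹ (crossMoment (pmt τ η pub priv) + w.2)

/-- The recovered estimator `σ̂_B Σ̂_B^{-1/2} β̃^DP`. -/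
def dpRecovered (τ η : ℝ) {nA nB d : ℕ} (pub : Dataset nB d) (priv : Dataset nA d)
    (w : (Fin d → Fin d → ℝ) × Vec d) : Vec d :=
  responseScale pub • act (invSqrt (secondMoment pub)) (dpTransformed τ η pub priv w)

/-- The randomized algorithm DP-PMTOLSE: the law of its output on a private dataset. -/
def dpPMTOLSE (τ ρ η : ℝ) {nA nB d : ℕ} (pub : Dataset nB d) (priv : Dataset nA d) :
    Measure (Vec d) :=
  (noiseLaw τ ρ η d nA).map (dpRecovered τ η pub priv)

/-! ### Zero-concentrated differential privacy -/

/-- Rényi divergence of order `α > 1` between probability measures. -/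
def renyiDiv {S : Type*} [MeasurableSpace S] (α : ℝ) (P Q : Measure S) : EReal :=
  open Classical in
  if P ≪ Q then (((α - 1)⁻¹ : ℝ) : EReal) * ENNReal.log (∫⁻ x, (P.rnDeriv Q x) ^ α ∂Q) else ⊤

/-- The two datasets differ in at most one sample. -/
def Neighbors {n : ℕ} {X : Type*} (D D' : Fin n → X) : Prop :=
  ∃ i, ∀ j, j ≠ i → D j = D' j

/-- `M` is a randomized algorithm that satisfies `ρ`-zCDP. -/
def IsZCDP {n : ℕ} {X S : Type*} [MeasurableSpace S] (M : (Fin n → X) → Measure S) (ρ : ℝ) :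
    Prop :=
  (∀ D, IsProbabilityMeasure (M D)) ∧
    ∀ D D', Neighbors D D' → ∀ α : ℝ, 1 < α → renyiDiv α (M D) (M D') ≤ ((ρ * α : ℝ) : EReal)

/-! ### The statistical model -/

/-- `ν` is a sub-Gaussian law on `ℝᵈ` with positive definite second-moment matrix `S`: every
marginal satisfies `‖⟨v, x⟩‖_{ψ₂} ≤ K (E⟨v, x⟩²)^{1/2}`, where
`‖X‖_{ψ₂} = inf {t > 0 | E exp (X²/t²) ≤ 2}`. Equivalently, the isotropic vector `S^{-1/2} x` has
sub-Gaussian norm at most `K`. No centering is assumed. -/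
structure IsSubG {d : ℕ} (ν : Measure (Vec d)) (S : Matrix (Fin d) (Fin d) ℝ) (K : ℝ) :
    Prop where
  isProbabilityMeasure : IsProbabilityMeasure ν
  posDef : S.PosDef
  integrable : ∀ i j, Integrable (fun x : Vec d => x i * x j) ν
  secondMoment_eq : ∀ i j, ∫ x : Vec d, x i * x j ∂ν = S i j
  psiTwo_le : ∀ v : Vec d,
    ∫⁻ x, ENNReal.ofReal (Real.exp (inner ℝ v x ^ 2 / (K ^ 2 * inner ℝ v (act S v)))) ∂ν ≤ 2

/-- Law of one sample `(x, ⟨x, β⟩ + ε)` with `x ∼ ν` and `ε ∼ N(0, σ²)` independent. -/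
def sampleLaw {d : ℕ} (ν : Measure (Vec d)) (β : Vec d) (σ : ℝ) : Measure (Vec d × ℝ) :=
  (ν.prod (gaussianReal 0 (σ ^ 2).toNNReal)).map fun p => (p.1, inner ℝ p.1 β + p.2)

/-- Joint law of the private and the public datasets, all samples being i.i.d. -/
def dataLaw {d : ℕ} (nA nB : ℕ) (ν : Measure (Vec d)) (β : Vec d) (σ : ℝ) :
    Measure (Dataset nA d × Dataset nB d) :=
  (Measure.pi fun _ => sampleLaw ν β σ).prod (Measure.pi fun _ => sampleLaw ν β σ)

/-! ### The quantities in the bounds -/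

/-- `L = n / (√n + C (√d + √(2 log (1/η))))²`. -/
def lowerEig (C : ℝ) (d n : ℕ) (η : ℝ) : ℝ :=
  n / (√n + C * (√d + √(2 * Real.log (1 / η)))) ^ 2

/-- `1 - C (√d + √(log (1/η))) / √n`. -/
def shrink (C : ℝ) (d n : ℕ) (η : ℝ) : ℝ :=
  1 - C * ((√d + √(Real.log (1 / η))) / √n)

/-- The event that the public moments `Σ̂_B` and `σ̂_B`, by which the data are divided, are positive
(definite), that truncation changes no sample, and that the OLSE of the truncated data is
the transformed OLSE of the original data. -/
def NoTruncationLoss (τ η : ℝ) {nA nB d : ℕ} (pub : Dataset nB d) (priv : Dataset nA d) : Prop :=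
  (secondMoment pub).PosDef ∧ 0 < responseScale pub ∧
    pmt τ η pub priv = transform pub priv ∧
    ols (pmt τ η pub priv) = transformedOLS pub priv

end DPOLS

end

namespace DPOLS

/-! ### Product integrals and product densities -/

/-! Privacy. Since `secondMoment` is symmetric, adding symmetric noise amounts to adding independent
Gaussians to all `d × d` entries and symmetrizing afterwards. The output is therefore a measurable
function of a Gaussian release of the truncated moments (`dpPMTOLSE_eq_map`). For Gaussians with
common variances, the Rényi moments are explicit and multiply over coordinates
(`renyiMomentLE_gaussianRelease`), and they do not grow under post-processing (`RenyiMomentLE.map`).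
Truncation bounds the squared sensitivities of the two moments by `4R⁴/n²` and `4R²r²/n²`, and the
noise scales make each of the two releases cost `ρ`.

Utility. Everything follows from a few events. Bernstein's inequality and a union bound over pairs
of points of a 1/2-net show that an empirical second moment is within a factor `1 ± 1/2` of `S`
(`exists_measure_not_momentClose_le`). Bernstein's inequality also controls the mean square
response. A union bound over samples and coordinates bounds every private sample up to a logarithm
(`measure_not_sampleBounded_le`). If the public moments are close and the private sample is bounded,
all transformed data lie inside the truncation radii, and equivariance of least squares gives part 2
(`noTruncationLoss_of_close`).

For part 3, when the private moments are close as well, the transformed second moment `M` is at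
least `1/3` and the transformed estimator `b` has norm at most `3`. Once `‖G‖ ≤ 1/6`, the identity
`(M + G)(b' - b) = g - G b` bounds the error by `6(‖g‖ + 3‖G‖)` (`norm_dpTransformed_sub_le`), and
Gaussian tail bounds over the net control the noise. This is already below the claimed bound: `L`
and `q` are at most `1`, and `‖β‖ ‖Σ̂_A‖ ‖Σ̂_B^{-1/2}‖ / σ̂_B` is bounded below in terms of `s`
(`one_le_mul_signalScale`).

The smallness hypothesis does not involve `τ`, whereas `‖G‖ ≤ 1/6` does. The hypothesis carries `log
(1/η)` where the noise only needs its square root, so the spare factor `√(log (1/η))` absorbs `τ`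
when `η` is small. For the remaining `η`, the constant `c₂`, which may depend on `τ`, makes `c₂ η ≥
1` and the claim is trivial. -/

lemma lintegral_pi_prod {ι : Type*} [Fintype ι] {X : ι → Type*} [∀ i, MeasurableSpace (X i)]
    (μ : ∀ i, Measure (X i)) [∀ i, IsProbabilityMeasure (μ i)] {f : ∀ i, X i → ℝ≥0∞}
    (hf : ∀ i, Measurable (f i)) :
    ∫⁻ ω, ∏ i, f i (ω i) ∂(Measure.pi μ) = ∏ i, ∫⁻ x, f i x ∂(μ i) := by
  have hind : iIndepFun (fun i (ω : ∀ i, X i) => f i (ω i)) (Measure.pi μ) :=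
    iIndepFun_pi (X := fun i => f i) fun i => (hf i).aemeasurable
  have h := lintegral_prod_eq_prod_lintegral_of_indepFun (μ := Measure.pi μ) Finset.univ
    (fun i (ω : ∀ i, X i) => f i (ω i)) hind
    (fun i => (hf i).comp (measurable_pi_apply i))
  rw [h]
  refine Finset.prod_congr rfl fun i _ => ?_
  exact (measurePreserving_eval μ i).lintegral_comp (hf i)

lemma pi_withDensity {ι : Type*} [Fintype ι] {X : ι → Type*} [∀ i, MeasurableSpace (X i)]
    (μ : ∀ i, Measure (X i)) [∀ i, IsProbabilityMeasure (μ i)] {h : ∀ i, X i → ℝ≥0∞}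
    (hh : ∀ i, Measurable (h i)) [∀ i, SigmaFinite ((μ i).withDensity (h i))] :
    Measure.pi (fun i => (μ i).withDensity (h i)) =
      (Measure.pi μ).withDensity fun ω => ∏ i, h i (ω i) := by
  refine Measure.pi_eq fun s hs => ?_
  rw [withDensity_apply _ (MeasurableSet.univ_pi hs),
    ← lintegral_indicator (MeasurableSet.univ_pi hs)]
  have key : (Set.univ.pi s).indicator (fun ω => ∏ i, h i (ω i)) =
      fun ω : ∀ i, X i => ∏ i, (s i).indicator (h i) (ω i) := by
    funext ω
    by_cases hω : ω ∈ Set.univ.pi s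
    · rw [Set.indicator_of_mem hω]
      exact Finset.prod_congr rfl fun i _ => (Set.indicator_of_mem (hω i trivial) _).symm
    · rw [Set.indicator_of_notMem hω]
      obtain ⟨i, hi⟩ : ∃ i, ω i ∉ s i := by
        by_contra hcon
        exact hω fun i _ => not_not.1 fun hi => hcon ⟨i, hi⟩
      exact (Finset.prod_eq_zero (Finset.mem_univ i) (Set.indicator_of_notMem hi _)).symm
  rw [key, lintegral_pi_prod μ fun i => (hh i).indicator (hs i)]
  exact Finset.prod_congr rfl fun i _ => by
    rw [lintegral_indicator (hs i), withDensity_apply _ (hs i)]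

/-! ### Bounds on Rényi moments -/

/-- `P` has a density with respect to `Q` whose `α`-th moment is at most `exp M`. -/
def RenyiMomentLE {S : Type*} [MeasurableSpace S] (α : ℝ) (P Q : Measure S) (M : ℝ) : Prop :=
  ∃ h : S → ℝ≥0∞, Measurable h ∧ P = Q.withDensity h ∧
    ∫⁻ x, h x ^ α ∂Q ≤ ENNReal.ofReal (Real.exp M)

lemma RenyiMomentLE.mono {S : Type*} [MeasurableSpace S] {α : ℝ} {P Q : Measure S} {M M' : ℝ}
    (h : RenyiMomentLE α P Q M) (hM : M ≤ M') : RenyiMomentLE α P Q M' := by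
  obtain ⟨f, hf, hP, hI⟩ := h
  exact ⟨f, hf, hP, hI.trans (ENNReal.ofReal_le_ofReal (Real.exp_le_exp.2 hM))⟩

lemma RenyiMomentLE.prod {S T : Type*} [MeasurableSpace S] [MeasurableSpace T] {α : ℝ}
    (hα : 0 ≤ α) {P Q : Measure S} {P' Q' : Measure T} [IsProbabilityMeasure Q]
    [IsProbabilityMeasure Q'] {M M' : ℝ} (h : RenyiMomentLE α P Q M)
    (h' : RenyiMomentLE α P' Q' M') : RenyiMomentLE α (P.prod P') (Q.prod Q') (M + M') := by
  obtain ⟨f, hf, rfl, hI⟩ := h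
  obtain ⟨g, hg, rfl, hJ⟩ := h'
  refine ⟨fun z => f z.1 * g z.2, by fun_prop, prod_withDensity hf hg, ?_⟩
  simp_rw [ENNReal.mul_rpow_of_nonneg _ _ hα]
  rw [lintegral_prod_mul (hf.pow_const α).aemeasurable (hg.pow_const α).aemeasurable,
    Real.exp_add, ENNReal.ofReal_mul (Real.exp_pos _).le]
  gcongr

lemma RenyiMomentLE.pi {ι : Type*} [Fintype ι] {X : ι → Type*} [∀ i, MeasurableSpace (X i)]
    {α : ℝ} (hα : 0 ≤ α) {P Q : ∀ i, Measure (X i)} [∀ i, IsProbabilityMeasure (P i)]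
    [∀ i, IsProbabilityMeasure (Q i)]
    {M : ι → ℝ} (h : ∀ i, RenyiMomentLE α (P i) (Q i) (M i)) :
    RenyiMomentLE α (Measure.pi P) (Measure.pi Q) (∑ i, M i) := by
  choose f hf hP hI using h
  have hP' : P = fun i => (Q i).withDensity (f i) := funext hP
  have : ∀ i, SigmaFinite ((Q i).withDensity (f i)) := fun i => by rw [← hP i]; infer_instance
  refine ⟨fun ω => ∏ i, f i (ω i), by fun_prop, by rw [hP', pi_withDensity Q hf], ?_⟩
  simp_rw [← ENNReal.prod_rpow_of_nonneg hα]
  rw [lintegral_pi_prod Q (f := fun i x => f i x ^ α) fun i => (hf i).pow_const α, Real.exp_sum,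
    ENNReal.ofReal_prod_of_nonneg fun i _ => (Real.exp_pos _).le]
  exact Finset.prod_le_prod' fun i _ => hI i

/-- Closes the self-bounding Hölder estimate in the data-processing inequality by cancelling `x ^
((α - 1) / α)`. The cancellation needs `x` finite, which is why the density is truncated there. -/
lemma rpow_le_of_le_mul_rpow {x C : ℝ≥0∞} {α : ℝ} (hα : 1 < α) (hx : x ≠ ∞)
    (h : x ≤ x ^ ((α - 1) / α) * C ^ (1 / α)) : x ≤ C := by
  have hα0 : 0 < α := by linarith
  rcases eq_or_ne x 0 with rfl | hx0
  · exact zero_le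
  have h1 : x = x ^ ((α - 1) / α) * x ^ (1 / α) := by
    rw [← ENNReal.rpow_add _ _ hx0 hx, ← add_div, sub_add_cancel, div_self hα0.ne',
      ENNReal.rpow_one]
  nth_rewrite 1 [h1] at h
  have h2 : x ^ ((α - 1) / α) ≠ 0 := (ENNReal.rpow_pos (pos_iff_ne_zero.2 hx0) hx).ne'
  have h3 : x ^ ((α - 1) / α) ≠ ∞ :=
    ENNReal.rpow_ne_top_of_nonneg (div_nonneg (by linarith) hα0.le) hx
  rw [ENNReal.mul_le_mul_iff_right h2 h3] at h
  exact (ENNReal.rpow_le_rpow_iff (by positivity)).1 h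

/-- Rényi moments do not increase under post-processing. -/
lemma RenyiMomentLE.map {S T : Type*} [MeasurableSpace S] [MeasurableSpace T] {α : ℝ}
    (hα : 1 < α) {P Q : Measure S} [IsProbabilityMeasure P] [IsProbabilityMeasure Q] {M : ℝ}
    (h : RenyiMomentLE α P Q M) {φ : S → T} (hφ : Measurable φ) :
    RenyiMomentLE α (P.map φ) (Q.map φ) M := by
  obtain ⟨f, hf, hP, hI⟩ := h
  have hα0 : 0 < α := by linarith
  have hac : P.map φ ≪ Q.map φ :=
    Measure.AbsolutelyContinuous.map (hP ▸ withDensity_absolutelyContinuous Q f) hφ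
  have hPm := Measure.isProbabilityMeasure_map (μ := P) hφ.aemeasurable
  have hQm := Measure.isProbabilityMeasure_map (μ := Q) hφ.aemeasurable
  set k := (P.map φ).rnDeriv (Q.map φ) with hk
  have hkm : Measurable k := Measure.measurable_rnDeriv _ _
  have hPk : P.map φ = (Q.map φ).withDensity k := (Measure.withDensity_rnDeriv_eq _ _ hac).symm
  refine ⟨k, hkm, hPk, ?_⟩
  -- With `I = ∫ min(k, N)^α`, bound one factor of the power by `k`, pull the integral back to `S`,
  -- and apply Hölder against `f`. This gives `I ≤ I ^ ((α - 1)/α) * C ^ (1/α)` with `C = exp M`.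
  -- Monotone convergence then removes `N`.
  have trunc : ∀ N : ℕ, ∫⁻ y, min (k y) N ^ α ∂(Q.map φ) ≤ ENNReal.ofReal (Real.exp M) := by
    intro N
    have hm : Measurable fun y => min (k y) (N : ℝ≥0∞) := hkm.min measurable_const
    have hfin : ∫⁻ y, min (k y) (N : ℝ≥0∞) ^ α ∂(Q.map φ) ≠ ∞ := by
      refine ne_top_of_le_ne_top (b := (N : ℝ≥0∞) ^ α)
        (ENNReal.rpow_ne_top_of_nonneg hα0.le (ENNReal.natCast_ne_top N)) ?_
      calc ∫⁻ y, min (k y) (N : ℝ≥0∞) ^ α ∂(Q.map φ)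
          ≤ ∫⁻ _, (N : ℝ≥0∞) ^ α ∂(Q.map φ) :=
            lintegral_mono fun y => ENNReal.rpow_le_rpow (min_le_right _ _) hα0.le
        _ = (N : ℝ≥0∞) ^ α := by simp
    refine rpow_le_of_le_mul_rpow hα hfin ?_
    have hpq : (α / (α - 1)).HolderConjugate α :=
      (Real.HolderConjugate.conjExponent hα).symm
    calc ∫⁻ y, min (k y) (N : ℝ≥0∞) ^ α ∂(Q.map φ)
        ≤ ∫⁻ y, k y * min (k y) (N : ℝ≥0∞) ^ (α - 1) ∂(Q.map φ) := by
          refine lintegral_mono fun y => ?_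
          have : min (k y) (N : ℝ≥0∞) ^ α =
              min (k y) (N : ℝ≥0∞) * min (k y) (N : ℝ≥0∞) ^ (α - 1) := by
            nth_rewrite 2 [← ENNReal.rpow_one (min (k y) (N : ℝ≥0∞))]
            rw [← ENNReal.rpow_add_of_nonneg _ _ zero_le_one (by linarith)]
            congr 1; ring
          simp only [this]
          gcongr
          exact min_le_left _ _
      _ = ∫⁻ y, min (k y) (N : ℝ≥0∞) ^ (α - 1) ∂(P.map φ) := by
          rw [hPk, lintegral_withDensity_eq_lintegral_mul _ hkm (hm.pow_const _)]
          rfl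
      _ = ∫⁻ x, ((fun x => min (k (φ x)) (N : ℝ≥0∞) ^ (α - 1)) * f) x ∂Q := by
          rw [lintegral_map (hm.pow_const _) hφ, hP,
            lintegral_withDensity_eq_lintegral_mul _ hf
              (show Measurable fun x => min (k (φ x)) (N : ℝ≥0∞) ^ (α - 1) from
                (hm.comp hφ).pow_const _), mul_comm]
      _ ≤ (∫⁻ x, (min (k (φ x)) (N : ℝ≥0∞) ^ (α - 1)) ^ (α / (α - 1)) ∂Q) ^ (1 / (α / (α - 1))) *
            (∫⁻ x, f x ^ α ∂Q) ^ (1 / α) :=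
          ENNReal.lintegral_mul_le_Lp_mul_Lq Q hpq
            ((hm.comp hφ).pow_const _).aemeasurable hf.aemeasurable
      _ ≤ (∫⁻ y, min (k y) (N : ℝ≥0∞) ^ α ∂(Q.map φ)) ^ ((α - 1) / α) *
            ENNReal.ofReal (Real.exp M) ^ (1 / α) := by
          rw [one_div_div, lintegral_map (hm.pow_const _) hφ]
          have : α - 1 ≠ 0 := by linarith
          simp_rw [← ENNReal.rpow_mul, mul_div_cancel₀ α this]
          gcongr
  have hmono : ∀ y, Monotone fun N : ℕ => min (k y) (N : ℝ≥0∞) ^ α := fun y a b hab =>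
    ENNReal.rpow_le_rpow (min_le_min le_rfl (by exact_mod_cast hab)) hα0.le
  have hsup : ∀ y, k y ^ α = ⨆ N : ℕ, min (k y) (N : ℝ≥0∞) ^ α := by
    intro y
    refine (iSup_eq_of_tendsto (hmono y) ?_).symm
    have h1 : Filter.Tendsto (fun N : ℕ => min (k y) (N : ℝ≥0∞)) Filter.atTop
        (nhds (min (k y) ∞)) := tendsto_const_nhds.min ENNReal.tendsto_nat_nhds_top
    rw [min_top_right] at h1
    exact (ENNReal.continuous_rpow_const.tendsto _).comp h1
  simp_rw [hsup]
  rw [lintegral_iSup (fun N => (hkm.min measurable_const).pow_const α)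
    fun a b hab y => hmono y hab]
  exact iSup_le trunc

lemma renyiDiv_le_of_renyiMomentLE {S : Type*} [MeasurableSpace S] {α : ℝ} (hα : 1 < α)
    {P Q : Measure S} [IsProbabilityMeasure P] [IsProbabilityMeasure Q] {M : ℝ}
    (h : RenyiMomentLE α P Q ((α - 1) * M)) : renyiDiv α P Q ≤ (M : EReal) := by
  obtain ⟨f, hf, hP, hI⟩ := h
  have hac : P ≪ Q := hP ▸ withDensity_absolutelyContinuous Q f
  have hd : P.rnDeriv Q =ᵐ[Q] f := by
    rw [hP]; exact Measure.rnDeriv_withDensity Q hf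
  have hint : ∫⁻ x, P.rnDeriv Q x ^ α ∂Q = ∫⁻ x, f x ^ α ∂Q :=
    lintegral_congr_ae (hd.mono fun x hx => by simp only [hx])
  have hα1 : 0 < α - 1 := by linarith
  rw [renyiDiv, if_pos hac, hint]
  calc (((α - 1)⁻¹ : ℝ) : EReal) * ENNReal.log (∫⁻ x, f x ^ α ∂Q)
      ≤ (((α - 1)⁻¹ : ℝ) : EReal) * (((α - 1) * M : ℝ) : EReal) := by
        refine mul_le_mul_of_nonneg_left ?_ (by exact_mod_cast (inv_pos.2 hα1).le)
        refine (ENNReal.log_le_log hI).trans_eq ?_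
        rw [ENNReal.log_ofReal_of_pos (Real.exp_pos _), Real.log_exp]
    _ = (M : EReal) := by
        rw [← EReal.coe_mul, inv_mul_cancel_left₀ hα1.ne']

/-- The Rényi moment between two Gaussians of the same variance. -/
lemma renyiMomentLE_gaussianReal (α m₁ m₂ : ℝ) {v : NNReal} (hv : v ≠ 0) :
    RenyiMomentLE α (gaussianReal m₁ v) (gaussianReal m₂ v)
      (α * (α - 1) * (m₁ - m₂) ^ 2 / (2 * v)) := by
  have hv' : (v : ℝ) ≠ 0 := by exact_mod_cast hv
  set g : ℝ → ℝ := fun x => Real.exp (((m₁ - m₂) * x - (m₁ ^ 2 - m₂ ^ 2) / 2) / v) with hg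
  have hgm : Measurable fun x => ENNReal.ofReal (g x) := by fun_prop
  have hdens : ∀ x, gaussianPDF m₁ v x = gaussianPDF m₂ v x * ENNReal.ofReal (g x) := by
    intro x
    rw [gaussianPDF, gaussianPDF, ← ENNReal.ofReal_mul (gaussianPDFReal_nonneg _ _ _),
      gaussianPDFReal, gaussianPDFReal, mul_assoc _ _ (g x), hg, ← Real.exp_add]
    congr 3
    field_simp
    ring
  refine ⟨fun x => ENNReal.ofReal (g x), hgm, ?_, ?_⟩
  · rw [gaussianReal_of_var_ne_zero _ hv, gaussianReal_of_var_ne_zero _ hv,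
      ← withDensity_mul _ (measurable_gaussianPDF _ _) hgm]
    congr 1
    funext x
    exact hdens x
  -- Completing the square: the tilted density is a multiple of the Gaussian density with mean `m₂ +
  -- α (m₁ - m₂)`, which integrates to one.
  · have h1 : ∀ x, gaussianPDF m₂ v x * ENNReal.ofReal (g x) ^ α =
        ENNReal.ofReal (Real.exp (α * (α - 1) * (m₁ - m₂) ^ 2 / (2 * v))) *
          gaussianPDF (m₂ + α * (m₁ - m₂)) v x := by
      intro x
      rw [ENNReal.ofReal_rpow_of_pos (Real.exp_pos _), gaussianPDF, gaussianPDF,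
        ← ENNReal.ofReal_mul (gaussianPDFReal_nonneg _ _ _),
        ← ENNReal.ofReal_mul (Real.exp_pos _).le,
        gaussianPDFReal, gaussianPDFReal, ← Real.exp_mul, mul_assoc _ (Real.exp _),
        ← Real.exp_add, mul_left_comm, ← Real.exp_add]
      congr 3
      field_simp
      ring
    rw [gaussianReal_of_var_ne_zero _ hv, lintegral_withDensity_eq_lintegral_mul _
      (measurable_gaussianPDF _ _) (hgm.pow_const _)]
    simp only [Pi.mul_apply, h1]
    rw [lintegral_const_mul _ (measurable_gaussianPDF _ _), lintegral_gaussianPDF_eq_one _ hv,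
      mul_one]

/-! ### Privacy of the algorithm -/

lemma secondMoment_apply {n d : ℕ} (D : Dataset n d) (j k : Fin d) :
    secondMoment D j k = (n : ℝ)⁻¹ * ∑ i, (D i).1 j * (D i).1 k := by
  simp [secondMoment, designMatrix, Matrix.mul_apply]

lemma crossMoment_apply {n d : ℕ} (D : Dataset n d) (j : Fin d) :
    crossMoment D j = (n : ℝ)⁻¹ * ∑ i, (D i).1 j * (D i).2 := by
  simp [crossMoment, designMatrix, Matrix.mulVec, dotProduct]

lemma norm_clip_le {V : Type*} [NormedAddCommGroup V] [NormedSpace ℝ V] {R : ℝ} (hR : 0 ≤ R)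
    (v : V) : ‖clip R v‖ ≤ R := by
  unfold clip
  split_ifs with h
  · rw [norm_smul, Real.norm_eq_abs, abs_div, abs_norm, abs_of_nonneg hR]
    rcases eq_or_ne ‖v‖ 0 with h0 | h0
    · rw [h0, mul_zero]; exact hR
    · rw [div_mul_cancel₀ _ h0]
  · exact (not_le.1 h).le

lemma sum_sub_sq_le_of_forall_ne {n : ℕ} {X : Type*} {D D' : Fin n → X} {i : Fin n}
    (h : ∀ j, j ≠ i → D j = D' j) (f : X → ℝ) :
    ((n : ℝ)⁻¹ * ∑ l, f (D l) - (n : ℝ)⁻¹ * ∑ l, f (D' l)) ^ 2 ≤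
      ((n : ℝ)⁻¹) ^ 2 * (2 * f (D i) ^ 2 + 2 * f (D' i) ^ 2) := by
  have : ∑ l, f (D l) - ∑ l, f (D' l) = f (D i) - f (D' i) := by
    rw [← Finset.sum_sub_distrib]
    exact Finset.sum_eq_single i (fun j _ hj => by rw [h j hj, sub_self]) (by simp)
  rw [← mul_sub, this, mul_pow]
  gcongr
  nlinarith [sq_nonneg (f (D i) + f (D' i))]

/-- Only the changed sample contributes, and the Frobenius norm of `v vᵀ` is `‖v‖²`. The constant
`4` comes from `(a - b)² ≤ 2a² + 2b²`. -/
lemma sum_secondMoment_sub_sq_le {n d : ℕ} {D D' : Dataset n d} (h : Neighbors D D') {R : ℝ}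
    (hD : ∀ i, ‖(D i).1‖ ≤ R) (hD' : ∀ i, ‖(D' i).1‖ ≤ R) :
    ∑ j, ∑ k, (secondMoment D j k - secondMoment D' j k) ^ 2 ≤ 4 * R ^ 4 / (n : ℝ) ^ 2 := by
  obtain ⟨i, hi⟩ := h
  have hsq : ∀ v : Vec d, ‖v‖ ≤ R → ∑ j, ∑ k, (v j * v k) ^ 2 ≤ R ^ 4 := by
    intro v hv
    have h1 : ∑ j, ∑ k, (v j * v k) ^ 2 = (‖v‖ ^ 2) ^ 2 := by
      rw [EuclideanSpace.real_norm_sq_eq, sq, Finset.sum_mul_sum]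
      simp_rw [mul_pow]
    rw [h1, ← pow_mul]
    gcongr
  calc ∑ j, ∑ k, (secondMoment D j k - secondMoment D' j k) ^ 2
      ≤ ∑ j, ∑ k, ((n : ℝ)⁻¹) ^ 2 * (2 * ((D i).1 j * (D i).1 k) ^ 2 +
          2 * ((D' i).1 j * (D' i).1 k) ^ 2) := by
        refine Finset.sum_le_sum fun j _ => Finset.sum_le_sum fun k _ => ?_
        rw [secondMoment_apply, secondMoment_apply]
        exact sum_sub_sq_le_of_forall_ne hi fun z : Vec d × ℝ => z.1 j * z.1 k
    _ = ((n : ℝ)⁻¹) ^ 2 * (2 * ∑ j, ∑ k, ((D i).1 j * (D i).1 k) ^ 2 +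
          2 * ∑ j, ∑ k, ((D' i).1 j * (D' i).1 k) ^ 2) := by
        simp only [← Finset.mul_sum, Finset.sum_add_distrib]
    _ ≤ ((n : ℝ)⁻¹) ^ 2 * (2 * R ^ 4 + 2 * R ^ 4) := by
        gcongr
        · exact hsq _ (hD i)
        · exact hsq _ (hD' i)
    _ = 4 * R ^ 4 / (n : ℝ) ^ 2 := by ring

lemma sum_crossMoment_sub_sq_le {n d : ℕ} {D D' : Dataset n d} (h : Neighbors D D') {R r : ℝ}
    (hD : ∀ i, ‖(D i).1‖ ≤ R) (hD' : ∀ i, ‖(D' i).1‖ ≤ R)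
    (hr : ∀ i, ‖(D i).2‖ ≤ r) (hr' : ∀ i, ‖(D' i).2‖ ≤ r) :
    ∑ j, (crossMoment D j - crossMoment D' j) ^ 2 ≤ 4 * (R ^ 2 * r ^ 2) / (n : ℝ) ^ 2 := by
  obtain ⟨i, hi⟩ := h
  have hsq : ∀ z : Vec d × ℝ, ‖z.1‖ ≤ R → ‖z.2‖ ≤ r →
      ∑ j, (z.1 j * z.2) ^ 2 ≤ R ^ 2 * r ^ 2 := by
    intro z hz hz'
    simp_rw [mul_pow]
    rw [← Finset.sum_mul, ← EuclideanSpace.real_norm_sq_eq, ← sq_abs z.2, ← Real.norm_eq_abs]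
    gcongr
  calc ∑ j, (crossMoment D j - crossMoment D' j) ^ 2
      ≤ ∑ j, ((n : ℝ)⁻¹) ^ 2 * (2 * ((D i).1 j * (D i).2) ^ 2 +
          2 * ((D' i).1 j * (D' i).2) ^ 2) := by
        refine Finset.sum_le_sum fun j _ => ?_
        rw [crossMoment_apply, crossMoment_apply]
        exact sum_sub_sq_le_of_forall_ne hi fun z : Vec d × ℝ => z.1 j * z.2
    _ = ((n : ℝ)⁻¹) ^ 2 * (2 * ∑ j, ((D i).1 j * (D i).2) ^ 2 +
          2 * ∑ j, ((D' i).1 j * (D' i).2) ^ 2) := by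
        simp only [← Finset.mul_sum, Finset.sum_add_distrib]
    _ ≤ ((n : ℝ)⁻¹) ^ 2 * (2 * (R ^ 2 * r ^ 2) + 2 * (R ^ 2 * r ^ 2)) := by
        gcongr
        · exact hsq _ (hD i) (hr i)
        · exact hsq _ (hD' i) (hr' i)
    _ = 4 * (R ^ 2 * r ^ 2) / (n : ℝ) ^ 2 := by ring

/-- Joint law of an array with independent `N(A i j, v₁)` entries and a vector with independent
`N(b j, v₂)` entries. -/
noncomputable def gaussianRelease {d : ℕ} (v₁ v₂ : NNReal) (A : Fin d → Fin d → ℝ)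
    (b : Vec d) : Measure ((Fin d → Fin d → ℝ) × Vec d) :=
  (Measure.pi fun i => Measure.pi fun j => gaussianReal (A i j) v₁).prod
    ((Measure.pi fun j => gaussianReal (b j) v₂).map (WithLp.toLp 2))

lemma measurable_toLp_vec (d : ℕ) :
    Measurable (WithLp.toLp 2 : (Fin d → ℝ) → Vec d) :=
  WithLp.measurable_toLp 2 (Fin d → ℝ)

instance isProbabilityMeasure_gaussianRelease {d : ℕ} (v₁ v₂ : NNReal)
    (A : Fin d → Fin d → ℝ) (b : Vec d) :
    IsProbabilityMeasure (gaussianRelease v₁ v₂ A b) := by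
  have := Measure.isProbabilityMeasure_map
    (μ := Measure.pi fun j => gaussianReal (b j) v₂) (measurable_toLp_vec d).aemeasurable
  unfold gaussianRelease
  infer_instance

lemma noiseLaw_eq_gaussianRelease (τ ρ η : ℝ) (d n : ℕ) :
    noiseLaw τ ρ η d n = gaussianRelease (noiseScale₁ τ ρ η d n ^ 2).toNNReal
      (noiseScale₂ τ ρ η d n ^ 2).toNNReal 0 0 := rfl

instance isProbabilityMeasure_noiseLaw (τ ρ η : ℝ) (d n : ℕ) :
    IsProbabilityMeasure (noiseLaw τ ρ η d n) := by
  rw [noiseLaw_eq_gaussianRelease]; infer_instance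

lemma gaussianRelease_map_add {d : ℕ} (v₁ v₂ : NNReal) (A : Fin d → Fin d → ℝ)
    (b : Vec d) :
    (gaussianRelease v₁ v₂ 0 0).map (fun w => ((fun i j => w.1 i j + A i j), w.2 + b)) =
      gaussianRelease v₁ v₂ A b := by
  have hL := measurable_toLp_vec d
  have := Measure.isProbabilityMeasure_map
    (μ := Measure.pi fun j => gaussianReal ((0 : Vec d) j) v₂) hL.aemeasurable
  have h1 : (Measure.pi fun i : Fin d => Measure.pi fun j : Fin d =>
        gaussianReal ((0 : Fin d → Fin d → ℝ) i j) v₁).map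
      (fun w i j => w i j + A i j) =
      Measure.pi fun i => Measure.pi fun j => gaussianReal (A i j) v₁ := by
    have inner : ∀ i, (Measure.pi fun j : Fin d =>
        gaussianReal ((0 : Fin d → Fin d → ℝ) i j) v₁).map (fun w j => w j + A i j) =
        Measure.pi fun j => gaussianReal (A i j) v₁ := by
      intro i
      rw [Measure.pi_map_pi (f := fun j x => x + A i j) fun j => by fun_prop]
      simp [gaussianReal_map_add_const]
    have hp : ∀ i, IsProbabilityMeasure ((Measure.pi fun j : Fin d =>
        gaussianReal ((0 : Fin d → Fin d → ℝ) i j) v₁).map (fun w j => w j + A i j)) :=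
      fun i => by rw [inner i]; infer_instance
    rw [Measure.pi_map_pi (f := fun i (w : Fin d → ℝ) j => w j + A i j) fun i =>
      (show Measurable fun (w : Fin d → ℝ) j => w j + A i j by fun_prop).aemeasurable]
    simp_rw [inner]
  have h2 : ((Measure.pi fun j : Fin d => gaussianReal ((0 : Vec d) j) v₂).map
      (WithLp.toLp 2)).map (fun w : Vec d => w + b) =
      (Measure.pi fun j => gaussianReal (b j) v₂).map (WithLp.toLp 2) := by
    have h3 : (Measure.pi fun j : Fin d => gaussianReal (b j) v₂) =
        (Measure.pi fun j : Fin d => gaussianReal ((0 : Vec d) j) v₂).map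
          (fun w j => w j + b j) := by
      rw [Measure.pi_map_pi (f := fun j x => x + b j) fun j => by fun_prop]
      simp [gaussianReal_map_add_const]
    rw [h3, Measure.map_map (by fun_prop) hL, Measure.map_map hL (by fun_prop)]
    rfl
  unfold gaussianRelease
  rw [← h1, ← h2, Measure.map_prod_map _ _ (by fun_prop) (by fun_prop)]
  rfl

lemma renyiMomentLE_gaussianRelease {d : ℕ} {α : ℝ} (hα : 1 < α) {v₁ v₂ : NNReal} (hv₁ : v₁ ≠ 0)
    (hv₂ : v₂ ≠ 0) (A A' : Fin d → Fin d → ℝ) (b b' : Vec d) :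
    RenyiMomentLE α (gaussianRelease v₁ v₂ A b) (gaussianRelease v₁ v₂ A' b')
      (α * (α - 1) * ((∑ i, ∑ j, (A i j - A' i j) ^ 2) / (2 * v₁) +
        (∑ j, (b j - b' j) ^ 2) / (2 * v₂))) := by
  have hα0 : 0 ≤ α := by linarith
  have hL := measurable_toLp_vec d
  have := Measure.isProbabilityMeasure_map
    (μ := Measure.pi fun j => gaussianReal (b' j) v₂) hL.aemeasurable
  have h1 := RenyiMomentLE.pi hα0 fun i => RenyiMomentLE.pi hα0 fun j =>
    renyiMomentLE_gaussianReal α (A i j) (A' i j) hv₁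
  have h2 := (RenyiMomentLE.pi hα0 fun j =>
    renyiMomentLE_gaussianReal α (b j) (b' j) hv₂).map hα hL
  refine (h1.prod hα0 h2).mono (le_of_eq ?_)
  simp only [Finset.sum_div, Finset.mul_sum, mul_add, mul_div_assoc]

/-- The output of the algorithm as a function of the perturbed moments. -/
noncomputable def recoverFromMoments {nB d : ℕ} (pub : Dataset nB d)
    (z : (Fin d → Fin d → ℝ) × Vec d) : Vec d :=
  responseScale pub • act (invSqrt (secondMoment pub)) (act (symMatrix z.1)⁻¹ z.2)

lemma measurable_recoverFromMoments {nB d : ℕ} (pub : Dataset nB d) :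
    Measurable (recoverFromMoments pub) := by
  have hsym : Continuous fun z : (Fin d → Fin d → ℝ) × Vec d => symMatrix z.1 := by
    refine continuous_matrix fun i j => ?_
    simp only [symMatrix, Matrix.of_apply]
    fun_prop
  have hinv : ∀ i j, Measurable fun z : (Fin d → Fin d → ℝ) × Vec d =>
      (symMatrix z.1)⁻¹ i j := by
    intro i j
    -- Writing the inverse as inverse determinant times adjugate gives measurability everywhere,
    -- singular matrices included.
    simp only [Matrix.inv_def, Ring.inverse_eq_inv', Matrix.smul_apply, smul_eq_mul]
    exact hsym.matrix_det.measurable.inv.mul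
      ((hsym.matrix_adjugate.matrix_elem i j).measurable)
  have hvec : Measurable fun z : (Fin d → Fin d → ℝ) × Vec d =>
      act (symMatrix z.1)⁻¹ z.2 := by
    have : (fun z : (Fin d → Fin d → ℝ) × Vec d => act (symMatrix z.1)⁻¹ z.2) =
        fun z => WithLp.toLp 2 (fun i => ∑ j, (symMatrix z.1)⁻¹ i j * z.2 j) := rfl
    rw [this]
    refine (measurable_toLp_vec d).comp (measurable_pi_lambda _ fun i => ?_)
    refine Finset.measurable_sum _ fun j _ => (hinv i j).mul ?_
    exact (EuclideanSpace.proj (𝕜 := ℝ) j).continuous.measurable.comp measurable_snd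
  unfold recoverFromMoments act
  exact ((ContinuousLinearMap.measurable
    (Matrix.toEuclideanCLM (𝕜 := ℝ) (invSqrt (secondMoment pub)))).comp hvec).const_smul (responseScale pub)

lemma secondMoment_comm {n d : ℕ} (D : Dataset n d) (j k : Fin d) :
    secondMoment D j k = secondMoment D k j := by
  simp_rw [secondMoment_apply, mul_comm]

lemma symMatrix_add_of_symm {d : ℕ} {A : Matrix (Fin d) (Fin d) ℝ} (hA : ∀ i j, A i j = A j i)
    (W : Fin d → Fin d → ℝ) :
    symMatrix (fun i j => W i j + A i j) = A + symMatrix W := by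
  ext i j
  simp only [symMatrix, Matrix.of_apply, Matrix.add_apply]
  rcases le_total i j with h | h
  · rw [min_eq_left h, max_eq_right h, add_comm]
  · rw [min_eq_right h, max_eq_left h, add_comm, hA]

/-- Exhibits the algorithm as post-processing of a Gaussian release, so only the sensitivities of
the two moments remain to be bounded. The array noise has independent entries below the diagonal
too; `symMatrix` discards them. -/
lemma dpPMTOLSE_eq_map (τ ρ η : ℝ) {nA nB d : ℕ} (pub : Dataset nB d) (priv : Dataset nA d) :
    dpPMTOLSE τ ρ η pub priv =
      (gaussianRelease (noiseScale₁ τ ρ η d nA ^ 2).toNNReal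
        (noiseScale₂ τ ρ η d nA ^ 2).toNNReal (secondMoment (pmt τ η pub priv))
        (crossMoment (pmt τ η pub priv))).map (recoverFromMoments pub) := by
  have hs : Measurable fun w : (Fin d → Fin d → ℝ) × Vec d =>
      ((fun i j => w.1 i j + secondMoment (pmt τ η pub priv) i j),
        w.2 + crossMoment (pmt τ η pub priv)) := by fun_prop
  rw [dpPMTOLSE, noiseLaw_eq_gaussianRelease,
    ← gaussianRelease_map_add _ _ (secondMoment (pmt τ η pub priv)),
    Measure.map_map (measurable_recoverFromMoments pub) hs]
  congr 1
  funext w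
  simp only [dpRecovered, dpTransformed, noisyMoment, Function.comp_apply, recoverFromMoments,
    symMatrix_add_of_symm (secondMoment_comm _), add_comm w.2]

lemma one_add_log_pos {n : ℕ} (hn : 0 < n) {η : ℝ} (hη : 0 < η) (hη1 : η < 1) :
    0 < 1 + Real.log (2 * n / η) := by
  have hn' : (1 : ℝ) ≤ n := by exact_mod_cast hn
  have : 0 ≤ Real.log (2 * n / η) := Real.log_nonneg (by rw [le_div_iff₀ hη]; linarith)
  linarith

/-- The algorithm is `2ρ`-zCDP. -/
theorem isZCDP_dpPMTOLSE (d nA nB : ℕ) (τ ρ η : ℝ) (hd : 0 < d) (hτ : 0 < τ) (hρ : 0 < ρ)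
    (hη : 0 < η) (hη1 : η < 1) (pub : Dataset nB d) :
    IsZCDP (fun priv : Dataset nA d => dpPMTOLSE τ ρ η pub priv) (2 * ρ) := by
  have hprob : ∀ priv : Dataset nA d, IsProbabilityMeasure (dpPMTOLSE τ ρ η pub priv) :=
    fun priv => by
      rw [dpPMTOLSE_eq_map]
      have := isProbabilityMeasure_gaussianRelease (noiseScale₁ τ ρ η d nA ^ 2).toNNReal
        (noiseScale₂ τ ρ η d nA ^ 2).toNNReal (secondMoment (pmt τ η pub priv))
        (crossMoment (pmt τ η pub priv))
      exact Measure.isProbabilityMeasure_map (measurable_recoverFromMoments pub).aemeasurable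
  refine ⟨hprob, fun D D' hDD α hα => ?_⟩
  have hpD := hprob D
  have hpD' := hprob D'
  refine renyiDiv_le_of_renyiMomentLE hα ?_
  -- Neighbouring datasets have an index at which they may differ, so they are nonempty. This makes
  -- the variances positive.
  have hn : 0 < nA := by obtain ⟨i, -⟩ := hDD; exact Fin.pos i
  have hnr : (0 : ℝ) < nA := by exact_mod_cast hn
  have hdr : (0 : ℝ) < d := by exact_mod_cast hd
  have hl := one_add_log_pos hn hη hη1
  set l := 1 + Real.log (2 * nA / η) with hldef
  have hs1 : 0 < noiseScale₁ τ ρ η d nA := by unfold noiseScale₁; positivity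
  have hs2 : 0 < noiseScale₂ τ ρ η d nA := by unfold noiseScale₂; positivity
  have hs1sq : noiseScale₁ τ ρ η d nA ^ 2 = 2 * (τ * d * l) ^ 2 / (ρ * nA ^ 2) := by
    rw [noiseScale₁, div_pow, mul_pow (√(2 * ρ)), Real.sq_sqrt (by positivity)]
    field_simp
    ring
  have hs2sq : noiseScale₂ τ ρ η d nA ^ 2 = 2 * (τ * d * l) * (τ * l) / (ρ * nA ^ 2) := by
    rw [noiseScale₂, div_pow, mul_pow (√(2 * ρ)), Real.sq_sqrt (by positivity), mul_pow,
      mul_pow (2 * τ), Real.sq_sqrt hdr.le]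
    field_simp
    ring
  simp only [dpPMTOLSE_eq_map]
  have hv1 : (noiseScale₁ τ ρ η d nA ^ 2).toNNReal ≠ 0 := by
    rw [Ne, Real.toNNReal_eq_zero, not_le]; positivity
  have hv2 : (noiseScale₂ τ ρ η d nA ^ 2).toNNReal ≠ 0 := by
    rw [Ne, Real.toNNReal_eq_zero, not_le]; positivity
  have hpG := isProbabilityMeasure_gaussianRelease (noiseScale₁ τ ρ η d nA ^ 2).toNNReal
    (noiseScale₂ τ ρ η d nA ^ 2).toNNReal (secondMoment (pmt τ η pub D))
    (crossMoment (pmt τ η pub D))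
  have hpG' := isProbabilityMeasure_gaussianRelease (noiseScale₁ τ ρ η d nA ^ 2).toNNReal
    (noiseScale₂ τ ρ η d nA ^ 2).toNNReal (secondMoment (pmt τ η pub D'))
    (crossMoment (pmt τ η pub D'))
  refine ((renyiMomentLE_gaussianRelease hα hv1 hv2 _ _ _ _).map hα
    (measurable_recoverFromMoments pub)).mono ?_
  have hR : truncRadius τ d nA η ^ 2 = τ * d * l := by
    rw [truncRadius, Real.sq_sqrt (by positivity)]
  have hr : truncRadius τ 1 nA η ^ 2 = τ * l := by
    rw [truncRadius, Nat.cast_one, mul_one, Real.sq_sqrt (by positivity)]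
  have hN : Neighbors (pmt τ η pub D) (pmt τ η pub D') := by
    obtain ⟨i, hi⟩ := hDD
    exact ⟨i, fun j hj => by simp only [pmt, transform, hi j hj]⟩
  have hM := sum_secondMoment_sub_sq_le hN (R := truncRadius τ d nA η)
    (fun i => norm_clip_le (Real.sqrt_nonneg _) _) (fun i => norm_clip_le (Real.sqrt_nonneg _) _)
  have hc := sum_crossMoment_sub_sq_le hN (R := truncRadius τ d nA η) (r := truncRadius τ 1 nA η)
    (fun i => norm_clip_le (Real.sqrt_nonneg _) _) (fun i => norm_clip_le (Real.sqrt_nonneg _) _)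
    (fun i => norm_clip_le (Real.sqrt_nonneg _) _) (fun i => norm_clip_le (Real.sqrt_nonneg _) _)
  have h4 : truncRadius τ d nA η ^ 4 = (τ * d * l) ^ 2 := by rw [← hR]; ring
  rw [h4] at hM
  rw [hR, hr] at hc
  rw [Real.coe_toNNReal _ (sq_nonneg _), Real.coe_toNNReal _ (sq_nonneg _), hs1sq, hs2sq]
  -- The calibration: the sensitivity bound divided by twice the variance is exactly `ρ`, here and
  -- in `e2`. This is the origin of `2ρ`.
  have e1 : (∑ i, ∑ j, (secondMoment (pmt τ η pub D) i j -
      secondMoment (pmt τ η pub D') i j) ^ 2) / (2 * (2 * (τ * d * l) ^ 2 / (ρ * nA ^ 2))) ≤ ρ := by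
    rw [div_le_iff₀ (by positivity)]
    refine hM.trans (le_of_eq ?_)
    field_simp
    ring
  have e2 : (∑ j, (crossMoment (pmt τ η pub D) j - crossMoment (pmt τ η pub D') j) ^ 2) /
      (2 * (2 * (τ * d * l) * (τ * l) / (ρ * nA ^ 2))) ≤ ρ := by
    rw [div_le_iff₀ (by positivity)]
    refine hc.trans (le_of_eq ?_)
    field_simp
    ring
  have hα1 : 0 ≤ α * (α - 1) := mul_nonneg (by linarith) (by linarith)
  refine (mul_le_mul_of_nonneg_left (add_le_add e1 e2) hα1).trans (le_of_eq ?_)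
  ring

/-! ### Exponential moments and tail bounds -/

/-- Multiplying the `N(0, v)` density by `exp (x² / 4v)` yields `√2` times the `N(0, 2v)` density.
This puts the noise `ε` on the same exponential-square scale as the features. -/
lemma lintegral_exp_sq_gaussianReal_le {v : NNReal} {c : ℝ} (hc : 4 * (v : ℝ) ≤ c) :
    ∫⁻ x, ENNReal.ofReal (Real.exp (x ^ 2 / c)) ∂(gaussianReal 0 v) ≤ 2 := by
  rcases eq_or_ne v 0 with rfl | hv
  · simp [gaussianReal_zero_var]
  have hv' : (0 : ℝ) < v := by exact_mod_cast pos_iff_ne_zero.2 hv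
  have h2v : (2 * v : NNReal) ≠ 0 := by simpa using hv
  calc ∫⁻ x, ENNReal.ofReal (Real.exp (x ^ 2 / c)) ∂(gaussianReal 0 v)
      ≤ ∫⁻ x, ENNReal.ofReal (Real.exp (x ^ 2 / (4 * v))) ∂(gaussianReal 0 v) := by
        gcongr
    _ = ∫⁻ x, ENNReal.ofReal √2 * gaussianPDF 0 (2 * v) x := by
        rw [gaussianReal_of_var_ne_zero _ hv, lintegral_withDensity_eq_lintegral_mul _
          (measurable_gaussianPDF _ _) (by fun_prop)]
        refine lintegral_congr fun x => ?_
        rw [Pi.mul_apply, gaussianPDF, gaussianPDF, ← ENNReal.ofReal_mul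
          (gaussianPDFReal_nonneg _ _ _), ← ENNReal.ofReal_mul (Real.sqrt_nonneg _),
          gaussianPDFReal, gaussianPDFReal, mul_assoc, ← Real.exp_add, ← mul_assoc]
        have h1 : √(2 * Real.pi * ((2 * v : NNReal) : ℝ)) = √2 * √(2 * Real.pi * v) := by
          rw [← Real.sqrt_mul (by norm_num)]
          congr 1
          push_cast
          ring
        rw [h1, mul_inv, mul_inv_cancel_left₀ (by positivity)]
        congr 3
        push_cast
        field_simp
        ring
    _ = ENNReal.ofReal √2 := by
        rw [lintegral_const_mul _ (measurable_gaussianPDF _ _),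
          lintegral_gaussianPDF_eq_one _ h2v, mul_one]
    _ ≤ 2 := by
        rw [← ENNReal.ofReal_ofNat]
        exact ENNReal.ofReal_le_ofReal (by rw [Real.sqrt_le_left] <;> norm_num)

lemma lintegral_exp_mul_gaussianReal (v : NNReal) (t : ℝ) :
    ∫⁻ x, ENNReal.ofReal (Real.exp (t * x)) ∂(gaussianReal 0 v) =
      ENNReal.ofReal (Real.exp (v * t ^ 2 / 2)) := by
  rw [← ofReal_integral_eq_lintegral_ofReal (integrable_exp_mul_gaussianReal t)
    (Filter.Eventually.of_forall fun x => (Real.exp_pos _).le)]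
  have := mgf_gaussianReal (p := gaussianReal 0 v) (μ := 0) (v := v) (X := id)
    Measure.map_id t
  simp only [mgf, id, zero_mul, zero_add] at this
  rw [this]

/-- Exponential Markov inequality. -/
lemma measure_ge_le_exp_mul {Ω : Type*} [MeasurableSpace Ω] (μ : Measure Ω) {f : Ω → ℝ}
    (hf : Measurable f) (t : ℝ) :
    μ {ω | t ≤ f ω} ≤
      ENNReal.ofReal (Real.exp (-t)) * ∫⁻ ω, ENNReal.ofReal (Real.exp (f ω)) ∂μ := by
  have h := mul_meas_ge_le_lintegral (μ := μ)
    (f := fun ω => ENNReal.ofReal (Real.exp (f ω))) (by fun_prop) (ENNReal.ofReal (Real.exp t))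
  have hset : {ω | t ≤ f ω} ⊆
      {ω | ENNReal.ofReal (Real.exp t) ≤ ENNReal.ofReal (Real.exp (f ω))} :=
    fun ω hω => ENNReal.ofReal_le_ofReal (Real.exp_le_exp.2 hω)
  calc μ {ω | t ≤ f ω}
      = ENNReal.ofReal (Real.exp (-t)) * (ENNReal.ofReal (Real.exp t) * μ {ω | t ≤ f ω}) := by
        rw [← mul_assoc, ← ENNReal.ofReal_mul (Real.exp_pos _).le, ← Real.exp_add]
        simp
    _ ≤ _ := by
        gcongr
        exact (mul_le_mul_right (measure_mono hset) _).trans h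

lemma lintegral_exp_sum_pi {ι : Type*} [Fintype ι] {X : ι → Type*} [∀ i, MeasurableSpace (X i)]
    (μ : ∀ i, Measure (X i)) [∀ i, IsProbabilityMeasure (μ i)] {f : ∀ i, X i → ℝ}
    (hf : ∀ i, Measurable (f i)) :
    ∫⁻ ω, ENNReal.ofReal (Real.exp (∑ i, f i (ω i))) ∂(Measure.pi μ) =
      ∏ i, ∫⁻ x, ENNReal.ofReal (Real.exp (f i x)) ∂(μ i) := by
  rw [← lintegral_pi_prod μ fun i => by have := hf i; fun_prop]
  refine lintegral_congr fun ω => ?_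
  rw [Real.exp_sum, ENNReal.ofReal_prod_of_nonneg fun i _ => (Real.exp_pos _).le]

lemma exp_le_one_add_self_add_sq_mul (u : ℝ) :
    Real.exp u ≤ 1 + u + u ^ 2 * Real.exp |u| := by
  have h := Complex.norm_exp_sub_sum_le_norm_mul_exp (u : ℂ) 2
  have h2 : (Complex.exp u - ∑ m ∈ Finset.range 2, (u : ℂ) ^ m / m.factorial) =
      ((Real.exp u - (1 + u) : ℝ) : ℂ) := by
    simp [Finset.sum_range_succ]
  rw [h2, Complex.norm_real, Complex.norm_real, Real.norm_eq_abs, Real.norm_eq_abs, sq_abs] at h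
  linarith [le_abs_self (Real.exp u - (1 + u))]

section SubExponential

variable {Ω : Type*} [MeasurableSpace Ω] {μ : Measure Ω} {X : Ω → ℝ} {b : ℝ}

lemma integrable_exp_abs_div (hX : Measurable X)
    (h : ∫⁻ ω, ENNReal.ofReal (Real.exp (|X ω| / b)) ∂μ ≤ 2) :
    Integrable (fun ω => Real.exp (|X ω| / b)) μ := by
  refine ⟨by fun_prop, ?_⟩
  rw [hasFiniteIntegral_iff_ofReal (Filter.Eventually.of_forall fun _ => (Real.exp_pos _).le)]
  exact h.trans_lt (by simp)

lemma integrable_of_lintegral_exp_abs_le (hb : 0 < b) (hX : Measurable X)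
    (h : ∫⁻ ω, ENNReal.ofReal (Real.exp (|X ω| / b)) ∂μ ≤ 2) : Integrable X μ := by
  refine ((integrable_exp_abs_div hX h).const_mul b).mono' hX.aestronglyMeasurable
    (Filter.Eventually.of_forall fun ω => ?_)
  have := Real.add_one_le_exp (|X ω| / b)
  rw [Real.norm_eq_abs]
  calc |X ω| = b * (|X ω| / b) := by field_simp
    _ ≤ b * Real.exp (|X ω| / b) := by gcongr; linarith

variable [IsProbabilityMeasure μ]

/-- A variable with `E exp (|X|/b) ≤ 2` has, after centering, a Gaussian-type moment generating
function for small `l`. The second-order Taylor remainder `u² exp |u|` is absorbed into `exp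
(|X|/b)`. -/
lemma lintegral_exp_mul_le (hb : 0 < b) (hX : Measurable X)
    (h : ∫⁻ ω, ENNReal.ofReal (Real.exp (|X ω| / b)) ∂μ ≤ 2) {l : ℝ}
    (hl : |l| ≤ 1 / (2 * b)) :
    ∫⁻ ω, ENNReal.ofReal (Real.exp (l * (X ω - ∫ x, X x ∂μ))) ∂μ ≤
      ENNReal.ofReal (Real.exp (16 * l ^ 2 * b ^ 2)) := by
  have hXi := integrable_of_lintegral_exp_abs_le hb hX h
  have hEi := integrable_exp_abs_div hX h
  set m := ∫ x, X x ∂μ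
  have hE2 : ∫ ω, Real.exp (|X ω| / b) ∂μ ≤ 2 := by
    rw [integral_eq_lintegral_of_nonneg_ae
      (Filter.Eventually.of_forall fun _ => (Real.exp_pos _).le) hEi.1]
    exact ENNReal.toReal_le_of_le_ofReal (by norm_num) (by simpa using h)
  have hpt : ∀ ω, Real.exp (l * X ω) ≤
      1 + l * X ω + 8 * l ^ 2 * b ^ 2 * Real.exp (|X ω| / b) := by
    intro ω
    refine (exp_le_one_add_self_add_sq_mul _).trans (add_le_add le_rfl ?_)
    -- Half of the exponent `|X|/b = 2s` pays for `exp |l X|` and the other half for the square,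
    -- through `s² ≤ 2 exp s`.
    set s := |X ω| / (2 * b) with hs
    have hs0 : 0 ≤ s := by positivity
    have h1 : |l * X ω| ≤ s := by
      rw [abs_mul, hs, div_eq_mul_one_div, mul_comm]
      gcongr
    have h2 : (l * X ω) ^ 2 = l ^ 2 * (4 * b ^ 2 * s ^ 2) := by
      rw [mul_pow, ← sq_abs (X ω), hs]; field_simp; ring
    have h3 : s ^ 2 ≤ 2 * Real.exp s := by
      have := Real.pow_div_factorial_le_exp s hs0 2
      norm_num at this
      linarith
    have h4 : |X ω| / b = s + s := by rw [hs]; field_simp; ring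
    rw [h4, Real.exp_add, h2]
    calc l ^ 2 * (4 * b ^ 2 * s ^ 2) * Real.exp |l * X ω|
        ≤ l ^ 2 * (4 * b ^ 2 * (2 * Real.exp s)) * Real.exp s := by gcongr
      _ = _ := by ring
  have hint : Integrable (fun ω => 1 + l * X ω + 8 * l ^ 2 * b ^ 2 * Real.exp (|X ω| / b)) μ :=
    ((integrable_const _).add (hXi.const_mul l)).add (hEi.const_mul _)
  have hexp : ∫⁻ ω, ENNReal.ofReal (Real.exp (l * X ω)) ∂μ ≤
      ENNReal.ofReal (Real.exp (l * m + 16 * l ^ 2 * b ^ 2)) := by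
    calc ∫⁻ ω, ENNReal.ofReal (Real.exp (l * X ω)) ∂μ
        ≤ ∫⁻ ω, ENNReal.ofReal
            (1 + l * X ω + 8 * l ^ 2 * b ^ 2 * Real.exp (|X ω| / b)) ∂μ :=
          lintegral_mono fun ω => ENNReal.ofReal_le_ofReal (hpt ω)
      _ = ENNReal.ofReal
            (∫ ω, 1 + l * X ω + 8 * l ^ 2 * b ^ 2 * Real.exp (|X ω| / b) ∂μ) := by
          rw [ofReal_integral_eq_lintegral_ofReal hint
            (Filter.Eventually.of_forall fun ω => (Real.exp_pos _).le.trans (hpt ω))]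
      _ ≤ _ := by
          refine ENNReal.ofReal_le_ofReal ?_
          rw [integral_add (f := fun ω => 1 + l * X ω)
              ((integrable_const _).add (hXi.const_mul l)) (hEi.const_mul _),
            integral_add (f := fun _ => (1 : ℝ)) (integrable_const _) (hXi.const_mul l),
            integral_const_mul, integral_const_mul]
          simp only [integral_const, probReal_univ, smul_eq_mul, mul_one]
          have h5 := Real.add_one_le_exp (l * m + 16 * l ^ 2 * b ^ 2)
          have h6 : 8 * l ^ 2 * b ^ 2 * ∫ ω, Real.exp (|X ω| / b) ∂μ ≤ 8 * l ^ 2 * b ^ 2 * 2 := by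
            gcongr
          linarith
  calc ∫⁻ ω, ENNReal.ofReal (Real.exp (l * (X ω - m))) ∂μ
      = ∫⁻ ω, ENNReal.ofReal (Real.exp (-(l * m))) * ENNReal.ofReal (Real.exp (l * X ω)) ∂μ := by
        refine lintegral_congr fun ω => ?_
        rw [← ENNReal.ofReal_mul (Real.exp_pos _).le, ← Real.exp_add]
        congr 2; ring
    _ ≤ ENNReal.ofReal (Real.exp (-(l * m))) *
          ENNReal.ofReal (Real.exp (l * m + 16 * l ^ 2 * b ^ 2)) := by
        rw [lintegral_const_mul _ (by fun_prop)]
        gcongr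
    _ = _ := by
        rw [← ENNReal.ofReal_mul (Real.exp_pos _).le, ← Real.exp_add]
        congr 2; ring

/-- Chernoff's method. The condition `32 b² l ≤ t` makes the quadratic term `16 l² b²` at most half
of the linear gain `l t`. -/
lemma measure_pi_sum_sub_integral_ge_le (hb : 0 < b) (hX : Measurable X)
    (h : ∫⁻ ω, ENNReal.ofReal (Real.exp (|X ω| / b)) ∂μ ≤ 2) {t l : ℝ} (n : ℕ)
    (hl0 : 0 ≤ l) (hl : l ≤ 1 / (2 * b)) (hlt : 32 * b ^ 2 * l ≤ t) :
    Measure.pi (fun _ : Fin n => μ) {ω | n * t ≤ ∑ i, (X (ω i) - ∫ x, X x ∂μ)} ≤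
      ENNReal.ofReal (Real.exp (-(l * t / 2 * n))) := by
  set m := ∫ x, X x ∂μ
  have hset : {ω : Fin n → Ω | n * t ≤ ∑ i, (X (ω i) - m)} ⊆
      {ω | l * (n * t) ≤ ∑ i, l * (X (ω i) - m)} := by
    intro ω hω
    simp only [Set.mem_ofPred_eq, ← Finset.mul_sum] at hω ⊢
    gcongr
  refine (measure_mono hset).trans ((measure_ge_le_exp_mul _
    (f := fun ω : Fin n → Ω => ∑ i, l * (X (ω i) - m)) (by fun_prop) _).trans ?_)
  rw [lintegral_exp_sum_pi (fun _ : Fin n => μ) (f := fun _ x => l * (X x - m))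
    fun i => by fun_prop]
  calc _ ≤ ENNReal.ofReal (Real.exp (-(l * (n * t)))) *
        ∏ _i : Fin n, ENNReal.ofReal (Real.exp (16 * l ^ 2 * b ^ 2)) := by
        gcongr
        exact lintegral_exp_mul_le hb hX h (by rwa [abs_of_nonneg hl0])
    _ ≤ _ := by
        rw [Finset.prod_const, Finset.card_univ, Fintype.card_fin,
          ← ENNReal.ofReal_pow (Real.exp_pos _).le, ← Real.exp_nat_mul,
          ← ENNReal.ofReal_mul (Real.exp_pos _).le, ← Real.exp_add]
        refine ENNReal.ofReal_le_ofReal (Real.exp_le_exp.2 ?_)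
        have h1 : (n : ℝ) * l * (32 * b ^ 2 * l) ≤ n * l * t := by gcongr
        linarith

end SubExponential

/-- Bernstein-type concentration at a fixed scale for averages of subexponential variables. -/
lemma exists_measure_pi_abs_sum_ge_le {b t : ℝ} (hb : 0 < b) (ht : 0 < t) :
    ∃ c : ℝ, 0 < c ∧ ∀ {Ω : Type*} [MeasurableSpace Ω] (μ : Measure Ω) [IsProbabilityMeasure μ]
      (X : Ω → ℝ), Measurable X →
      ∫⁻ ω, ENNReal.ofReal (Real.exp (|X ω| / b)) ∂μ ≤ 2 → ∀ n : ℕ,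
      Measure.pi (fun _ : Fin n => μ) {ω | n * t ≤ |∑ i, (X (ω i) - ∫ x, X x ∂μ)|} ≤
        ENNReal.ofReal (2 * Real.exp (-(c * n))) := by
  -- The largest tilt allowed by both conditions of the one-sided bound. It depends on `b` and `t`
  -- only, hence so does the rate `l t / 2`.
  set l := min (t / (32 * b ^ 2)) (1 / (2 * b)) with hl
  have hl0 : 0 < l := lt_min (by positivity) (by positivity)
  have hlt : 32 * b ^ 2 * l ≤ t := by
    calc 32 * b ^ 2 * l ≤ 32 * b ^ 2 * (t / (32 * b ^ 2)) := by
          gcongr; exact min_le_left _ _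
      _ = t := by field_simp
  refine ⟨l * t / 2, by positivity, fun {Ω} _ μ _ X hX h n => ?_⟩
  have h1 := measure_pi_sum_sub_integral_ge_le hb hX h n hl0.le (min_le_right _ _) hlt
  have h2 := measure_pi_sum_sub_integral_ge_le hb hX.neg
    (by simpa only [Pi.neg_apply, abs_neg] using h) n hl0.le (min_le_right _ _) hlt
  have hset : {ω : Fin n → Ω | (n : ℝ) * t ≤ |∑ i : Fin n, (X (ω i) - ∫ x, X x ∂μ)|} ⊆
      {ω : Fin n → Ω | (n : ℝ) * t ≤ ∑ i : Fin n, (X (ω i) - ∫ x, X x ∂μ)} ∪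
      {ω : Fin n → Ω | (n : ℝ) * t ≤ ∑ i : Fin n, ((-X) (ω i) - ∫ x, (-X) x ∂μ)} := by
    intro ω hω
    rcases le_abs.1 (Set.mem_ofPred_eq ▸ hω) with h | h
    · exact Or.inl h
    · refine Or.inr ?_
      simp only [Set.mem_ofPred_eq, Pi.neg_apply, integral_neg]
      rw [← Finset.sum_neg_distrib] at h
      exact h.trans_eq (Finset.sum_congr rfl fun i _ => by ring)
  refine (measure_mono hset).trans ((measure_union_le _ _).trans ((add_le_add h1 h2).trans ?_))
  rw [← ENNReal.ofReal_add (Real.exp_pos _).le (Real.exp_pos _).le, two_mul]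

/-! ### A net of the unit ball -/

/-- A 1/2-separated subset of the unit ball of maximal cardinality is a net, since any uncovered
point could be added. Doubling it gives a 1-separated set in the ball of radius 2, which has at most
`5 ^ d` points. -/
lemma exists_half_net (d : ℕ) :
    ∃ N : Finset (Vec d), N.card ≤ 5 ^ d ∧ (∀ u ∈ N, ‖u‖ ≤ 1) ∧
      ∀ u : Vec d, ‖u‖ ≤ 1 → ∃ v ∈ N, ‖u - v‖ ≤ 1 / 2 := by
  classical
  let P : Finset (Vec d) → Prop := fun s =>
    (∀ u ∈ s, ‖u‖ ≤ 1) ∧ ∀ u ∈ s, ∀ v ∈ s, u ≠ v → 1 / 2 ≤ ‖u - v‖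
  have hcard : ∀ s, P s → s.card ≤ 5 ^ d := by
    intro s hs
    have hinj : Function.Injective fun u : Vec d => (2 : ℝ) • u := smul_right_injective _ two_ne_zero
    have := Besicovitch.card_le_of_separated (s.image fun u => (2 : ℝ) • u) ?_ ?_
    · rwa [Finset.card_image_of_injective _ hinj, finrank_euclideanSpace_fin] at this
    · simp only [Finset.mem_image, forall_exists_index, and_imp, forall_apply_eq_imp_iff₂]
      intro u hu
      rw [norm_smul, Real.norm_ofNat]
      linarith [hs.1 u hu]
    · simp only [Finset.mem_image, forall_exists_index, and_imp, forall_apply_eq_imp_iff₂]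
      intro u hu v hv huv
      rw [← smul_sub, norm_smul, Real.norm_ofNat]
      linarith [hs.2 u hu v hv fun h => huv (by rw [h])]
  let A : Set ℕ := {k | ∃ s, P s ∧ s.card = k}
  have hne : A.Nonempty := ⟨0, ∅, ⟨by simp, by simp⟩, rfl⟩
  have hbdd : BddAbove A := ⟨5 ^ d, by rintro _ ⟨s, hs, rfl⟩; exact hcard s hs⟩
  obtain ⟨s, hs, hsc⟩ := Nat.sSup_mem hne hbdd
  refine ⟨s, hcard s hs, hs.1, fun u hu => ?_⟩
  by_contra! hcon
  have hus : u ∉ s := fun h => by simpa using (hcon u h).trans_le' (by norm_num : (0 : ℝ) ≤ 1 / 2)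
  have hins : P (insert u s) := by
    refine ⟨fun w hw => ?_, fun w hw z hz hwz => ?_⟩
    · rcases Finset.mem_insert.1 hw with rfl | hw
      exacts [hu, hs.1 w hw]
    · rcases Finset.mem_insert.1 hw with hwu | hw <;> rcases Finset.mem_insert.1 hz with hzu | hz
      · exact absurd (hwu.trans hzu.symm) hwz
      · rw [hwu]; exact (hcon z hz).le
      · rw [hzu, norm_sub_rev]; exact (hcon w hw).le
      · exact hs.2 w hw z hz hwz
  have : (insert u s).card ≤ sSup A := le_csSup hbdd ⟨_, hins, rfl⟩
  rw [Finset.card_insert_of_notMem hus, hsc] at this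
  omega

/-- Approximating a unit vector by a net point gives `‖F‖ ≤ δ + ‖F‖ / 2`. For bilinear forms this is
applied in each variable, whence the factor `4` below. -/
lemma abs_le_of_half_net {d : ℕ} {N : Finset (Vec d)}
    (hN : ∀ u : Vec d, ‖u‖ ≤ 1 → ∃ v ∈ N, ‖u - v‖ ≤ 1 / 2) (f : Vec d →ₗ[ℝ] ℝ) {δ : ℝ}
    (h : ∀ v ∈ N, |f v| ≤ δ) (u : Vec d) : |f u| ≤ 2 * δ * ‖u‖ := by
  set F : Vec d →L[ℝ] ℝ := LinearMap.toContinuousLinearMap f with hF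
  have hδ : 0 ≤ δ := by
    obtain ⟨v, hv, -⟩ := hN 0 (by simp)
    exact (abs_nonneg _).trans (h v hv)
  have hnorm : ‖F‖ ≤ δ + ‖F‖ / 2 := by
    refine ContinuousLinearMap.opNorm_le_of_unit_norm (by positivity) fun u hu => ?_
    obtain ⟨v, hv, huv⟩ := hN u hu.le
    calc ‖F u‖ = ‖F v + F (u - v)‖ := by rw [← map_add]; congr 2; abel
      _ ≤ ‖F v‖ + ‖F (u - v)‖ := norm_add_le _ _
      _ ≤ δ + ‖F‖ * (1 / 2) := by
          refine add_le_add (h v hv) ((F.le_opNorm _).trans ?_)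
          gcongr
      _ = δ + ‖F‖ / 2 := by ring
  have h2 : ‖F‖ ≤ 2 * δ := by linarith
  calc |f u| = ‖F u‖ := rfl
    _ ≤ ‖F‖ * ‖u‖ := F.le_opNorm u
    _ ≤ 2 * δ * ‖u‖ := by gcongr

lemma abs_bilin_le_of_half_net {d : ℕ} {N : Finset (Vec d)}
    (hN : ∀ u : Vec d, ‖u‖ ≤ 1 → ∃ v ∈ N, ‖u - v‖ ≤ 1 / 2) (B : Vec d →ₗ[ℝ] Vec d →ₗ[ℝ] ℝ)
    {δ : ℝ} (h : ∀ u ∈ N, ∀ v ∈ N, |B u v| ≤ δ) (u v : Vec d) :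
    |B u v| ≤ 4 * δ * ‖u‖ * ‖v‖ := by
  have h1 : ∀ w ∈ N, |B u w| ≤ 2 * δ * ‖u‖ := fun w hw =>
    abs_le_of_half_net hN (B.flip w) (fun z hz => h z hz w hw) u
  exact (abs_le_of_half_net hN (B u) h1 v).trans_eq (by ring)

/-! ### Matrices acting on Euclidean space -/

section Act

variable {d : ℕ}

lemma act_mul (M N : Matrix (Fin d) (Fin d) ℝ) (v : Vec d) : act (M * N) v = act M (act N v) := by
  simp [act]

lemma act_one (v : Vec d) : act 1 v = v := by
  simp [act]

lemma act_add (M : Matrix (Fin d) (Fin d) ℝ) (u v : Vec d) : act M (u + v) = act M u + act M v :=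
  map_add _ _ _

lemma act_sub (M : Matrix (Fin d) (Fin d) ℝ) (u v : Vec d) : act M (u - v) = act M u - act M v :=
  map_sub _ _ _

lemma act_smul (M : Matrix (Fin d) (Fin d) ℝ) (c : ℝ) (v : Vec d) : act M (c • v) = c • act M v :=
  map_smul _ _ _

lemma add_act (M N : Matrix (Fin d) (Fin d) ℝ) (v : Vec d) : act (M + N) v = act M v + act N v := by
  simp [act]

lemma norm_act_le (M : Matrix (Fin d) (Fin d) ℝ) (v : Vec d) : ‖act M v‖ ≤ opNorm M * ‖v‖ :=
  ContinuousLinearMap.le_opNorm _ _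

lemma opNorm_nonneg (M : Matrix (Fin d) (Fin d) ℝ) : 0 ≤ opNorm M := norm_nonneg _

lemma opNorm_le {M : Matrix (Fin d) (Fin d) ℝ} {c : ℝ} (hc : 0 ≤ c)
    (h : ∀ v : Vec d, ‖act M v‖ ≤ c * ‖v‖) : opNorm M ≤ c :=
  ContinuousLinearMap.opNorm_le_bound _ hc h

lemma inner_act (M : Matrix (Fin d) (Fin d) ℝ) (u v : Vec d) :
    inner ℝ u (act M v) = ∑ i, ∑ j, M i j * (u i * v j) := by
  rw [act, Matrix.inner_toEuclideanCLM, dotProduct]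
  refine Finset.sum_congr rfl fun i _ => ?_
  rw [Matrix.mulVec, dotProduct, Finset.mul_sum]
  exact Finset.sum_congr rfl fun j _ => by ring

lemma inner_act_eq_inner_act_transpose (M : Matrix (Fin d) (Fin d) ℝ) (u v : Vec d) :
    inner ℝ u (act M v) = inner ℝ (act Mᵀ u) v := by
  rw [real_inner_comm v, inner_act, inner_act, Finset.sum_comm]
  refine Finset.sum_congr rfl fun i _ => Finset.sum_congr rfl fun j _ => ?_
  rw [Matrix.transpose_apply]; ring

lemma inner_secondMoment {n : ℕ} (D : Dataset n d) (u v : Vec d) :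
    inner ℝ u (act (secondMoment D) v) =
      (n : ℝ)⁻¹ * ∑ i, inner ℝ u (D i).1 * inner ℝ v (D i).1 := by
  rw [inner_act]
  simp only [secondMoment_apply, PiLp.inner_apply, RCLike.inner_apply, conj_trivial,
    Finset.mul_sum, Finset.sum_mul]
  rw [Finset.sum_congr rfl fun _ _ => Finset.sum_comm, Finset.sum_comm]
  refine Finset.sum_congr rfl fun i _ => ?_
  rw [Finset.sum_comm]
  refine Finset.sum_congr rfl fun j _ => Finset.sum_congr rfl fun k _ => ?_
  ring

lemma inner_crossMoment {n : ℕ} (D : Dataset n d) (u : Vec d) :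
    inner ℝ u (crossMoment D) = (n : ℝ)⁻¹ * ∑ i, inner ℝ u (D i).1 * (D i).2 := by
  simp only [PiLp.inner_apply, RCLike.inner_apply, conj_trivial, crossMoment_apply,
    Finset.mul_sum, Finset.sum_mul]
  rw [Finset.sum_comm]
  refine Finset.sum_congr rfl fun i _ => Finset.sum_congr rfl fun j _ => ?_
  ring

lemma posDef_iff_inner_act {M : Matrix (Fin d) (Fin d) ℝ} :
    M.PosDef ↔ Mᵀ = M ∧ ∀ v : Vec d, v ≠ 0 → 0 < inner ℝ v (act M v) := by
  rw [Matrix.posDef_iff_dotProduct_mulVec]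
  refine and_congr (by rw [Matrix.IsHermitian, Matrix.conjTranspose_eq_transpose_of_trivial])
    ⟨fun h v hv => ?_, fun h x hx => ?_⟩
  · rw [act, Matrix.inner_toEuclideanCLM]
    simpa using h (x := WithLp.ofLp v) (by simpa using hv)
  · have := h (WithLp.toLp 2 x) (by simpa using hx)
    rw [act, Matrix.inner_toEuclideanCLM] at this
    simpa using this

lemma transpose_secondMoment {n : ℕ} (D : Dataset n d) : (secondMoment D)ᵀ = secondMoment D := by
  ext i j
  exact secondMoment_comm D j i

lemma isUnit_det_of_posDef {M : Matrix (Fin d) (Fin d) ℝ} (h : M.PosDef) : IsUnit M.det :=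
  h.det_pos.ne'.isUnit

lemma transpose_sqrt (S : Matrix (Fin d) (Fin d) ℝ) : (CFC.sqrt S)ᵀ = CFC.sqrt S := by
  rw [← Matrix.conjTranspose_eq_transpose_of_trivial]
  exact (Matrix.nonneg_iff_posSemidef.1 (CFC.sqrt_nonneg S)).isHermitian

lemma transpose_invSqrt (S : Matrix (Fin d) (Fin d) ℝ) : (invSqrt S)ᵀ = invSqrt S := by
  rw [invSqrt, Matrix.transpose_nonsing_inv, transpose_sqrt S]

lemma inner_act_invSqrt (S : Matrix (Fin d) (Fin d) ℝ) (u v : Vec d) :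
    inner ℝ u (act (invSqrt S) v) = inner ℝ (act (invSqrt S) u) v := by
  rw [inner_act_eq_inner_act_transpose, transpose_invSqrt S]

section Sqrt

variable {S : Matrix (Fin d) (Fin d) ℝ}

lemma sqrt_mul_sqrt (hS : S.PosDef) : CFC.sqrt S * CFC.sqrt S = S :=
  CFC.sqrt_mul_sqrt_self S (Matrix.nonneg_iff_posSemidef.2 hS.posSemidef)

lemma isUnit_det_sqrt (hS : S.PosDef) : IsUnit (CFC.sqrt S).det := by
  have h := isUnit_det_of_posDef hS
  rw [← sqrt_mul_sqrt hS, Matrix.det_mul] at h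
  exact isUnit_of_mul_isUnit_left h

lemma invSqrt_mul_sqrt (hS : S.PosDef) : invSqrt S * CFC.sqrt S = 1 :=
  Matrix.nonsing_inv_mul _ (isUnit_det_sqrt hS)

lemma sqrt_mul_invSqrt (hS : S.PosDef) : CFC.sqrt S * invSqrt S = 1 :=
  Matrix.mul_nonsing_inv _ (isUnit_det_sqrt hS)

lemma act_invSqrt_act_sqrt (hS : S.PosDef) (v : Vec d) :
    act (invSqrt S) (act (CFC.sqrt S) v) = v := by
  rw [← act_mul, invSqrt_mul_sqrt hS, act_one]

lemma act_sqrt_act_invSqrt (hS : S.PosDef) (v : Vec d) :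
    act (CFC.sqrt S) (act (invSqrt S) v) = v := by
  rw [← act_mul, sqrt_mul_invSqrt hS, act_one]

lemma invSqrt_mul_invSqrt (hS : S.PosDef) : invSqrt S * invSqrt S = S⁻¹ := by
  rw [invSqrt, ← Matrix.mul_inv_rev, sqrt_mul_sqrt hS]

lemma inner_act_eq_inner_sqrt (hS : S.PosDef) (u v : Vec d) :
    inner ℝ u (act S v) = inner ℝ (act (CFC.sqrt S) u) (act (CFC.sqrt S) v) := by
  conv_lhs => rw [← sqrt_mul_sqrt hS, act_mul, inner_act_eq_inner_act_transpose, transpose_sqrt S]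

lemma inner_act_self (hS : S.PosDef) (v : Vec d) :
    inner ℝ v (act S v) = ‖act (CFC.sqrt S) v‖ ^ 2 := by
  rw [inner_act_eq_inner_sqrt hS, real_inner_self_eq_norm_sq]

lemma inner_invSqrt_act (hS : S.PosDef) (u v : Vec d) :
    inner ℝ (act (invSqrt S) u) (act S (act (invSqrt S) v)) = inner ℝ u v := by
  rw [inner_act_eq_inner_sqrt hS, act_sqrt_act_invSqrt hS, act_sqrt_act_invSqrt hS]

lemma opNorm_invSqrt_sq (hS : S.PosDef) : opNorm (invSqrt S) ^ 2 ≤ opNorm S⁻¹ := by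
  have h : ∀ v : Vec d, ‖act (invSqrt S) v‖ ≤ √(opNorm S⁻¹) * ‖v‖ := by
    intro v
    refine abs_le_of_sq_le_sq' ?_ (by positivity) |>.2
    rw [mul_pow, Real.sq_sqrt (opNorm_nonneg _), ← real_inner_self_eq_norm_sq,
      ← inner_act_invSqrt S, ← act_mul, invSqrt_mul_invSqrt hS]
    calc inner ℝ v (act S⁻¹ v) ≤ ‖v‖ * ‖act S⁻¹ v‖ := real_inner_le_norm _ _
      _ ≤ ‖v‖ * (opNorm S⁻¹ * ‖v‖) := by gcongr; exact norm_act_le _ _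
      _ = _ := by ring
  have := opNorm_le (Real.sqrt_nonneg _) h
  calc opNorm (invSqrt S) ^ 2 ≤ √(opNorm S⁻¹) ^ 2 := by
        gcongr; exact opNorm_nonneg _
    _ = _ := Real.sq_sqrt (opNorm_nonneg _)

end Sqrt

end Act

/-! ### Moments of a sample -/

/-- `E y²` for a response `y = ⟨x, β⟩ + ε`. -/
noncomputable def responseVar {d : ℕ} (S : Matrix (Fin d) (Fin d) ℝ) (β : Vec d) (σ : ℝ) : ℝ :=
  inner ℝ β (act S β) + σ ^ 2

lemma exp_half_add_le (a b : ℝ) :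
    Real.exp ((a + b) / 2) ≤ (Real.exp a + Real.exp b) / 2 := by
  have ha : Real.exp a = Real.exp (a / 2) ^ 2 := by rw [← Real.exp_nat_mul]; congr 1; push_cast; ring
  have hb : Real.exp b = Real.exp (b / 2) ^ 2 := by rw [← Real.exp_nat_mul]; congr 1; push_cast; ring
  rw [add_div, Real.exp_add, ha, hb]
  nlinarith [sq_nonneg (Real.exp (a / 2) - Real.exp (b / 2))]

/-- Convexity of `exp`. It replaces the triangle and Cauchy–Schwarz inequalities for `ψ₂`-norms and
needs no independence. -/
lemma lintegral_exp_le_of_le_half_add {Ω : Type*} [MeasurableSpace Ω] {μ : Measure Ω}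
    {f g h : Ω → ℝ} (hg : Measurable g) (hh : Measurable h)
    (hgI : ∫⁻ ω, ENNReal.ofReal (Real.exp (g ω)) ∂μ ≤ 2)
    (hhI : ∫⁻ ω, ENNReal.ofReal (Real.exp (h ω)) ∂μ ≤ 2)
    (hle : ∀ ω, f ω ≤ (g ω + h ω) / 2) :
    ∫⁻ ω, ENNReal.ofReal (Real.exp (f ω)) ∂μ ≤ 2 := by
  calc ∫⁻ ω, ENNReal.ofReal (Real.exp (f ω)) ∂μ
      ≤ ∫⁻ ω, 2⁻¹ * (ENNReal.ofReal (Real.exp (g ω)) + ENNReal.ofReal (Real.exp (h ω))) ∂μ := by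
        refine lintegral_mono fun ω => ?_
        have h2 : (2⁻¹ : ℝ≥0∞) = ENNReal.ofReal (2⁻¹ : ℝ) := by
          rw [ENNReal.ofReal_inv_of_pos two_pos, ENNReal.ofReal_ofNat]
        rw [← ENNReal.ofReal_add (Real.exp_pos _).le (Real.exp_pos _).le, h2,
          ← ENNReal.ofReal_mul (by norm_num)]
        refine ENNReal.ofReal_le_ofReal ?_
        have := (Real.exp_le_exp.2 (hle ω)).trans (exp_half_add_le (g ω) (h ω))
        linarith
    _ ≤ 2⁻¹ * (2 + 2) := by
        rw [lintegral_const_mul _ (by fun_prop), lintegral_add_left (by fun_prop)]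
        gcongr
    _ = 2 := by
        rw [← two_mul, ← mul_assoc, ENNReal.inv_mul_cancel two_ne_zero ENNReal.ofNat_ne_top,
          one_mul]

section Sample

variable {d : ℕ} {ν : Measure (Vec d)} {S : Matrix (Fin d) (Fin d) ℝ} {K : ℝ}

lemma IsSubG.inner_nonneg (hν : IsSubG ν S K) (v : Vec d) : 0 ≤ inner ℝ v (act S v) := by
  rw [inner_act_self hν.posDef]; positivity

lemma IsSubG.lintegral_exp_sq_le (hν : IsSubG ν S K) (hK : 0 < K) (v : Vec d) {c : ℝ}
    (hc : K ^ 2 * inner ℝ v (act S v) ≤ c) :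
    ∫⁻ x, ENNReal.ofReal (Real.exp (inner ℝ v x ^ 2 / c)) ∂ν ≤ 2 := by
  have := hν.isProbabilityMeasure
  rcases eq_or_ne v 0 with rfl | hv
  · simp
  refine le_trans (lintegral_mono fun x => ?_) (hν.psiTwo_le v)
  have hpos : 0 < inner ℝ v (act S v) := (posDef_iff_inner_act.1 hν.posDef).2 v hv
  exact ENNReal.ofReal_le_ofReal (Real.exp_le_exp.2 (by gcongr))

lemma integrable_coord_mul_coord_sum (hν : IsSubG ν S K) (u v : Vec d) :
    Integrable (fun x => inner ℝ u x * inner ℝ v x) ν ∧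
      ∫ x, inner ℝ u x * inner ℝ v x ∂ν = inner ℝ u (act S v) := by
  have hexp : (fun x : Vec d => inner ℝ u x * inner ℝ v x) =
      fun x => ∑ i, ∑ j, u i * v j * (x i * x j) := by
    funext x
    simp only [PiLp.inner_apply, RCLike.inner_apply, conj_trivial, Finset.sum_mul_sum]
    exact Finset.sum_congr rfl fun i _ => Finset.sum_congr rfl fun j _ => by ring
  have hint : ∀ i j, Integrable (fun x : Vec d => u i * v j * (x i * x j)) ν :=
    fun i j => (hν.integrable i j).const_mul _
  rw [hexp]
  refine ⟨integrable_finsetSum _ fun i _ => integrable_finsetSum _ fun j _ => hint i j, ?_⟩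
  rw [integral_finsetSum _ fun i _ => integrable_finsetSum _ fun j _ => hint i j, inner_act]
  refine Finset.sum_congr rfl fun i _ => ?_
  rw [integral_finsetSum _ fun j _ => hint i j]
  refine Finset.sum_congr rfl fun j _ => ?_
  rw [integral_const_mul, hν.secondMoment_eq]
  ring

lemma measurable_sample (β : Vec d) :
    Measurable fun p : Vec d × ℝ => (p.1, inner ℝ p.1 β + p.2) := by fun_prop

lemma isProbabilityMeasure_sampleLaw [IsProbabilityMeasure ν] (β : Vec d) (σ : ℝ) :
    IsProbabilityMeasure (sampleLaw ν β σ) :=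
  Measure.isProbabilityMeasure_map (measurable_sample β).aemeasurable

lemma measurePreserving_fst_sampleLaw [IsProbabilityMeasure ν] (β : Vec d) (σ : ℝ) :
    MeasurePreserving Prod.fst (sampleLaw ν β σ) ν := by
  refine ⟨measurable_fst, ?_⟩
  rw [sampleLaw, Measure.map_map measurable_fst (measurable_sample β)]
  exact Measure.map_fst_prod.trans (by simp)

/-- From `y² ≤ 2 (⟨β, x⟩² + ε²)`, each summand may be measured at scale `c / 4 = (K² + 4) E y²`.
This dominates both `K² E⟨β, x⟩²` and `4 σ²`, as the two exponential moments require. -/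
lemma IsSubG.lintegral_exp_sq_response_le (hν : IsSubG ν S K) (hK : 0 < K) (β : Vec d) (σ : ℝ) :
    ∫⁻ p, ENNReal.ofReal (Real.exp (p.2 ^ 2 / ((4 * K ^ 2 + 16) * responseVar S β σ)))
      ∂(sampleLaw ν β σ) ≤ 2 := by
  have := hν.isProbabilityMeasure
  have hq := hν.inner_nonneg β
  set c := (4 * K ^ 2 + 16) * responseVar S β σ with hc
  have hc0 : 0 ≤ c := by rw [hc, responseVar]; positivity
  rw [sampleLaw, lintegral_map (by fun_prop) (measurable_sample β)]
  refine lintegral_exp_le_of_le_half_add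
    (g := fun p => inner ℝ β p.1 ^ 2 / (c / 4)) (h := fun p => p.2 ^ 2 / (c / 4))
    (by fun_prop) (by fun_prop) ?_ ?_ fun p => ?_
  · rw [lintegral_prod _ (by fun_prop)]
    simp only [lintegral_const, measure_univ, mul_one]
    refine hν.lintegral_exp_sq_le hK β ?_
    rw [hc, responseVar]
    nlinarith [mul_nonneg (sq_nonneg K) (sq_nonneg σ), sq_nonneg σ]
  · rw [lintegral_prod _ (by fun_prop)]
    simp only [lintegral_const, measure_univ, mul_one]
    refine lintegral_exp_sq_gaussianReal_le ?_
    rw [Real.coe_toNNReal _ (sq_nonneg σ), hc, responseVar]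
    nlinarith [mul_nonneg (sq_nonneg K) (sq_nonneg σ), sq_nonneg σ,
      mul_nonneg (sq_nonneg K) hq]
  · rw [real_inner_comm, ← add_div, div_div, div_mul_eq_mul_div]
    rcases hc0.eq_or_lt with h0 | h0
    · simp [← h0]
    have h2 : (inner ℝ β p.1 + p.2) ^ 2 ≤ 2 * (inner ℝ β p.1 ^ 2 + p.2 ^ 2) := by
      nlinarith [sq_nonneg (inner ℝ β p.1 - p.2)]
    rw [div_le_div_iff₀ h0 (by positivity)]
    linarith [mul_le_mul_of_nonneg_right h2 hc0]

lemma IsSubG.integral_response_sq (hν : IsSubG ν S K) (β : Vec d) (σ : ℝ) :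
    ∫ p, p.2 ^ 2 ∂(sampleLaw ν β σ) = responseVar S β σ := by
  have := hν.isProbabilityMeasure
  set γ := gaussianReal 0 (σ ^ 2).toNNReal with hγ
  obtain ⟨hI, hE⟩ := integrable_coord_mul_coord_sum hν β β
  have hA : Integrable (fun x : Vec d => inner ℝ β x ^ 2) ν := by simpa only [sq] using hI
  have hA1 : Integrable (fun x : Vec d => inner ℝ β x) ν := by
    have : MemLp (fun x : Vec d => inner ℝ β x) 2 ν :=
      (memLp_two_iff_integrable_sq (by fun_prop)).2 hA
    exact this.integrable (by norm_num)
  have hE2 : MemLp (fun e : ℝ => e) 2 γ := memLp_id_gaussianReal 2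
  have hEs : Integrable (fun e : ℝ => e ^ 2) γ := hE2.integrable_sq
  have hE1 : Integrable (fun e : ℝ => e) γ := hE2.integrable (by norm_num)
  have hEsv : ∫ e, e ^ 2 ∂γ = σ ^ 2 := by
    have h := variance_fun_id_gaussianReal (μ := 0) (v := (σ ^ 2).toNNReal)
    rw [variance_eq_integral (by fun_prop), integral_id_gaussianReal] at h
    simpa [Real.coe_toNNReal _ (sq_nonneg σ)] using h
  rw [sampleLaw, integral_map (measurable_sample β).aemeasurable (by fun_prop)]
  have hexp : ∀ p : Vec d × ℝ, (inner ℝ p.1 β + p.2) ^ 2 =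
      inner ℝ β p.1 ^ 2 + 2 * (inner ℝ β p.1 * p.2) + p.2 ^ 2 := by
    intro p; rw [real_inner_comm]; ring
  simp_rw [hexp]
  have i1 : Integrable (fun p : Vec d × ℝ => inner ℝ β p.1 ^ 2) (ν.prod γ) := hA.comp_fst γ
  have i2 : Integrable (fun p : Vec d × ℝ => 2 * (inner ℝ β p.1 * p.2)) (ν.prod γ) :=
    (hA1.mul_prod hE1).const_mul 2
  have i3 : Integrable (fun p : Vec d × ℝ => p.2 ^ 2) (ν.prod γ) := hEs.comp_snd ν
  rw [integral_add (f := fun p : Vec d × ℝ => inner ℝ β p.1 ^ 2 + 2 * (inner ℝ β p.1 * p.2))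
    (i1.add i2) i3, integral_add i1 i2, integral_const_mul,
    integral_prod_mul (fun x : Vec d => inner ℝ β x) (fun e : ℝ => e),
    integral_fun_fst (fun x : Vec d => inner ℝ β x ^ 2), integral_fun_snd (fun e : ℝ => e ^ 2),
    hEsv, hγ, integral_id_gaussianReal]
  simp only [probReal_univ, one_smul, mul_zero, add_zero, responseVar]
  rw [← hE]
  simp only [sq]

end Sample

/-! ### Concentration of the empirical moments -/

/-- The empirical second moment is within a factor `1 ± 1/2` of `S`, as a quadratic form. -/
def MomentClose {n d : ℕ} (S : Matrix (Fin d) (Fin d) ℝ) (D : Dataset n d) : Prop :=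
  ∀ w : Vec d, |inner ℝ w (act (secondMoment D) w) - inner ℝ w (act S w)| ≤
    inner ℝ w (act S w) / 2

/-- The mean square of the responses is within a factor `1 ± 1/2` of `v`. -/
def ResponseClose {n d : ℕ} (v : ℝ) (D : Dataset n d) : Prop :=
  |responseScale D ^ 2 - v| ≤ v / 2

lemma responseScale_sq {n d : ℕ} (D : Dataset n d) :
    responseScale D ^ 2 = (n : ℝ)⁻¹ * ∑ i, (D i).2 ^ 2 :=
  Real.sq_sqrt (by positivity)

/-- The lower bound on `n` gives `c n ≥ 4 (d + log (1/η))`: the part `4d` pays for the cardinality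
of the net, the rest for the probability. -/
lemma exp_neg_le_mul_of_le {c x η : ℝ} {d n : ℕ} (hc : 0 < c) (hη : 0 < η) (hη1 : η < 1)
    (hx : 2 / √c * (√d + √(Real.log (1 / η))) ≤ √n) (hxd : x ≤ 4 * d) :
    Real.exp x * Real.exp (-(c * n)) ≤ η := by
  have hlog : 0 ≤ Real.log (1 / η) := Real.log_nonneg (by rw [le_div_iff₀ hη]; linarith)
  have hsq : (2 / √c * (√d + √(Real.log (1 / η)))) ^ 2 ≤ n := by
    calc _ ≤ √(n : ℝ) ^ 2 := by gcongr
      _ = n := Real.sq_sqrt (by positivity)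
  have h1 : 4 * ((d : ℝ) + Real.log (1 / η)) ≤ c * n := by
    calc 4 * ((d : ℝ) + Real.log (1 / η))
        ≤ 4 * (√d + √(Real.log (1 / η))) ^ 2 := by
          rw [add_sq, Real.sq_sqrt (by positivity), Real.sq_sqrt hlog]
          have : 0 ≤ 2 * √(d : ℝ) * √(Real.log (1 / η)) := by positivity
          linarith
      _ = c * (2 / √c * (√d + √(Real.log (1 / η)))) ^ 2 := by
          rw [mul_pow, div_pow, Real.sq_sqrt hc.le]; field_simp; ring
      _ ≤ c * n := by gcongr
  rw [← Real.exp_add]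
  calc Real.exp (x + -(c * n)) ≤ Real.exp (-Real.log (1 / η)) := by
        apply Real.exp_le_exp.2; linarith
    _ = η := by rw [one_div, Real.log_inv, neg_neg, Real.exp_log hη]

lemma twenty_five_le_exp : (25 : ℝ) ≤ Real.exp 4 := by
  have h := Real.exp_one_gt_d9
  have h4 : Real.exp 4 = Real.exp 1 ^ 4 := by rw [← Real.exp_nat_mul]; norm_num
  rw [h4]
  calc (25 : ℝ) ≤ (2.7 : ℝ) ^ 4 := by norm_num
    _ ≤ Real.exp 1 ^ 4 := by gcongr; linarith

/-- After whitening by `S^{-1/2}`, deviation `1/8` on pairs of net points becomes deviation `4 · 1/8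
= 1/2` on all vectors. Substituting `S^{1/2} w` undoes the whitening. -/
lemma momentClose_of_half_net {n d : ℕ} {S : Matrix (Fin d) (Fin d) ℝ} (hS : S.PosDef)
    {N : Finset (Vec d)} (hN : ∀ u : Vec d, ‖u‖ ≤ 1 → ∃ v ∈ N, ‖u - v‖ ≤ 1 / 2)
    {D : Dataset n d}
    (h : ∀ u ∈ N, ∀ v ∈ N, |inner ℝ (act (invSqrt S) u) (act (secondMoment D)
      (act (invSqrt S) v)) - inner ℝ u v| ≤ 1 / 8) : MomentClose S D := by
  intro w
  let B : Vec d →ₗ[ℝ] Vec d →ₗ[ℝ] ℝ := LinearMap.mk₂ ℝ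
    (fun u v => inner ℝ (act (invSqrt S) u) (act (secondMoment D) (act (invSqrt S) v)) -
      inner ℝ u v)
    (fun a b c => by simp only [act_add, inner_add_left]; ring)
    (fun a b c => by simp only [act_smul, real_inner_smul_left, smul_eq_mul]; ring)
    (fun a b c => by simp only [act_add, inner_add_right]; ring)
    (fun a b c => by simp only [act_smul, real_inner_smul_right, smul_eq_mul]; ring)
  have hB := abs_bilin_le_of_half_net hN B h (act (CFC.sqrt S) w) (act (CFC.sqrt S) w)
  simp only [B, LinearMap.mk₂_apply, act_invSqrt_act_sqrt hS] at hB
  rw [← inner_act_eq_inner_sqrt hS] at hB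
  refine hB.trans (le_of_eq ?_)
  rw [inner_act_self hS]; ring

/-- Two-sided concentration of the empirical second moment. -/
lemma exists_measure_not_momentClose_le {K : ℝ} (hK : 0 < K) :
    ∃ C : ℝ, 0 < C ∧ ∀ (d n : ℕ) (η σ : ℝ) (ν : Measure (Vec d)) (S : Matrix (Fin d) (Fin d) ℝ)
      (β : Vec d), IsSubG ν S K → 0 < η → η < 1 → C * (√d + √(Real.log (1 / η))) ≤ √n →
      Measure.pi (fun _ : Fin n => sampleLaw ν β σ) {D : Dataset n d | ¬ MomentClose S D} ≤
        ENNReal.ofReal (2 * η) := by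
  -- A product of two whitened marginals is subexponential at scale `K²`, by `|a b| ≤ (a² + b²)/2`;
  -- `1/8` is the deviation required on the net.
  obtain ⟨c, hc, hconc⟩ := exists_measure_pi_abs_sum_ge_le.{0} (b := K ^ 2) (t := 1 / 8)
    (by positivity) (by norm_num)
  refine ⟨2 / √c, by positivity, fun d n η σ ν S β hν hη hη1 hn => ?_⟩
  have hprob := hν.isProbabilityMeasure
  have hprob' := isProbabilityMeasure_sampleLaw (ν := ν) β σ
  have hS := hν.posDef
  have hmp := measurePreserving_fst_sampleLaw (ν := ν) β σ
  obtain ⟨N, hcard, hN1, hN⟩ := exists_half_net d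
  set T := invSqrt S with hT
  let X : Vec d → Vec d → Vec d × ℝ → ℝ := fun u v p => inner ℝ (act T u) p.1 * inner ℝ (act T v) p.1
  have hXm : ∀ u v, Measurable (X u v) := fun u v => by fun_prop
  have hXint : ∀ u v, ∫ p, X u v p ∂(sampleLaw ν β σ) = inner ℝ u v := by
    intro u v
    have h1 := (integrable_coord_mul_coord_sum hν (act T u) (act T v)).2
    rw [inner_invSqrt_act hS, ← hmp.map_eq,
      integral_map measurable_fst.aemeasurable (by fun_prop)] at h1
    exact h1
  have hsq : ∀ u : Vec d, ‖u‖ ≤ 1 →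
      ∫⁻ p, ENNReal.ofReal (Real.exp (inner ℝ (act T u) p.1 ^ 2 / K ^ 2)) ∂(sampleLaw ν β σ) ≤ 2 := by
    intro u hu
    have h1 := hν.lintegral_exp_sq_le hK (act T u) (c := K ^ 2) (by
      rw [inner_invSqrt_act hS, real_inner_self_eq_norm_sq]
      have : ‖u‖ ^ 2 ≤ 1 := pow_le_one₀ (norm_nonneg _) hu
      nlinarith [sq_nonneg K])
    rw [← hmp.lintegral_comp (by fun_prop)] at h1
    exact h1
  have hXe : ∀ u ∈ N, ∀ v ∈ N,
      ∫⁻ p, ENNReal.ofReal (Real.exp (|X u v p| / K ^ 2)) ∂(sampleLaw ν β σ) ≤ 2 := by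
    intro u hu v hv
    refine lintegral_exp_le_of_le_half_add (by fun_prop) (by fun_prop) (hsq u (hN1 u hu))
      (hsq v (hN1 v hv)) fun p => ?_
    rw [← add_div, div_div, mul_comm (K ^ 2), ← div_div]
    gcongr
    rw [abs_mul, ← sq_abs (inner ℝ (act T u) p.1), ← sq_abs (inner ℝ (act T v) p.1)]
    nlinarith [sq_nonneg (|inner ℝ (act T u) p.1| - |inner ℝ (act T v) p.1|)]
  have hsub : {D : Dataset n d | ¬ MomentClose S D} ⊆ ⋃ u ∈ N, ⋃ v ∈ N,
      {D : Dataset n d | n * (1 / 8 : ℝ) ≤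
        |∑ i, (X u v (D i) - ∫ p, X u v p ∂(sampleLaw ν β σ))|} := by
    intro D hD
    by_contra hcon
    simp only [Set.mem_iUnion, Set.mem_ofPred_eq, not_exists, not_le, exists_prop,
      not_and] at hcon
    refine hD (momentClose_of_half_net hS hN fun u hu v hv => ?_)
    have h1 := hcon u hu v hv
    rw [hXint, Finset.sum_sub_distrib, Finset.sum_const, Finset.card_univ, Fintype.card_fin,
      nsmul_eq_mul] at h1
    have hn0 : (0 : ℝ) < n := by
      have := (abs_nonneg _).trans_lt h1
      linarith
    rw [inner_secondMoment]
    have h2 : (n : ℝ)⁻¹ * ∑ i, inner ℝ (act T u) (D i).1 * inner ℝ (act T v) (D i).1 -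
        inner ℝ u v = (n : ℝ)⁻¹ * (∑ i, X u v (D i) - n * inner ℝ u v) := by
      rw [mul_sub, inv_mul_cancel_left₀ hn0.ne']
    rw [h2, abs_mul, abs_of_pos (inv_pos.2 hn0), inv_mul_le_iff₀ hn0]
    exact h1.le
  refine (measure_mono hsub).trans ?_
  calc _ ≤ ∑ u ∈ N, ∑ v ∈ N, ENNReal.ofReal (2 * Real.exp (-(c * n))) :=
        (measure_biUnion_finset_le _ _).trans (Finset.sum_le_sum fun u hu =>
          (measure_biUnion_finset_le _ _).trans (Finset.sum_le_sum fun v hv =>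
            hconc _ (X u v) (hXm u v) (hXe u hu v hv) n))
    _ = ENNReal.ofReal ((N.card : ℝ) * (N.card * (2 * Real.exp (-(c * n))))) := by
        simp only [Finset.sum_const, nsmul_eq_mul]
        rw [ENNReal.ofReal_mul (p := (N.card : ℝ)) (by positivity),
          ENNReal.ofReal_mul (p := (N.card : ℝ)) (by positivity), ENNReal.ofReal_natCast]
    _ ≤ ENNReal.ofReal (2 * η) := by
        refine ENNReal.ofReal_le_ofReal ?_
        -- There are at most `25 ^ d ≤ exp (4 d)` pairs, which matches the exponent in
        -- `exp_neg_le_mul_of_le`.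
        have hcard' : (N.card : ℝ) ≤ 5 ^ d := by exact_mod_cast hcard
        calc (N.card : ℝ) * (N.card * (2 * Real.exp (-(c * n))))
            ≤ 5 ^ d * (5 ^ d * (2 * Real.exp (-(c * n)))) := by gcongr
          _ = 2 * ((25 : ℝ) ^ d * Real.exp (-(c * n))) := by
              rw [show (25 : ℝ) = 5 * 5 by norm_num, mul_pow]; ring
          _ ≤ 2 * (Real.exp 4 ^ d * Real.exp (-(c * n))) := by
              have := twenty_five_le_exp
              gcongr
          _ = 2 * (Real.exp (4 * d) * Real.exp (-(c * n))) := by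
              rw [← Real.exp_nat_mul, mul_comm (d : ℝ)]
          _ ≤ 2 * η := by
              gcongr
              exact exp_neg_le_mul_of_le hc hη hη1 hn le_rfl

/-- Two-sided concentration of the mean square of the responses. -/
lemma exists_measure_not_responseClose_le {K : ℝ} (hK : 0 < K) :
    ∃ C : ℝ, 0 < C ∧ ∀ (d n : ℕ) (η σ : ℝ) (ν : Measure (Vec d)) (S : Matrix (Fin d) (Fin d) ℝ)
      (β : Vec d), IsSubG ν S K → 0 < η → η < 1 → 0 < responseVar S β σ →
      C * (√d + √(Real.log (1 / η))) ≤ √n →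
      Measure.pi (fun _ : Fin n => sampleLaw ν β σ)
        {D : Dataset n d | ¬ ResponseClose (responseVar S β σ) D} ≤ ENNReal.ofReal (2 * η) := by
  -- The concentration is applied to `y² / E y²`, which has mean one and a scale depending on `K`
  -- only. No net is needed.
  obtain ⟨c, hc, hconc⟩ := exists_measure_pi_abs_sum_ge_le.{0} (b := 4 * K ^ 2 + 16) (t := 1 / 2)
    (by positivity) (by norm_num)
  refine ⟨2 / √c, by positivity, fun d n η σ ν S β hν hη hη1 hv hn => ?_⟩
  have hprob := hν.isProbabilityMeasure
  have hprob' := isProbabilityMeasure_sampleLaw (ν := ν) β σ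
  set m := responseVar S β σ with hm
  have hint : ∫ p, p.2 ^ 2 / m ∂(sampleLaw ν β σ) = 1 := by
    rw [integral_div, hν.integral_response_sq, div_self hv.ne']
  have h := hconc (sampleLaw ν β σ) (fun p => p.2 ^ 2 / m) (by fun_prop) (by
    refine le_trans (le_of_eq (lintegral_congr fun p => ?_))
      (hν.lintegral_exp_sq_response_le hK β σ)
    rw [abs_of_nonneg (by positivity), div_div, mul_comm m]) n
  rw [hint] at h
  refine (measure_mono fun D hD => ?_).trans (h.trans ?_)
  · by_contra hcon
    simp only [Set.mem_ofPred_eq, not_le] at hcon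
    refine hD ?_
    rw [Finset.sum_sub_distrib, Finset.sum_const, Finset.card_univ, Fintype.card_fin,
      nsmul_eq_mul, mul_one, ← Finset.sum_div] at hcon
    have hn0 : (0 : ℝ) < n := by
      have := (abs_nonneg _).trans_lt hcon
      linarith
    have h2 : (n : ℝ)⁻¹ * ∑ i, (D i).2 ^ 2 - m =
        (n : ℝ)⁻¹ * m * ((∑ i, (D i).2 ^ 2) / m - n) := by
      field_simp
    rw [ResponseClose, responseScale_sq, h2, abs_mul, abs_of_pos (by positivity)]
    calc (n : ℝ)⁻¹ * m * |(∑ i, (D i).2 ^ 2) / m - n| ≤ (n : ℝ)⁻¹ * m * (n * (1 / 2)) := by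
          gcongr
      _ = m / 2 := by field_simp
  · refine ENNReal.ofReal_le_ofReal ?_
    have := exp_neg_le_mul_of_le (x := 0) hc hη hη1 hn (by positivity)
    rw [Real.exp_zero, one_mul] at this
    linarith

/-! ### Maxima over the sample -/

/-- Markov's inequality at level `2 log (2n/η)` gives `2 (η/2n)²` per sample. The factor `2` before
the logarithm leaves a spare `1/n` after the union over samples. -/
lemma measure_pi_exists_ge_le {Ω : Type*} [MeasurableSpace Ω] (μ : Measure Ω)
    [IsProbabilityMeasure μ] {f : Ω → ℝ} (hf : Measurable f)
    (h : ∫⁻ ω, ENNReal.ofReal (Real.exp (f ω)) ∂μ ≤ 2) {n : ℕ} (hn : 0 < n) {η : ℝ}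
    (hη : 0 < η) :
    Measure.pi (fun _ : Fin n => μ) {ω | ∃ i, 2 * Real.log (2 * n / η) ≤ f (ω i)} ≤
      ENNReal.ofReal (η ^ 2 / (2 * n)) := by
  have hn' : (0 : ℝ) < n := by exact_mod_cast hn
  have hset : {ω : Fin n → Ω | ∃ i, 2 * Real.log (2 * n / η) ≤ f (ω i)} =
      ⋃ i ∈ (Finset.univ : Finset (Fin n)), {ω | 2 * Real.log (2 * n / η) ≤ f (ω i)} := by
    ext ω; simp
  have hone : ∀ i : Fin n, Measure.pi (fun _ : Fin n => μ)
      {ω | 2 * Real.log (2 * n / η) ≤ f (ω i)} ≤ ENNReal.ofReal (η ^ 2 / (2 * n ^ 2)) := by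
    intro i
    have hmp := measurePreserving_eval (fun _ : Fin n => μ) i
    have hms : MeasurableSet {x : Ω | 2 * Real.log (2 * n / η) ≤ f x} :=
      measurableSet_le measurable_const hf
    calc Measure.pi (fun _ : Fin n => μ) {ω | 2 * Real.log (2 * n / η) ≤ f (ω i)}
        = μ {x : Ω | 2 * Real.log (2 * n / η) ≤ f x} := hmp.measure_preimage hms.nullMeasurableSet
      _ ≤ ENNReal.ofReal (Real.exp (-(2 * Real.log (2 * n / η)))) * 2 :=
          (measure_ge_le_exp_mul μ hf _).trans (by gcongr)
      _ = ENNReal.ofReal (η ^ 2 / (2 * n ^ 2)) := by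
          rw [← ENNReal.ofReal_ofNat, ← ENNReal.ofReal_mul (Real.exp_pos _).le]
          congr 1
          have : Real.exp (-(2 * Real.log (2 * n / η))) = (2 * n / η) ^ (-2 : ℤ) := by
            rw [← Real.rpow_intCast, Real.rpow_def_of_pos (by positivity)]
            congr 1; push_cast; ring
          rw [this, zpow_neg]
          norm_cast
          push_cast
          field_simp
  rw [hset]
  refine (measure_biUnion_finset_le _ _).trans ((Finset.sum_le_sum fun i _ => hone i).trans ?_)
  rw [Finset.sum_const, Finset.card_univ, Fintype.card_fin, nsmul_eq_mul,
    ← ENNReal.ofReal_natCast, ← ENNReal.ofReal_mul (by positivity)]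
  refine ENNReal.ofReal_le_ofReal (le_of_eq ?_)
  field_simp

/-- All whitened features and all responses are bounded, up to a logarithmic factor, by the
square roots of their second moments. -/
def SampleBounded {n d : ℕ} (S : Matrix (Fin d) (Fin d) ℝ) (K v η : ℝ) (D : Dataset n d) : Prop :=
  ∀ i, ‖act (invSqrt S) (D i).1‖ ^ 2 ≤ 2 * K ^ 2 * d * Real.log (2 * n / η) ∧
    (D i).2 ^ 2 ≤ 2 * (4 * K ^ 2 + 16) * v * Real.log (2 * n / η)

/-- The spare `1/n` pays for the union over `d` whitened coordinates and the response, because `d +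
1 ≤ n`. Thus `log (2n/η)` suffices, with no dimension inside the logarithm. -/
lemma measure_not_sampleBounded_le {K : ℝ} (hK : 0 < K) {d n : ℕ} {η : ℝ}
    {ν : Measure (Vec d)} {S : Matrix (Fin d) (Fin d) ℝ} (β : Vec d) (σ : ℝ) (hν : IsSubG ν S K)
    (hη : 0 < η) (hη1 : η < 1) (hd : 0 < d) (hdn : d < n) (hv : 0 < responseVar S β σ) :
    Measure.pi (fun _ : Fin n => sampleLaw ν β σ)
      {D : Dataset n d | ¬ SampleBounded S K (responseVar S β σ) η D} ≤ ENNReal.ofReal η := by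
  have hprob := hν.isProbabilityMeasure
  have hprob' := isProbabilityMeasure_sampleLaw (ν := ν) β σ
  have hS := hν.posDef
  have hmp := measurePreserving_fst_sampleLaw (ν := ν) β σ
  set m := responseVar S β σ with hm
  set T := invSqrt S with hT
  have hn : 0 < n := hd.trans hdn
  let e : Fin d → Vec d := fun j => EuclideanSpace.single j 1
  let A : Fin d → Set (Dataset n d) := fun j =>
    {D | ∃ i, 2 * Real.log (2 * n / η) ≤ inner ℝ (act T (e j)) (D i).1 ^ 2 / K ^ 2}
  let A' : Set (Dataset n d) :=
    {D | ∃ i, 2 * Real.log (2 * n / η) ≤ (D i).2 ^ 2 / ((4 * K ^ 2 + 16) * m)}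
  have hA : ∀ j, Measure.pi (fun _ : Fin n => sampleLaw ν β σ) (A j) ≤
      ENNReal.ofReal (η ^ 2 / (2 * n)) := by
    intro j
    refine measure_pi_exists_ge_le (sampleLaw ν β σ)
      (f := fun p : Vec d × ℝ => inner ℝ (act T (e j)) p.1 ^ 2 / K ^ 2) (by fun_prop) ?_ hn hη
    have h1 := hν.lintegral_exp_sq_le hK (act T (e j)) (c := K ^ 2) (by
      rw [inner_invSqrt_act hS, real_inner_self_eq_norm_sq]
      simp [e])
    rw [← hmp.lintegral_comp (by fun_prop)] at h1
    exact h1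
  have hA' : Measure.pi (fun _ : Fin n => sampleLaw ν β σ) A' ≤
      ENNReal.ofReal (η ^ 2 / (2 * n)) :=
    measure_pi_exists_ge_le (sampleLaw ν β σ)
      (f := fun p : Vec d × ℝ => p.2 ^ 2 / ((4 * K ^ 2 + 16) * m)) (by fun_prop)
      (hν.lintegral_exp_sq_response_le hK β σ) hn hη
  have hsub : {D : Dataset n d | ¬ SampleBounded S K m η D} ⊆
      (⋃ j ∈ (Finset.univ : Finset (Fin d)), A j) ∪ A' := by
    intro D hD
    by_contra hcon
    simp only [A, A', Set.mem_union, Set.mem_iUnion, Set.mem_ofPred_eq, not_or, not_exists, not_le,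
      Finset.mem_univ, true_and, exists_prop] at hcon
    refine hD fun i => ⟨?_, ?_⟩
    · rw [EuclideanSpace.real_norm_sq_eq]
      calc ∑ j, act T (D i).1 j ^ 2 ≤ ∑ _j : Fin d, 2 * Real.log (2 * n / η) * K ^ 2 := by
            refine Finset.sum_le_sum fun j _ => ?_
            have h1 := (hcon.1 j i).le
            rw [div_le_iff₀ (by positivity), hT, ← inner_act_invSqrt] at h1
            simpa [e, EuclideanSpace.inner_single_left] using h1
        _ = 2 * K ^ 2 * d * Real.log (2 * n / η) := by
            rw [Finset.sum_const, Finset.card_univ, Fintype.card_fin, nsmul_eq_mul]; ring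
    · have h1 := (hcon.2 i).le
      rw [div_le_iff₀ (by positivity)] at h1
      exact h1.trans (le_of_eq (by ring))
  refine (measure_mono hsub).trans ((measure_union_le _ _).trans ?_)
  calc _ ≤ ∑ _j : Fin d, ENNReal.ofReal (η ^ 2 / (2 * n)) + ENNReal.ofReal (η ^ 2 / (2 * n)) := by
        refine add_le_add ((measure_biUnion_finset_le _ _).trans
          (Finset.sum_le_sum fun j _ => hA j)) hA'
    _ = ENNReal.ofReal (d * (η ^ 2 / (2 * n)) + η ^ 2 / (2 * n)) := by
        rw [Finset.sum_const, Finset.card_univ, Fintype.card_fin, nsmul_eq_mul,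
          ENNReal.ofReal_add (by positivity) (by positivity), ENNReal.ofReal_mul (by positivity),
          ENNReal.ofReal_natCast]
    _ ≤ ENNReal.ofReal η := by
        refine ENNReal.ofReal_le_ofReal ?_
        have hn' : (0 : ℝ) < n := by exact_mod_cast hn
        have hdn' : (d : ℝ) + 1 ≤ n := by exact_mod_cast hdn
        calc d * (η ^ 2 / (2 * n)) + η ^ 2 / (2 * n) = (d + 1) * η ^ 2 / (2 * n) := by ring
          _ ≤ n * η ^ 2 / (2 * n) := by gcongr
          _ = η * η / 2 := by field_simp
          _ ≤ η := by nlinarith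

/-! ### The transformed data -/

lemma clip_eq_self {V : Type*} [NormedAddCommGroup V] [NormedSpace ℝ V] {R : ℝ} {v : V}
    (h : ‖v‖ ≤ R) : clip R v = v := by
  unfold clip
  split_ifs with hR
  · have hRv : R = ‖v‖ := le_antisymm hR h
    rcases eq_or_ne v 0 with rfl | hv
    · simp
    · rw [hRv, div_self (norm_ne_zero_iff.2 hv), one_smul]
  · rfl

section Transform

variable {nA nB d : ℕ} {S : Matrix (Fin d) (Fin d) ℝ} {v : ℝ}

lemma MomentClose.le_two_mul {n : ℕ} {D : Dataset n d} (h : MomentClose S D) (w : Vec d) :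
    inner ℝ w (act S w) ≤ 2 * inner ℝ w (act (secondMoment D) w) := by
  linarith [(abs_le.1 (h w)).1]

lemma MomentClose.two_mul_le {n : ℕ} {D : Dataset n d} (h : MomentClose S D) (w : Vec d) :
    2 * inner ℝ w (act (secondMoment D) w) ≤ 3 * inner ℝ w (act S w) := by
  linarith [(abs_le.1 (h w)).2]

lemma MomentClose.posDef {n : ℕ} {D : Dataset n d} (h : MomentClose S D) (hS : S.PosDef) :
    (secondMoment D).PosDef := by
  refine posDef_iff_inner_act.2 ⟨transpose_secondMoment D, fun w hw => ?_⟩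
  have := (posDef_iff_inner_act.1 hS).2 w hw
  linarith [h.le_two_mul w]

lemma ResponseClose.responseScale_pos {n : ℕ} {D : Dataset n d} (h : ResponseClose v D)
    (hv : 0 < v) : 0 < responseScale D := by
  have h1 := (abs_le.1 h).1
  have h0 : 0 ≤ responseScale D := Real.sqrt_nonneg _
  refine h0.lt_of_ne fun h2 => ?_
  rw [← h2] at h1
  linarith

lemma secondMoment_transform (pub : Dataset nB d) (priv : Dataset nA d) :
    secondMoment (transform pub priv) =
      invSqrt (secondMoment pub) * secondMoment priv * invSqrt (secondMoment pub) := by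
  have h : designMatrix (transform pub priv) = designMatrix priv * invSqrt (secondMoment pub) := by
    ext i j
    rw [Matrix.mul_apply]
    simp only [designMatrix, transform, Matrix.of_apply]
    change ∑ k, invSqrt (secondMoment pub) j k * (priv i).1 k = _
    refine Finset.sum_congr rfl fun k _ => ?_
    rw [mul_comm, ← Matrix.transpose_apply (invSqrt (secondMoment pub)) j k, transpose_invSqrt]
  have hP := transpose_invSqrt (secondMoment pub)
  generalize invSqrt (secondMoment pub) = P at h hP ⊢
  simp only [secondMoment, h, Matrix.transpose_mul, hP, Matrix.mul_smul, Matrix.smul_mul,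
    Matrix.mul_assoc]

lemma crossMoment_transform (pub : Dataset nB d) (priv : Dataset nA d) :
    crossMoment (transform pub priv) =
      (responseScale pub)⁻¹ • act (invSqrt (secondMoment pub)) (crossMoment priv) := by
  refine ext_inner_left ℝ fun u => ?_
  rw [inner_smul_right, inner_act_invSqrt, inner_crossMoment, inner_crossMoment]
  simp only [transform, inner_act_invSqrt, Finset.mul_sum]
  exact Finset.sum_congr rfl fun i _ => by ring

/-- Equivariance of least squares under linear changes of the features and scaling of the responses.
The private second moment may be singular: the product rule for `Matrix` inverses holds regardless.
-/
lemma ols_transform {pub : Dataset nB d} (hB : (secondMoment pub).PosDef) (priv : Dataset nA d) :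
    ols (transform pub priv) = transformedOLS pub priv := by
  have hinv : (invSqrt (secondMoment pub))⁻¹ = CFC.sqrt (secondMoment pub) :=
    Matrix.nonsing_inv_nonsing_inv _ (isUnit_det_sqrt hB)
  rw [ols, transformedOLS, ols, secondMoment_transform, crossMoment_transform, act_smul,
    Matrix.mul_inv_rev, Matrix.mul_inv_rev, hinv, act_mul, act_mul, act_sqrt_act_invSqrt hB]

lemma responseScale_transform (pub : Dataset nB d) (priv : Dataset nA d) :
    responseScale (transform pub priv) ^ 2 = responseScale priv ^ 2 / responseScale pub ^ 2 := by
  rw [responseScale_sq, responseScale_sq priv]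
  simp only [transform, div_pow]
  rw [← Finset.sum_div, mul_div_assoc]

/-- Inversion reverses the order `S ≤ 2 Σ̂_B`. Directly, with `w = Σ̂_B⁻¹ a`, the left side is
`⟨S^{-1/2} a, S^{1/2} w⟩`, to which Cauchy–Schwarz and `‖S^{1/2} w‖² ≤ 2 ⟨w, Σ̂_B w⟩` apply. -/
lemma norm_invSqrt_act_sq_le (hS : S.PosDef) {pub : Dataset nB d} (hB : MomentClose S pub)
    (a : Vec d) :
    ‖act (invSqrt (secondMoment pub)) a‖ ^ 2 ≤ 2 * ‖act (invSqrt S) a‖ ^ 2 := by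
  set u := act (invSqrt (secondMoment pub)) a with hu
  set w := act (invSqrt (secondMoment pub)) u with hw
  have h1 : ‖u‖ ^ 2 ≤ ‖act (invSqrt S) a‖ * ‖act (CFC.sqrt S) w‖ := by
    have : ‖u‖ ^ 2 = inner ℝ (act (invSqrt S) a) (act (CFC.sqrt S) w) := by
      rw [← inner_act_invSqrt, act_invSqrt_act_sqrt hS, hw, inner_act_invSqrt,
        ← hu, real_inner_self_eq_norm_sq]
    rw [this]
    exact real_inner_le_norm _ _
  have h2 : ‖act (CFC.sqrt S) w‖ ^ 2 ≤ 2 * ‖u‖ ^ 2 := by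
    rw [← inner_act_self hS, ← real_inner_self_eq_norm_sq u,
      ← inner_invSqrt_act (hB.posDef hS) u u]
    exact hB.le_two_mul w
  rcases (sq_nonneg ‖u‖).eq_or_lt with h0 | h0
  · rw [← h0]; positivity
  have h3 : ‖u‖ ^ 2 * ‖u‖ ^ 2 ≤ 2 * ‖act (invSqrt S) a‖ ^ 2 * ‖u‖ ^ 2 := by
    calc ‖u‖ ^ 2 * ‖u‖ ^ 2 = (‖u‖ ^ 2) ^ 2 := by ring
      _ ≤ (‖act (invSqrt S) a‖ * ‖act (CFC.sqrt S) w‖) ^ 2 := by gcongr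
      _ = ‖act (invSqrt S) a‖ ^ 2 * ‖act (CFC.sqrt S) w‖ ^ 2 := by ring
      _ ≤ ‖act (invSqrt S) a‖ ^ 2 * (2 * ‖u‖ ^ 2) := by gcongr
      _ = _ := by ring
  exact le_of_mul_le_mul_right h3 h0

/-- On the event that the public moments are close to the true ones and the sample is
bounded, truncation changes nothing. -/
lemma noTruncationLoss_of_close {K τ η : ℝ} {pub : Dataset nB d} {priv : Dataset nA d}
    (hS : S.PosDef) (hv : 0 < v) (hn : 0 < nA) (hη : 0 < η) (hη1 : η < 1)
    (hτ : 4 * (4 * K ^ 2 + 16) ≤ τ) (hB : MomentClose S pub) (hR : ResponseClose v pub)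
    (hA : SampleBounded S K v η priv) : NoTruncationLoss τ η pub priv := by
  have hpd := hB.posDef hS
  have hsc := hR.responseScale_pos hv
  have hn' : (1 : ℝ) ≤ nA := by exact_mod_cast hn
  set l := Real.log (2 * nA / η) with hl
  have hl0 : 0 ≤ l := Real.log_nonneg (by rw [le_div_iff₀ hη]; linarith)
  have hK2 := sq_nonneg K
  have hτ0 : 0 ≤ τ := by nlinarith
  have heq : pmt τ η pub priv = transform pub priv := by
    funext i
    refine Prod.ext (clip_eq_self ?_) (clip_eq_self ?_)
    · refine Real.le_sqrt_of_sq_le ?_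
      calc _ ≤ 2 * ‖act (invSqrt S) (priv i).1‖ ^ 2 := norm_invSqrt_act_sq_le hS hB _
        _ ≤ 2 * (2 * K ^ 2 * d * l) := by gcongr; exact (hA i).1
        _ = 4 * K ^ 2 * (d * l) := by ring
        _ ≤ τ * (d * l) := by gcongr; nlinarith
        _ ≤ τ * d * (1 + l) := by nlinarith [mul_nonneg hτ0 (Nat.cast_nonneg (α := ℝ) d)]
    · refine Real.le_sqrt_of_sq_le ?_
      -- Dividing by `σ̂_B²` costs a factor `2`, so the responses need `τ ≥ 4 (4K² + 16)`; the
      -- features only need `4K²`.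
      have h1 : v / 2 ≤ responseScale pub ^ 2 := by linarith [(abs_le.1 hR).1]
      rw [Real.norm_eq_abs, sq_abs, transform, div_pow, div_le_iff₀ (by positivity), Nat.cast_one,
        mul_one]
      calc (priv i).2 ^ 2 ≤ 2 * (4 * K ^ 2 + 16) * v * l := (hA i).2
        _ = 4 * (4 * K ^ 2 + 16) * l * (v / 2) := by ring
        _ ≤ τ * (1 + l) * responseScale pub ^ 2 := by gcongr; linarith
  exact ⟨hpd, hsc, heq, by rw [heq, ols_transform hpd]⟩

end Transform

/-! ### Norms of the Gaussian perturbations -/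

/-- Chernoff's bound at threshold `6 s x`, with constants chosen so that the tail `exp (-4x²)` beats
the `25 ^ d` terms of the union over pairs of net points. -/
lemma measure_abs_ge_le_of_exp_mul_le {Ω : Type*} [MeasurableSpace Ω] {μ : Measure Ω} {f : Ω → ℝ}
    (hf : Measurable f) {s : ℝ} (hs : 0 < s)
    (h : ∀ l : ℝ, ∫⁻ ω, ENNReal.ofReal (Real.exp (l * f ω)) ∂μ ≤
      ENNReal.ofReal (Real.exp (2 * s ^ 2 * l ^ 2))) {x : ℝ} (hx : 0 ≤ x) :
    μ {ω | 6 * s * x ≤ |f ω|} ≤ ENNReal.ofReal (2 * Real.exp (-(4 * x ^ 2))) := by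
  have key : ∀ ε : ℝ, ε ^ 2 = 1 → μ {ω | 6 * s * x ≤ ε * f ω} ≤
      ENNReal.ofReal (Real.exp (-(4 * x ^ 2))) := by
    intro ε hε
    -- The minimizer of `2 s² l² - 6 s x l`, with value `-(9/2) x²`.
    set l := 3 / 2 * x / s with hl
    have hl0 : 0 ≤ l := by positivity
    have hset : {ω | 6 * s * x ≤ ε * f ω} ⊆ {ω | l * (6 * s * x) ≤ l * ε * f ω} := by
      intro ω hω
      simp only [Set.mem_ofPred_eq] at hω ⊢
      rw [mul_assoc l ε]
      gcongr
    refine (measure_mono hset).trans ((measure_ge_le_exp_mul μ (by fun_prop) _).trans ?_)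
    refine (mul_le_mul_right (h (l * ε)) _).trans ?_
    rw [← ENNReal.ofReal_mul (Real.exp_pos _).le, ← Real.exp_add]
    refine ENNReal.ofReal_le_ofReal (Real.exp_le_exp.2 ?_)
    have h1 : l * (6 * s * x) = 9 * x ^ 2 := by rw [hl]; field_simp; ring
    have h2 : 2 * s ^ 2 * (l * ε) ^ 2 = 9 / 2 * x ^ 2 := by
      rw [mul_pow, hε, hl]; field_simp; ring
    rw [h1, h2]
    nlinarith [sq_nonneg x]
  have hset : {ω | 6 * s * x ≤ |f ω|} ⊆
      {ω | 6 * s * x ≤ 1 * f ω} ∪ {ω | 6 * s * x ≤ -1 * f ω} := by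
    intro ω hω
    rcases le_abs.1 (Set.mem_ofPred_eq ▸ hω) with h | h
    · exact Or.inl (by simpa using h)
    · exact Or.inr (by simpa using h)
  refine (measure_mono hset).trans ((measure_union_le _ _).trans
    ((add_le_add (key 1 (by norm_num)) (key (-1) (by norm_num))).trans ?_))
  rw [← ENNReal.ofReal_add (Real.exp_pos _).le (Real.exp_pos _).le, two_mul]

lemma lintegral_exp_mul_sum_gaussianReal {ι : Type*} [Fintype ι] (v : NNReal) (c : ι → ℝ)
    (l : ℝ) :
    ∫⁻ w, ENNReal.ofReal (Real.exp (l * ∑ i, c i * w i))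
      ∂(Measure.pi fun _ : ι => gaussianReal 0 v) =
      ENNReal.ofReal (Real.exp (v * (∑ i, c i ^ 2) * l ^ 2 / 2)) := by
  have h : ∀ w : ι → ℝ, l * ∑ i, c i * w i = ∑ i, l * c i * w i := fun w => by
    simp only [Finset.mul_sum, mul_assoc]
  simp_rw [h]
  rw [lintegral_exp_sum_pi (fun _ : ι => gaussianReal 0 v) (f := fun i x => l * c i * x)
    fun i => by fun_prop]
  simp_rw [lintegral_exp_mul_gaussianReal]
  rw [← ENNReal.ofReal_prod_of_nonneg fun i _ => (Real.exp_pos _).le, ← Real.exp_sum]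
  congr 2
  rw [Finset.mul_sum, Finset.sum_mul, Finset.sum_div]
  exact Finset.sum_congr rfl fun i _ => by ring

lemma lintegral_exp_mul_sum_sum_gaussianReal {ι κ : Type*} [Fintype ι] [Fintype κ] (v : NNReal)
    (c : ι → κ → ℝ) (l : ℝ) :
    ∫⁻ w, ENNReal.ofReal (Real.exp (l * ∑ i, ∑ j, c i j * w i j))
      ∂(Measure.pi fun _ : ι => Measure.pi fun _ : κ => gaussianReal 0 v) =
      ENNReal.ofReal (Real.exp (v * (∑ i, ∑ j, c i j ^ 2) * l ^ 2 / 2)) := by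
  simp_rw [Finset.mul_sum Finset.univ (fun i => ∑ j, c i j * _) l]
  rw [lintegral_exp_sum_pi (fun _ : ι => Measure.pi fun _ : κ => gaussianReal 0 v)
    (f := fun i x => l * ∑ j, c i j * x j) fun i => by fun_prop]
  simp_rw [lintegral_exp_mul_sum_gaussianReal]
  rw [← ENNReal.ofReal_prod_of_nonneg fun i _ => (Real.exp_pos _).le, ← Real.exp_sum]
  congr 2
  rw [Finset.mul_sum, Finset.sum_mul, Finset.sum_div]

section Noise

variable {d : ℕ}

/-- Coefficients of the bilinear form of `symMatrix W` in the entries of `W`. -/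
noncomputable def symCoeff (u v : Vec d) (i j : Fin d) : ℝ :=
  (if i ≤ j then u i * v j else 0) + if i < j then u j * v i else 0

lemma inner_act_symMatrix (W : Fin d → Fin d → ℝ) (u v : Vec d) :
    inner ℝ u (act (symMatrix W) v) = ∑ i, ∑ j, symCoeff u v i j * W i j := by
  have h1 : ∀ i j, symMatrix W i j * (u i * v j) =
      (if i ≤ j then u i * v j else 0) * W i j + (if j < i then u i * v j else 0) * W j i := by
    intro i j
    simp only [symMatrix, Matrix.of_apply]
    rcases le_or_gt i j with h | h
    · rw [min_eq_left h, max_eq_right h, if_pos h, if_neg h.not_gt]; ring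
    · rw [min_eq_right h.le, max_eq_left h.le, if_neg h.not_ge, if_pos h]; ring
  rw [inner_act]
  simp_rw [h1, symCoeff, add_mul, Finset.sum_add_distrib]
  congr 1
  exact Finset.sum_comm

/-- An off-diagonal noise entry enters the bilinear form twice, as `u i * v j + u j * v i`. The
bound gives the form variance at most `4 s²` on the unit ball. -/
lemma sum_symCoeff_sq_le (u v : Vec d) :
    ∑ i, ∑ j, symCoeff u v i j ^ 2 ≤ 4 * (‖u‖ ^ 2 * ‖v‖ ^ 2) := by
  have h : ∀ i j, symCoeff u v i j ^ 2 ≤ 2 * (u i ^ 2 * v j ^ 2) + 2 * (v i ^ 2 * u j ^ 2) := by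
    intro i j
    unfold symCoeff
    split_ifs <;> nlinarith [sq_nonneg (u i * v j - u j * v i), sq_nonneg (u i * v j),
      sq_nonneg (u j * v i)]
  calc ∑ i, ∑ j, symCoeff u v i j ^ 2
      ≤ ∑ i, ∑ j, (2 * (u i ^ 2 * v j ^ 2) + 2 * (v i ^ 2 * u j ^ 2)) :=
        Finset.sum_le_sum fun i _ => Finset.sum_le_sum fun j _ => h i j
    _ = 4 * (‖u‖ ^ 2 * ‖v‖ ^ 2) := by
        simp only [Finset.sum_add_distrib, ← Finset.mul_sum, ← Finset.sum_mul,
          ← EuclideanSpace.real_norm_sq_eq]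
        ring

lemma opNorm_le_of_abs_inner_le {M : Matrix (Fin d) (Fin d) ℝ} {c : ℝ} (hc : 0 ≤ c)
    (h : ∀ u v : Vec d, |inner ℝ u (act M v)| ≤ c * ‖u‖ * ‖v‖) : opNorm M ≤ c := by
  refine opNorm_le hc fun v => ?_
  have h1 := (le_abs_self _).trans (h (act M v) v)
  rw [real_inner_self_eq_norm_sq] at h1
  rcases (norm_nonneg (act M v)).eq_or_lt with h0 | h0
  · rw [← h0]; positivity
  · exact le_of_mul_le_mul_right (by linarith : ‖act M v‖ * ‖act M v‖ ≤ c * ‖v‖ * ‖act M v‖) h0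

lemma opNorm_le_of_half_net {N : Finset (Vec d)}
    (hN : ∀ u : Vec d, ‖u‖ ≤ 1 → ∃ v ∈ N, ‖u - v‖ ≤ 1 / 2) {M : Matrix (Fin d) (Fin d) ℝ} {δ : ℝ}
    (hδ : 0 ≤ δ) (h : ∀ u ∈ N, ∀ v ∈ N, |inner ℝ u (act M v)| ≤ δ) : opNorm M ≤ 4 * δ := by
  let B : Vec d →ₗ[ℝ] Vec d →ₗ[ℝ] ℝ := LinearMap.mk₂ ℝ (fun u v => inner ℝ u (act M v))
    (fun a b c => by simp only [inner_add_left])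
    (fun a b c => by simp only [real_inner_smul_left, smul_eq_mul])
    (fun a b c => by simp only [act_add, inner_add_right])
    (fun a b c => by simp only [act_smul, real_inner_smul_right, smul_eq_mul])
  exact opNorm_le_of_abs_inner_le (by positivity) (abs_bilin_le_of_half_net hN B h)

lemma norm_le_of_half_net {N : Finset (Vec d)}
    (hN : ∀ u : Vec d, ‖u‖ ≤ 1 → ∃ v ∈ N, ‖u - v‖ ≤ 1 / 2) {g : Vec d} {δ : ℝ}
    (hδ : 0 ≤ δ) (h : ∀ u ∈ N, |inner ℝ g u| ≤ δ) : ‖g‖ ≤ 2 * δ := by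
  have h1 := (le_abs_self _).trans (abs_le_of_half_net hN (innerSL ℝ g).toLinearMap h g)
  simp only [ContinuousLinearMap.coe_coe, innerSL_apply_apply] at h1
  rw [real_inner_self_eq_norm_sq] at h1
  rcases (norm_nonneg g).eq_or_lt with h0 | h0
  · rw [← h0]; positivity
  · exact le_of_mul_le_mul_right (by linarith : ‖g‖ * ‖g‖ ≤ 2 * δ * ‖g‖) h0

lemma pow_mul_exp_neg_le {η : ℝ} (hη : 0 < η) (hη1 : η < 1) {k : ℝ} (hk : k ≤ 25 ^ d) :
    k * (2 * Real.exp (-(4 * (√d + √(Real.log (1 / η))) ^ 2))) ≤ 2 * η := by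
  have hlog : 0 ≤ Real.log (1 / η) := Real.log_nonneg (by rw [le_div_iff₀ hη]; linarith)
  have hsq : (d : ℝ) + Real.log (1 / η) ≤ (√d + √(Real.log (1 / η))) ^ 2 := by
    rw [add_sq, Real.sq_sqrt (by positivity), Real.sq_sqrt hlog]
    have : 0 ≤ 2 * √(d : ℝ) * √(Real.log (1 / η)) := by positivity
    linarith
  calc k * (2 * Real.exp (-(4 * (√d + √(Real.log (1 / η))) ^ 2)))
      ≤ Real.exp 4 ^ d * (2 * Real.exp (-(4 * (√d + √(Real.log (1 / η))) ^ 2))) := by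
        gcongr
        exact hk.trans (by have := twenty_five_le_exp; gcongr)
    _ = 2 * Real.exp (d * 4 + -(4 * (√d + √(Real.log (1 / η))) ^ 2)) := by
        rw [← Real.exp_nat_mul, Real.exp_add]; ring
    _ ≤ 2 * Real.exp (-Real.log (1 / η)) := by
        gcongr
        linarith
    _ = 2 * η := by rw [one_div, Real.log_inv, neg_neg, Real.exp_log hη]

lemma measure_opNorm_symMatrix_gt_le {s η : ℝ} (hs : 0 < s) (hη : 0 < η) (hη1 : η < 1) :
    Measure.pi (fun _ : Fin d => Measure.pi fun _ : Fin d => gaussianReal 0 (s ^ 2).toNNReal)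
      {W | ¬ opNorm (symMatrix W) ≤ 24 * s * (√d + √(Real.log (1 / η)))} ≤
        ENNReal.ofReal (2 * η) := by
  obtain ⟨N, hcard, hN1, hN⟩ := exists_half_net d
  set x := √d + √(Real.log (1 / η)) with hx
  have hx0 : 0 ≤ x := by positivity
  have hsub : {W : Fin d → Fin d → ℝ | ¬ opNorm (symMatrix W) ≤ 24 * s * x} ⊆
      ⋃ u ∈ N, ⋃ v ∈ N, {W | 6 * s * x ≤ |∑ i, ∑ j, symCoeff u v i j * W i j|} := by
    intro W hW
    by_contra hcon
    simp only [Set.mem_iUnion, Set.mem_ofPred_eq, not_exists, not_le, exists_prop,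
      not_and] at hcon
    refine hW ((opNorm_le_of_half_net hN (δ := 6 * s * x) (by positivity)
      fun u hu v hv => ?_).trans_eq (by ring))
    rw [inner_act_symMatrix]
    exact (hcon u hu v hv).le
  have hone : ∀ u ∈ N, ∀ v ∈ N,
      Measure.pi (fun _ : Fin d => Measure.pi fun _ : Fin d => gaussianReal 0 (s ^ 2).toNNReal)
        {W | 6 * s * x ≤ |∑ i, ∑ j, symCoeff u v i j * W i j|} ≤
          ENNReal.ofReal (2 * Real.exp (-(4 * x ^ 2))) := by
    intro u hu v hv
    refine measure_abs_ge_le_of_exp_mul_le (by fun_prop) hs (fun l => ?_) hx0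
    rw [lintegral_exp_mul_sum_sum_gaussianReal, Real.coe_toNNReal _ (sq_nonneg s)]
    refine ENNReal.ofReal_le_ofReal (Real.exp_le_exp.2 ?_)
    have h1 : ∑ i, ∑ j, symCoeff u v i j ^ 2 ≤ 4 := by
      refine (sum_symCoeff_sq_le u v).trans ?_
      have hu1 : ‖u‖ ^ 2 ≤ 1 := pow_le_one₀ (norm_nonneg _) (hN1 u hu)
      have hv1 : ‖v‖ ^ 2 ≤ 1 := pow_le_one₀ (norm_nonneg _) (hN1 v hv)
      nlinarith [sq_nonneg ‖u‖, sq_nonneg ‖v‖]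
    calc s ^ 2 * (∑ i, ∑ j, symCoeff u v i j ^ 2) * l ^ 2 / 2 ≤ s ^ 2 * 4 * l ^ 2 / 2 := by gcongr
      _ = 2 * s ^ 2 * l ^ 2 := by ring
  refine (measure_mono hsub).trans ?_
  calc _ ≤ ∑ u ∈ N, ∑ v ∈ N, ENNReal.ofReal (2 * Real.exp (-(4 * x ^ 2))) :=
        (measure_biUnion_finset_le _ _).trans (Finset.sum_le_sum fun u hu =>
          (measure_biUnion_finset_le _ _).trans (Finset.sum_le_sum fun v hv => hone u hu v hv))
    _ = ENNReal.ofReal (((N.card * N.card : ℕ) : ℝ) * (2 * Real.exp (-(4 * x ^ 2)))) := by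
        simp only [Finset.sum_const, nsmul_eq_mul]
        rw [ENNReal.ofReal_mul (p := ((N.card * N.card : ℕ) : ℝ)) (by positivity),
          ENNReal.ofReal_natCast, Nat.cast_mul, mul_assoc]
    _ ≤ ENNReal.ofReal (2 * η) := by
        refine ENNReal.ofReal_le_ofReal (pow_mul_exp_neg_le hη hη1 ?_)
        have : N.card * N.card ≤ 25 ^ d := by
          refine (Nat.mul_le_mul hcard hcard).trans_eq ?_
          rw [← mul_pow]; norm_num
        exact_mod_cast this

lemma measure_norm_gt_le {s η : ℝ} (hs : 0 < s) (hη : 0 < η) (hη1 : η < 1) :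
    ((Measure.pi fun _ : Fin d => gaussianReal 0 (s ^ 2).toNNReal).map (WithLp.toLp 2))
      {g : Vec d | ¬ ‖g‖ ≤ 12 * s * (√d + √(Real.log (1 / η)))} ≤ ENNReal.ofReal (2 * η) := by
  obtain ⟨N, hcard, hN1, hN⟩ := exists_half_net d
  set x := √d + √(Real.log (1 / η)) with hx
  have hx0 : 0 ≤ x := by positivity
  have hms : MeasurableSet {g : Vec d | ¬ ‖g‖ ≤ 12 * s * x} :=
    (measurableSet_le measurable_norm measurable_const).compl
  rw [Measure.map_apply (measurable_toLp_vec d) hms]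
  have hsub : (WithLp.toLp 2 : (Fin d → ℝ) → Vec d) ⁻¹' {g : Vec d | ¬ ‖g‖ ≤ 12 * s * x} ⊆
      ⋃ u ∈ N, {w : Fin d → ℝ | 6 * s * x ≤ |∑ i, u i * w i|} := by
    intro w hw
    by_contra hcon
    simp only [Set.mem_iUnion, Set.mem_ofPred_eq, not_exists, exists_prop] at hcon
    refine hw ((norm_le_of_half_net hN (δ := 6 * s * x) (by positivity)
      fun u hu => ?_).trans_eq (by ring))
    have h1 := not_and.1 (hcon u) hu
    rw [not_le] at h1
    simpa [PiLp.inner_apply] using h1.le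
  have hone : ∀ u ∈ N, Measure.pi (fun _ : Fin d => gaussianReal 0 (s ^ 2).toNNReal)
        {w : Fin d → ℝ | 6 * s * x ≤ |∑ i, u i * w i|} ≤
          ENNReal.ofReal (2 * Real.exp (-(4 * x ^ 2))) := by
    intro u hu
    refine measure_abs_ge_le_of_exp_mul_le (by fun_prop) hs (fun l => ?_) hx0
    rw [lintegral_exp_mul_sum_gaussianReal, Real.coe_toNNReal _ (sq_nonneg s),
      ← EuclideanSpace.real_norm_sq_eq]
    refine ENNReal.ofReal_le_ofReal (Real.exp_le_exp.2 ?_)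
    have hu1 : ‖u‖ ^ 2 ≤ 1 := pow_le_one₀ (norm_nonneg _) (hN1 u hu)
    calc s ^ 2 * ‖u‖ ^ 2 * l ^ 2 / 2 ≤ s ^ 2 * 4 * l ^ 2 / 2 := by gcongr; linarith
      _ = 2 * s ^ 2 * l ^ 2 := by ring
  refine (measure_mono hsub).trans ?_
  calc _ ≤ ∑ u ∈ N, ENNReal.ofReal (2 * Real.exp (-(4 * x ^ 2))) :=
        (measure_biUnion_finset_le _ _).trans (Finset.sum_le_sum hone)
    _ = ENNReal.ofReal ((N.card : ℝ) * (2 * Real.exp (-(4 * x ^ 2)))) := by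
        simp only [Finset.sum_const, nsmul_eq_mul]
        rw [ENNReal.ofReal_mul (p := (N.card : ℝ)) (by positivity), ENNReal.ofReal_natCast]
    _ ≤ ENNReal.ofReal (2 * η) := by
        refine ENNReal.ofReal_le_ofReal (pow_mul_exp_neg_le hη hη1 ?_)
        have : N.card ≤ 25 ^ d := hcard.trans (Nat.pow_le_pow_left (by norm_num) d)
        exact_mod_cast this

end Noise

/-! ### Perturbation of the least squares estimator -/

section Perturbation

variable {d : ℕ}

lemma isUnit_det_of_le_inner {M : Matrix (Fin d) (Fin d) ℝ} {c : ℝ} (hc : 0 < c)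
    (h : ∀ u : Vec d, c * ‖u‖ ^ 2 ≤ inner ℝ u (act M u)) : IsUnit M.det := by
  refine isUnit_iff_ne_zero.2 fun h0 => ?_
  obtain ⟨x, hx, hMx⟩ := Matrix.exists_mulVec_eq_zero_iff.2 h0
  have h1 := h (WithLp.toLp 2 x)
  have h2 : act M (WithLp.toLp 2 x) = 0 := by
    rw [act, Matrix.toEuclideanCLM_toLp, hMx]; rfl
  rw [h2, inner_zero_right] at h1
  have h3 : 0 < ‖(WithLp.toLp 2 x : Vec d)‖ := norm_pos_iff.2 (by simpa using hx)
  have : 0 < c * ‖(WithLp.toLp 2 x : Vec d)‖ ^ 2 := by positivity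
  linarith

lemma act_act_inv {M : Matrix (Fin d) (Fin d) ℝ} (h : IsUnit M.det) (v : Vec d) :
    act M (act M⁻¹ v) = v := by
  rw [← act_mul, Matrix.mul_nonsing_inv _ h, act_one]

lemma mul_norm_le_norm_act {M : Matrix (Fin d) (Fin d) ℝ} {c : ℝ}
    (h : ∀ u : Vec d, c * ‖u‖ ^ 2 ≤ inner ℝ u (act M u)) (u : Vec d) :
    c * ‖u‖ ≤ ‖act M u‖ := by
  rcases (norm_nonneg u).eq_or_lt with h0 | h0
  · rw [← h0]; simp
  · have h1 := (h u).trans (real_inner_le_norm _ _)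
    exact le_of_mul_le_mul_left (by linarith : ‖u‖ * (c * ‖u‖) ≤ ‖u‖ * ‖act M u‖) h0

/-- Fitted values are a projection of the responses, so their mean square `Q = ⟨b, M b⟩` is at most
that of the responses. In the proof, the normal equations and Cauchy–Schwarz give `Q² ≤ Q ·
responseScale²`. -/
lemma mul_norm_ols_sq_le {n : ℕ} {D : Dataset n d} {c : ℝ} (hc : 0 < c)
    (h : ∀ u : Vec d, c * ‖u‖ ^ 2 ≤ inner ℝ u (act (secondMoment D) u)) :
    c * ‖ols D‖ ^ 2 ≤ responseScale D ^ 2 := by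
  set b := ols D with hb
  have hact : act (secondMoment D) b = crossMoment D :=
    act_act_inv (isUnit_det_of_le_inner hc h) _
  have h1 := inner_secondMoment D b b
  have h2 := inner_crossMoment D b
  rw [← hact, h1] at h2
  set Q := (n : ℝ)⁻¹ * ∑ i, inner ℝ b (D i).1 * inner ℝ b (D i).1 with hQ
  have hcs : ((n : ℝ)⁻¹ * ∑ i, inner ℝ b (D i).1 * (D i).2) ^ 2 ≤ Q * responseScale D ^ 2 := by
    have := Finset.sum_mul_sq_le_sq_mul_sq Finset.univ (fun i => inner ℝ b (D i).1)
      (fun i => (D i).2)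
    rw [responseScale_sq, hQ, mul_pow]
    calc ((n : ℝ)⁻¹) ^ 2 * (∑ i, inner ℝ b (D i).1 * (D i).2) ^ 2
        ≤ ((n : ℝ)⁻¹) ^ 2 * ((∑ i, inner ℝ b (D i).1 ^ 2) * ∑ i, (D i).2 ^ 2) := by gcongr
      _ = _ := by simp only [sq]; ring
  rw [← h2] at hcs
  have hle : c * ‖b‖ ^ 2 ≤ Q := h1 ▸ h b
  have hQ0 : 0 ≤ Q := le_trans (by positivity) hle
  refine hle.trans ?_
  rcases hQ0.eq_or_lt with h0 | h0
  · rw [← h0]; positivity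
  · exact le_of_mul_le_mul_left (by linarith [sq Q] : Q * Q ≤ Q * responseScale D ^ 2) h0

variable {nA nB : ℕ} {S : Matrix (Fin d) (Fin d) ℝ} {v τ η : ℝ} {pub : Dataset nB d}
  {priv : Dataset nA d}

/-- Both empirical moments are comparable to `S`: `Σ̂_A ≥ S/2` and `S ≥ (2/3) Σ̂_B`, and whitening
by the public moment turns `Σ̂_B` into the identity. -/
lemma norm_sq_le_inner_secondMoment_transform (hS : S.PosDef) (hA : MomentClose S priv)
    (hB : MomentClose S pub) (u : Vec d) :
    1 / 3 * ‖u‖ ^ 2 ≤ inner ℝ u (act (secondMoment (transform pub priv)) u) := by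
  rw [secondMoment_transform, act_mul, act_mul, inner_act_invSqrt]
  have h1 := inner_invSqrt_act (hB.posDef hS) u u
  rw [real_inner_self_eq_norm_sq] at h1
  have h2 := hA.le_two_mul (act (invSqrt (secondMoment pub)) u)
  have h3 := hB.two_mul_le (act (invSqrt (secondMoment pub)) u)
  linarith

/-- Deterministic perturbation bound for the estimator computed from the noisy moments. -/
lemma norm_dpTransformed_sub_le (hS : S.PosDef) (hA : MomentClose S priv)
    (hB : MomentClose S pub) (hRA : ResponseClose v priv) (hRB : ResponseClose v pub)
    (hT : NoTruncationLoss τ η pub priv) {w : (Fin d → Fin d → ℝ) × Vec d}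
    (hG : opNorm (symMatrix w.1) ≤ 1 / 6) :
    IsUnit (noisyMoment τ η pub priv w).det ∧
      ‖dpTransformed τ η pub priv w - transformedOLS pub priv‖ ≤
        6 * (‖w.2‖ + 3 * opNorm (symMatrix w.1)) := by
  obtain ⟨-, hsc, heq, hols⟩ := hT
  have hM := norm_sq_le_inner_secondMoment_transform hS hA hB
  set M := secondMoment (transform pub priv) with hMdef
  set G := symMatrix w.1 with hGdef
  have hN : ∀ u : Vec d, 1 / 6 * ‖u‖ ^ 2 ≤ inner ℝ u (act (M + G) u) := by
    intro u
    rw [add_act, inner_add_right]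
    have h1 : |inner ℝ u (act G u)| ≤ 1 / 6 * ‖u‖ ^ 2 := by
      calc |inner ℝ u (act G u)| ≤ ‖u‖ * ‖act G u‖ := abs_real_inner_le_norm _ _
        _ ≤ ‖u‖ * (1 / 6 * ‖u‖) := by
            gcongr
            exact (norm_act_le G u).trans (by gcongr)
        _ = _ := by ring
    have := (abs_le.1 h1).1
    linarith [hM u]
  have hdet := isUnit_det_of_le_inner (by norm_num) hN
  have hnoisy : noisyMoment τ η pub priv w = M + G := by rw [noisyMoment, heq]
  rw [hnoisy]
  refine ⟨hdet, ?_⟩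
  set b := transformedOLS pub priv with hb
  have hb' : b = ols (transform pub priv) := by rw [← hols, heq]
  have hMb : act M b = crossMoment (transform pub priv) := by
    rw [hb']; exact act_act_inv (isUnit_det_of_le_inner (by norm_num) hM) _
  -- The ratio of mean square responses is at most `(3v/2) / (v/2) = 3`, so `‖b‖² / 3 ≤ 3`.
  have hbn : ‖b‖ ≤ 3 := by
    have h1 := mul_norm_ols_sq_le (by norm_num) hM
    rw [← hb', responseScale_transform] at h1
    have h2 : responseScale priv ^ 2 / responseScale pub ^ 2 ≤ 3 := by
      rw [div_le_iff₀ (by positivity)]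
      linarith [(abs_le.1 hRA).2, (abs_le.1 hRB).1]
    exact abs_le_of_sq_le_sq' (by linarith : ‖b‖ ^ 2 ≤ 3 ^ 2) (by norm_num) |>.2
  -- Subtract `(M + G) b` from the noisy normal equations and use `M b = crossMoment`.
  have hdiff : act (M + G) (dpTransformed τ η pub priv w - b) = w.2 - act G b := by
    rw [act_sub, dpTransformed, hnoisy, act_act_inv hdet, heq, add_act, hMb]
    abel
  have h1 := mul_norm_le_norm_act hN (dpTransformed τ η pub priv w - b)
  rw [hdiff] at h1
  have h2 : ‖w.2 - act G b‖ ≤ ‖w.2‖ + 3 * opNorm G := by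
    refine (norm_sub_le _ _).trans (add_le_add le_rfl ((norm_act_le G b).trans ?_))
    rw [mul_comm]
    exact mul_le_mul_of_nonneg_right hbn (opNorm_nonneg _)
  linarith

lemma norm_dpRecovered_sub_le (hB : (secondMoment pub).PosDef) (hsc : 0 < responseScale pub)
    (w : (Fin d → Fin d → ℝ) × Vec d) :
    ‖dpRecovered τ η pub priv w - ols priv‖ ≤ responseScale pub *
      (opNorm (invSqrt (secondMoment pub)) *
        ‖dpTransformed τ η pub priv w - transformedOLS pub priv‖) := by
  have h : dpRecovered τ η pub priv w - ols priv = responseScale pub •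
      act (invSqrt (secondMoment pub))
        (dpTransformed τ η pub priv w - transformedOLS pub priv) := by
    rw [act_sub, smul_sub, dpRecovered, transformedOLS, act_smul, act_invSqrt_act_sqrt hB,
      smul_inv_smul₀ hsc.ne']
  rw [h, norm_smul, Real.norm_of_nonneg hsc.le]
  gcongr
  exact norm_act_le _ _

lemma opNorm_le_two_mul_of_momentClose (hS : S.PosDef) (hA : MomentClose S priv) :
    opNorm S ≤ 2 * opNorm (secondMoment priv) := by
  set k := 2 * opNorm (secondMoment priv) with hk
  have hk0 : 0 ≤ k := mul_nonneg zero_le_two (opNorm_nonneg _)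
  have h1 : ∀ u : Vec d, ‖act (CFC.sqrt S) u‖ ≤ √k * ‖u‖ := by
    intro u
    refine abs_le_of_sq_le_sq' ?_ (by positivity) |>.2
    rw [mul_pow, Real.sq_sqrt hk0, ← inner_act_self hS]
    calc inner ℝ u (act S u) ≤ 2 * inner ℝ u (act (secondMoment priv) u) := hA.le_two_mul u
      _ ≤ 2 * (‖u‖ * ‖act (secondMoment priv) u‖) := by gcongr; exact real_inner_le_norm _ _
      _ ≤ 2 * (‖u‖ * (opNorm (secondMoment priv) * ‖u‖)) := by gcongr; exact norm_act_le _ _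
      _ = k * ‖u‖ ^ 2 := by rw [hk]; ring
  refine opNorm_le hk0 fun u => ?_
  calc ‖act S u‖ = ‖act (CFC.sqrt S) (act (CFC.sqrt S) u)‖ := by rw [← act_mul, sqrt_mul_sqrt hS]
    _ ≤ √k * (√k * ‖u‖) := (h1 _).trans (by gcongr; exact h1 u)
    _ = k * ‖u‖ := by rw [← mul_assoc, Real.mul_self_sqrt hk0]

/-- From `‖u‖² ≤ ‖Σ̂_B^{-1/2}‖² ⟨u, Σ̂_B u⟩` and `Σ̂_B ≤ (3/2) S`. The vector `u` only witnesses
that the space is nonzero. -/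
lemma two_le_opNorm_invSqrt_sq_mul (hS : S.PosDef) (hB : MomentClose S pub) {u : Vec d}
    (hu : u ≠ 0) : 2 ≤ 3 * (opNorm (invSqrt (secondMoment pub)) ^ 2 * opNorm S) := by
  have hpd := hB.posDef hS
  have hu0 : 0 < ‖u‖ ^ 2 := by have := norm_pos_iff.2 hu; positivity
  have h1 : ‖u‖ ^ 2 ≤ opNorm (invSqrt (secondMoment pub)) ^ 2 *
      inner ℝ u (act (secondMoment pub) u) := by
    rw [inner_act_self hpd, ← mul_pow]
    have := norm_act_le (invSqrt (secondMoment pub)) (act (CFC.sqrt (secondMoment pub)) u)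
    rw [act_invSqrt_act_sqrt hpd] at this
    gcongr
  have h2 : 2 * inner ℝ u (act (secondMoment pub) u) ≤ 3 * (opNorm S * ‖u‖ ^ 2) := by
    refine (hB.two_mul_le u).trans ?_
    gcongr
    calc inner ℝ u (act S u) ≤ ‖u‖ * ‖act S u‖ := real_inner_le_norm _ _
      _ ≤ ‖u‖ * (opNorm S * ‖u‖) := by gcongr; exact norm_act_le _ _
      _ = _ := by ring
  have h3 := mul_le_mul_of_nonneg_left h2 (sq_nonneg (opNorm (invSqrt (secondMoment pub))))
  refine le_of_mul_le_mul_right (?_ : 2 * ‖u‖ ^ 2 ≤ _ * ‖u‖ ^ 2) hu0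
  linarith

/-- On the event that the empirical moments are close to the true ones, the scale of the error
bound is bounded below. -/
lemma one_le_mul_signalScale {β : Vec d} {σ s : ℝ} (hs : 0 < s) (hS : S.PosDef) (hβ : β ≠ 0)
    (hσ0 : 0 ≤ σ) (hσ : σ ≤ s * (√(opNorm S) * ‖β‖)) (hA : MomentClose S priv)
    (hB : MomentClose S pub) (hRB : ResponseClose (responseVar S β σ) pub)
    (hsc : 0 < responseScale pub) :
    1 ≤ 3 * (1 + s) * (‖β‖ * opNorm (secondMoment priv) * opNorm (invSqrt (secondMoment pub)) /
      responseScale pub) := by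
  have h1 := opNorm_le_two_mul_of_momentClose hS hA
  have h2 := two_le_opNorm_invSqrt_sq_mul hS hB hβ
  have hS0 := opNorm_nonneg S
  have hP0 := opNorm_nonneg (invSqrt (secondMoment pub))
  set a := opNorm (secondMoment priv)
  set p := opNorm (invSqrt (secondMoment pub))
  set t := opNorm S
  set r := responseScale pub
  have ha0 : 0 ≤ a := by linarith
  have hm : responseVar S β σ ≤ (1 + s ^ 2) * (t * ‖β‖ ^ 2) := by
    have e1 : inner ℝ β (act S β) ≤ t * ‖β‖ ^ 2 := by
      calc inner ℝ β (act S β) ≤ ‖β‖ * ‖act S β‖ := real_inner_le_norm _ _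
        _ ≤ ‖β‖ * (t * ‖β‖) := by gcongr; exact norm_act_le _ _
        _ = _ := by ring
    have e2 : σ ^ 2 ≤ s ^ 2 * (t * ‖β‖ ^ 2) := by
      calc σ ^ 2 ≤ (s * (√t * ‖β‖)) ^ 2 := by gcongr
        _ = _ := by rw [mul_pow, mul_pow, Real.sq_sqrt hS0]
    rw [responseVar]
    linarith
  have hr : r ^ 2 ≤ 3 / 2 * ((1 + s) ^ 2 * (t * ‖β‖ ^ 2)) := by
    have e1 := (abs_le.1 hRB).2
    have e2 : (1 + s ^ 2) * (t * ‖β‖ ^ 2) ≤ (1 + s) ^ 2 * (t * ‖β‖ ^ 2) := by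
      gcongr; nlinarith
    linarith
  rw [← mul_div_assoc, one_le_div hsc]
  refine abs_le_of_sq_le_sq' ?_ (by positivity) |>.2
  -- To bring in the empirical quantities, the factor `2` is replaced by `3 p² t`, and `t = ‖S‖`
  -- then by `2a`.
  calc r ^ 2 ≤ 3 / 2 * ((1 + s) ^ 2 * (t * ‖β‖ ^ 2)) := hr
    _ = 3 / 4 * ((1 + s) ^ 2 * (t * ‖β‖ ^ 2)) * 2 := by ring
    _ ≤ 3 / 4 * ((1 + s) ^ 2 * (t * ‖β‖ ^ 2)) * (3 * (p ^ 2 * t)) := by gcongr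
    _ = 9 / 4 * ((1 + s) ^ 2 * ‖β‖ ^ 2 * p ^ 2) * t ^ 2 := by ring
    _ ≤ 9 / 4 * ((1 + s) ^ 2 * ‖β‖ ^ 2 * p ^ 2) * (2 * a) ^ 2 := by gcongr
    _ = (3 * (1 + s) * (‖β‖ * a * p)) ^ 2 := by ring

end Perturbation

/-! ### Size of the perturbation -/

lemma rpow_three_halves {x : ℝ} (hx : 0 < x) : x ^ (3 / 2 : ℝ) = x * √x := by
  rw [show (3 / 2 : ℝ) = 1 + 1 / 2 by norm_num, Real.rpow_add hx, Real.rpow_one,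
    Real.sqrt_eq_rpow]

lemma two_div_sqrt_two_mul_le {ρ : ℝ} (hρ : 0 < ρ) : 2 / √(2 * ρ) ≤ 3 / 2 / √ρ := by
  have h2 : (4 / 3 : ℝ) ≤ √2 := Real.le_sqrt_of_sq_le (by norm_num)
  rw [Real.sqrt_mul (by norm_num), div_le_div_iff₀ (by positivity) (by positivity)]
  nlinarith [Real.sqrt_pos.2 hρ]

/-- Both noise norms are `O(τ X)`. The total `1512` is `6 (12 · 3 + 3 · 24 · 3)`. -/
lemma noise_bounds {d n : ℕ} {τ ρ η X : ℝ} (hd : 0 < d) (hn : 0 < n) (hτ : 0 < τ) (hρ : 0 < ρ)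
    (hη : 0 < η) (hη1 : η < 1) (hlog : 1 + (216 * τ) ^ 2 ≤ Real.log (1 / η))
    (hX : X = (d : ℝ) ^ (3 / 2 : ℝ) * (1 + Real.log (2 * n / η)) * Real.log (1 / η) / (√ρ * n))
    (hX2 : X ≤ 1 / 2) :
    24 * noiseScale₁ τ ρ η d n * (√d + √(Real.log (1 / η))) ≤ 1 / 6 ∧
      6 * (12 * noiseScale₂ τ ρ η d n * (√d + √(Real.log (1 / η))) +
        3 * (24 * noiseScale₁ τ ρ η d n * (√d + √(Real.log (1 / η))))) ≤ 1512 * τ * X := by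
  have hd1 : (1 : ℝ) ≤ d := by exact_mod_cast hd
  have hd0 : (0 : ℝ) < d := by linarith
  have hn0 : (0 : ℝ) < n := by exact_mod_cast hn
  have hl := one_add_log_pos hn hη hη1
  rw [rpow_three_halves hd0] at hX
  set l := 1 + Real.log (2 * n / η)
  set Λ := Real.log (1 / η)
  have hΛ1 : 1 ≤ Λ := by nlinarith
  set q := √Λ with hq
  set e := √(d : ℝ) with he
  have hq1 : 1 ≤ q := Real.one_le_sqrt.2 hΛ1
  have he1 : 1 ≤ e := Real.one_le_sqrt.2 hd1
  have hqq : q * q = Λ := Real.mul_self_sqrt (by linarith)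
  have hee : e * e = d := Real.mul_self_sqrt (by linarith)
  have hqτ : 216 * τ ≤ q := Real.le_sqrt_of_sq_le (by linarith)
  set Y := τ * l / (√ρ * n) with hY
  have hY0 : 0 < Y := by positivity
  have hXY : τ * X = d * e * Λ * Y := by rw [hX, hY]; ring
  have h2 := two_div_sqrt_two_mul_le hρ
  have hs1 : noiseScale₁ τ ρ η d n ≤ 3 / 2 * d * Y := by
    calc noiseScale₁ τ ρ η d n = 2 / √(2 * ρ) * (τ * d * l / n) := by
          rw [noiseScale₁]; field_simp; rfl
      _ ≤ 3 / 2 / √ρ * (τ * d * l / n) := by gcongr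
      _ = 3 / 2 * d * Y := by rw [hY]; field_simp
  have hs2 : noiseScale₂ τ ρ η d n ≤ 3 / 2 * d * Y := by
    calc noiseScale₂ τ ρ η d n = 2 / √(2 * ρ) * (τ * e * l / n) := by
          rw [noiseScale₂]; field_simp; rfl
      _ ≤ 3 / 2 / √ρ * (τ * d * l / n) := by
          gcongr
          nlinarith
      _ = 3 / 2 * d * Y := by rw [hY]; field_simp
  have hx0 : 0 < e + q := by linarith
  have hx : e + q ≤ 2 * (e * Λ) := by
    have h1 : e ≤ e * Λ := le_mul_of_one_le_right (by linarith) hΛ1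
    have h3 : q ≤ Λ := by nlinarith
    have h4 : Λ ≤ e * Λ := le_mul_of_one_le_left (by linarith) he1
    linarith
  have hxq : (e + q) * q ≤ 2 * (e * Λ) := by
    have h1 : e * q ≤ e * Λ := by gcongr; nlinarith
    have h4 : Λ ≤ e * Λ := le_mul_of_one_le_left (by linarith) he1
    linarith
  have hdY : 0 < (d : ℝ) * Y := by positivity
  have b1 : noiseScale₁ τ ρ η d n * (e + q) ≤ 3 * (τ * X) := by
    calc noiseScale₁ τ ρ η d n * (e + q) ≤ 3 / 2 * d * Y * (2 * (e * Λ)) := by gcongr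
      _ = 3 * (τ * X) := by rw [hXY]; ring
  have b2 : noiseScale₂ τ ρ η d n * (e + q) ≤ 3 * (τ * X) := by
    calc noiseScale₂ τ ρ η d n * (e + q) ≤ 3 / 2 * d * Y * (2 * (e * Λ)) := by gcongr
      _ = 3 * (τ * X) := by rw [hXY]; ring
  refine ⟨?_, by linarith⟩
  -- The spare factor `q = √(log (1/η))`: from `X ≤ 1/2` the left side is at most `3τ/2`, and `216 τ
  -- ≤ q` turns `24 · 3τ/2 = 36τ` into at most `q / 6`.
  have b3 : noiseScale₁ τ ρ η d n * (e + q) * q ≤ 3 * (τ * X) := by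
    calc noiseScale₁ τ ρ η d n * (e + q) * q = noiseScale₁ τ ρ η d n * ((e + q) * q) := by ring
      _ ≤ 3 / 2 * d * Y * (2 * (e * Λ)) := by gcongr
      _ = 3 * (τ * X) := by rw [hXY]; ring
  have hτX : τ * X ≤ τ * (1 / 2) := by gcongr
  refine le_of_mul_le_mul_right (?_ : _ * q ≤ _ * q) (by linarith)
  linarith

/-! ### Good events and their probabilities -/

lemma measure_prod_fst_mem {α β : Type*} [MeasurableSpace α] [MeasurableSpace β] (μ : Measure α)
    (ν : Measure β) [SFinite μ] [IsProbabilityMeasure ν] (s : Set α) :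
    (μ.prod ν) {ω | ω.1 ∈ s} = μ s := by
  have : {ω : α × β | ω.1 ∈ s} = s ×ˢ Set.univ := by ext; simp
  rw [this, Measure.prod_prod, measure_univ, mul_one]

lemma measure_prod_snd_mem {α β : Type*} [MeasurableSpace α] [MeasurableSpace β] (μ : Measure α)
    (ν : Measure β) [IsProbabilityMeasure μ] [SFinite ν] (s : Set β) :
    (μ.prod ν) {ω | ω.2 ∈ s} = ν s := by
  have : {ω : α × β | ω.2 ∈ s} = Set.univ ×ˢ s := by ext; simp
  rw [this, Measure.prod_prod, measure_univ, one_mul]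

/-- Only monotonicity and subadditivity of outer measure are used, and the product formula for
rectangles above holds for arbitrary sets, so no good event has to be shown measurable. -/
lemma measure_le_ofReal_add {α : Type*} [MeasurableSpace α] {μ : Measure α} {s t u : Set α}
    {a b : ℝ} (ha : 0 ≤ a) (hb : 0 ≤ b) (hs : s ⊆ t ∪ u) (ht : μ t ≤ ENNReal.ofReal a)
    (hu : μ u ≤ ENNReal.ofReal b) : μ s ≤ ENNReal.ofReal (a + b) := by
  rw [ENNReal.ofReal_add ha hb]
  exact (measure_mono hs).trans ((measure_union_le _ _).trans (add_le_add ht hu))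

/-- The noise matrix and the noise vector have the sizes used in the utility analysis. -/
def NoiseBounded (τ ρ η : ℝ) (d n : ℕ) (w : (Fin d → Fin d → ℝ) × Vec d) : Prop :=
  opNorm (symMatrix w.1) ≤ 24 * noiseScale₁ τ ρ η d n * (√d + √(Real.log (1 / η))) ∧
    ‖w.2‖ ≤ 12 * noiseScale₂ τ ρ η d n * (√d + √(Real.log (1 / η)))

lemma noiseLaw_not_noiseBounded_le {τ ρ η : ℝ} {d n : ℕ} (hd : 0 < d) (hn : 0 < n) (hτ : 0 < τ)
    (hρ : 0 < ρ) (hη : 0 < η) (hη1 : η < 1) :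
    noiseLaw τ ρ η d n {w | ¬ NoiseBounded τ ρ η d n w} ≤ ENNReal.ofReal (4 * η) := by
  have hd0 : (0 : ℝ) < d := by exact_mod_cast hd
  have hn0 : (0 : ℝ) < n := by exact_mod_cast hn
  have hl := one_add_log_pos hn hη hη1
  have hs1 : 0 < noiseScale₁ τ ρ η d n := by unfold noiseScale₁; positivity
  have hs2 : 0 < noiseScale₂ τ ρ η d n := by unfold noiseScale₂; positivity
  have hp := Measure.isProbabilityMeasure_map
    (μ := Measure.pi fun _ : Fin d => gaussianReal 0 (noiseScale₂ τ ρ η d n ^ 2).toNNReal)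
    (measurable_toLp_vec d).aemeasurable
  rw [show 4 * η = 2 * η + 2 * η by ring]
  refine measure_le_ofReal_add (by positivity) (by positivity) (fun w hw => ?_)
    ((measure_prod_fst_mem _ _ _).trans_le (measure_opNorm_symMatrix_gt_le hs1 hη hη1))
    ((measure_prod_snd_mem _ _ _).trans_le (measure_norm_gt_le hs2 hη hη1))
  by_contra hcon
  simp only [Set.mem_union, Set.mem_ofPred_eq, not_or, not_not] at hcon
  exact hw hcon

/-- The event on the data on which the utility bounds hold. -/
def DataGood {nA nB d : ℕ} (S : Matrix (Fin d) (Fin d) ℝ) (K v η : ℝ)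
    (D : Dataset nA d × Dataset nB d) : Prop :=
  MomentClose S D.2 ∧ ResponseClose v D.2 ∧ SampleBounded S K v η D.1

lemma isProbabilityMeasure_dataLaw {d nA nB : ℕ} {ν : Measure (Vec d)} [IsProbabilityMeasure ν]
    (β : Vec d) (σ : ℝ) : IsProbabilityMeasure (dataLaw nA nB ν β σ) := by
  have := isProbabilityMeasure_sampleLaw (ν := ν) β σ
  unfold dataLaw
  infer_instance

/-- Concentration of the empirical moments of one sample. -/
lemma exists_measure_not_close_le {K : ℝ} (hK : 0 < K) :
    ∃ C : ℝ, 0 < C ∧ ∀ (d n : ℕ) (η σ : ℝ) (ν : Measure (Vec d)) (S : Matrix (Fin d) (Fin d) ℝ)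
      (β : Vec d), IsSubG ν S K → 0 < η → η < 1 → 0 < responseVar S β σ →
      C * (√d + √(Real.log (1 / η))) ≤ √n →
      Measure.pi (fun _ : Fin n => sampleLaw ν β σ)
        {D : Dataset n d | ¬ (MomentClose S D ∧ ResponseClose (responseVar S β σ) D)} ≤
          ENNReal.ofReal (4 * η) := by
  obtain ⟨C, hC, h⟩ := exists_measure_not_momentClose_le hK
  obtain ⟨C', -, h'⟩ := exists_measure_not_responseClose_le hK
  refine ⟨max C C', lt_max_of_lt_left hC, fun d n η σ ν S β hν hη hη1 hv hn => ?_⟩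
  rw [show 4 * η = 2 * η + 2 * η by ring]
  refine measure_le_ofReal_add (by positivity) (by positivity) (fun D hD => ?_)
    (h d n η σ ν S β hν hη hη1 (le_trans ?_ hn)) (h' d n η σ ν S β hν hη hη1 hv (le_trans ?_ hn))
  · by_contra hcon
    simp only [Set.mem_union, Set.mem_ofPred_eq, not_or, not_not] at hcon
    exact hD hcon
  · gcongr; exact le_max_left _ _
  · gcongr; exact le_max_right _ _

/-- Closeness of the private moments is kept out of `DataGood`: part 2 requires of the private
sample size only `d < nA`, which boundedness of the sample allows. -/
lemma dataLaw_not_dataGood_le {K C : ℝ} (hK : 0 < K) {d nA nB : ℕ} {η σ : ℝ} {ν : Measure (Vec d)}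
    {S : Matrix (Fin d) (Fin d) ℝ} {β : Vec d}
    (hC : ∀ (d n : ℕ) (η σ : ℝ) (ν : Measure (Vec d)) (S : Matrix (Fin d) (Fin d) ℝ)
      (β : Vec d), IsSubG ν S K → 0 < η → η < 1 → 0 < responseVar S β σ →
      C * (√d + √(Real.log (1 / η))) ≤ √n →
      Measure.pi (fun _ : Fin n => sampleLaw ν β σ)
        {D : Dataset n d | ¬ (MomentClose S D ∧ ResponseClose (responseVar S β σ) D)} ≤
          ENNReal.ofReal (4 * η))
    (hν : IsSubG ν S K) (hη : 0 < η) (hη1 : η < 1) (hd : 0 < d) (hdn : d < nA)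
    (hv : 0 < responseVar S β σ) (hn : C * (√d + √(Real.log (1 / η))) ≤ √nB) :
    dataLaw nA nB ν β σ {D | ¬ DataGood S K (responseVar S β σ) η D} ≤
      ENNReal.ofReal (5 * η) := by
  have := hν.isProbabilityMeasure
  have hp := isProbabilityMeasure_sampleLaw (ν := ν) β σ
  rw [show 5 * η = 4 * η + η by ring]
  refine measure_le_ofReal_add (by positivity) (by positivity) (fun D hD => ?_)
    ((measure_prod_snd_mem _ _ _).trans_le (hC d nB η σ ν S β hν hη hη1 hv hn))
    ((measure_prod_fst_mem _ _ _).trans_le (measure_not_sampleBounded_le hK β σ hν hη hη1 hd hdn hv))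
  by_contra hcon
  simp only [Set.mem_union, Set.mem_ofPred_eq, not_or, not_not] at hcon
  exact hD ⟨hcon.1.1, hcon.1.2, hcon.2⟩

lemma responseVar_pos {d : ℕ} {S : Matrix (Fin d) (Fin d) ℝ} (hS : S.PosDef) {β : Vec d} {σ : ℝ}
    (h : β ≠ 0 ∨ σ ≠ 0) : 0 < responseVar S β σ := by
  unfold responseVar
  rcases h with h | h
  · have := (posDef_iff_inner_act.1 hS).2 β h
    positivity
  · have : 0 ≤ inner ℝ β (act S β) := by rw [inner_act_self hS]; positivity
    positivity

lemma lowerEig_pos_le_one {C η : ℝ} (hC : 0 ≤ C) {d n : ℕ} (hn : 0 < n) :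
    0 < lowerEig C d n η ∧ lowerEig C d n η ≤ 1 := by
  have hn0 : (0 : ℝ) < n := by exact_mod_cast hn
  have h0 : 0 ≤ C * (√d + √(2 * Real.log (1 / η))) := by positivity
  have h1 : (n : ℝ) ≤ (√n + C * (√d + √(2 * Real.log (1 / η)))) ^ 2 := by
    calc (n : ℝ) = √n ^ 2 := (Real.sq_sqrt hn0.le).symm
      _ ≤ _ := by gcongr; linarith
  exact ⟨by unfold lowerEig; exact div_pos hn0 (hn0.trans_le h1),
    div_le_one_of_le₀ h1 (by positivity)⟩

lemma shrink_le_one {C η : ℝ} (hC : 0 ≤ C) {d n : ℕ} : shrink C d n η ≤ 1 := by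
  unfold shrink
  have : 0 ≤ C * ((√d + √(Real.log (1 / η))) / √n) := by positivity
  linarith

/-- The two error bounds, on the event on which all the random quantities are controlled. -/
lemma accuracy_of_good {nA nB d : ℕ} {K τ ρ η σ s L q : ℝ} {S : Matrix (Fin d) (Fin d) ℝ}
    {β : Vec d} {pub : Dataset nB d} {priv : Dataset nA d} {w : (Fin d → Fin d → ℝ) × Vec d}
    (hd : 0 < d) (hn : 0 < nA) (hρ : 0 < ρ) (hη : 0 < η) (hη1 : η < 1) (hτ0 : 0 < τ)
    (hτ : 4 * (4 * K ^ 2 + 16) ≤ τ) (hlog : 1 + (216 * τ) ^ 2 ≤ Real.log (1 / η))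
    (hS : S.PosDef) (hβ : β ≠ 0) (hσ0 : 0 ≤ σ) (hs : 0 < s) (hσ : σ ≤ s * (√(opNorm S) * ‖β‖))
    (hL0 : 0 < L) (hL1 : L ≤ 1) (hq0 : 0 < q) (hq1 : q ≤ 1)
    (hsmall : (d : ℝ) ^ (3 / 2 : ℝ) * (1 + Real.log (2 * nA / η)) * Real.log (1 / η) /
      (√ρ * nA * L * q ^ 2) ≤ 1 / 2)
    (hgood : DataGood S K (responseVar S β σ) η (priv, pub))
    (hA : MomentClose S priv) (hRA : ResponseClose (responseVar S β σ) priv)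
    (hw : NoiseBounded τ ρ η d nA w) :
    (secondMoment pub).PosDef ∧ 0 < responseScale pub ∧
      (secondMoment priv).PosDef ∧ IsUnit (noisyMoment τ η pub priv w).det ∧
      ‖dpTransformed τ η pub priv w - transformedOLS pub priv‖ ≤
        1512 * τ * (3 * (1 + s)) * ((d : ℝ) ^ (3 / 2 : ℝ) * ‖β‖ * opNorm (secondMoment priv) *
            opNorm (invSqrt (secondMoment pub)) * Real.log (1 / η) /
          (responseScale pub * √ρ * nA * q ^ 4) * ((1 + Real.log (2 * nA / η)) / L ^ 2)) ∧
      ‖dpRecovered τ η pub priv w - ols priv‖ ≤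
        1512 * τ * (3 * (1 + s)) * ((d : ℝ) ^ (3 / 2 : ℝ) * ‖β‖ * opNorm (secondMoment priv) *
            opNorm (secondMoment pub)⁻¹ * Real.log (1 / η) /
          (√ρ * nA * q ^ 4) * ((1 + Real.log (2 * nA / η)) / L ^ 2)) := by
  obtain ⟨hB, hRB, hSB⟩ := hgood
  have hv := responseVar_pos (σ := σ) hS (Or.inl hβ)
  have hT := noTruncationLoss_of_close hS hv hn hη hη1 hτ hB hRB hSB
  have hpd := hT.1
  have hsc := hT.2.1
  have hn0 : (0 : ℝ) < nA := by exact_mod_cast hn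
  have hd0 : (0 : ℝ) < d := by exact_mod_cast hd
  have hl := one_add_log_pos hn hη hη1
  have hΛ : 0 < Real.log (1 / η) := by nlinarith
  set X := (d : ℝ) ^ (3 / 2 : ℝ) * (1 + Real.log (2 * nA / η)) * Real.log (1 / η) / (√ρ * nA)
    with hX
  have hX0 : 0 < X := by positivity
  have hX2 : X ≤ 1 / 2 := by
    refine le_trans ?_ hsmall
    rw [hX]
    have h1 : L * q ^ 2 ≤ 1 := mul_le_one₀ hL1 (by positivity) (pow_le_one₀ hq0.le hq1)
    refine div_le_div_of_nonneg_left (by positivity) (by positivity) ?_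
    calc √ρ * nA * L * q ^ 2 = √ρ * nA * (L * q ^ 2) := by ring
      _ ≤ √ρ * nA * 1 := by gcongr
      _ = √ρ * nA := mul_one _
  obtain ⟨hG6, herr⟩ := noise_bounds hd hn hτ0 hρ hη hη1 hlog hX hX2
  obtain ⟨hdet, hdiff⟩ := norm_dpTransformed_sub_le hS hA hB hRA hRB hT (hw.1.trans hG6)
  have hscale := one_le_mul_signalScale hs hS hβ hσ0 hσ hA hB hRB hsc
  have hP0 := opNorm_nonneg (invSqrt (secondMoment pub))
  have ha0 := opNorm_nonneg (secondMoment priv)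
  have hP2 := opNorm_invSqrt_sq hpd
  have hrec := norm_dpRecovered_sub_le (τ := τ) (η := η) (priv := priv) hpd hsc w
  set a := opNorm (secondMoment priv)
  set p := opNorm (invSqrt (secondMoment pub))
  set r := responseScale pub
  have hfirst : ‖dpTransformed τ η pub priv w - transformedOLS pub priv‖ ≤
      1512 * τ * (3 * (1 + s)) * ((d : ℝ) ^ (3 / 2 : ℝ) * ‖β‖ * a * p * Real.log (1 / η) /
          (r * √ρ * nA * q ^ 4) * ((1 + Real.log (2 * nA / η)) / L ^ 2)) := by
    have h1 : ‖dpTransformed τ η pub priv w - transformedOLS pub priv‖ ≤ 1512 * τ * X := by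
      refine hdiff.trans (le_trans ?_ herr)
      have := hw.1
      have := hw.2
      linarith
    -- The factors `q⁻⁴` and `L⁻²` of the claimed bound are slack; they are at least one and are
    -- inserted here.
    have hqL : q ^ 4 * L ^ 2 ≤ 1 :=
      mul_le_one₀ (pow_le_one₀ hq0.le hq1) (by positivity) (pow_le_one₀ hL0.le hL1)
    have hZ : 0 ≤ ‖β‖ * a * p / r := by positivity
    calc ‖dpTransformed τ η pub priv w - transformedOLS pub priv‖ ≤ 1512 * τ * X * 1 := by
          rwa [mul_one]
      _ ≤ 1512 * τ * X * (3 * (1 + s) * (‖β‖ * a * p / r)) := by gcongr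
      _ = 1512 * τ * (3 * (1 + s)) * (X * (‖β‖ * a * p / r)) / 1 := by ring
      _ ≤ 1512 * τ * (3 * (1 + s)) * (X * (‖β‖ * a * p / r)) / (q ^ 4 * L ^ 2) := by gcongr
      _ = _ := by rw [hX]; field_simp
  refine ⟨hpd, hsc, hA.posDef hS, hdet, hfirst, ?_⟩
  calc ‖dpRecovered τ η pub priv w - ols priv‖
      ≤ r * (p * (1512 * τ * (3 * (1 + s)) * ((d : ℝ) ^ (3 / 2 : ℝ) * ‖β‖ * a * p *
          Real.log (1 / η) / (r * √ρ * nA * q ^ 4) *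
          ((1 + Real.log (2 * nA / η)) / L ^ 2)))) := hrec.trans (by gcongr)
    _ = 1512 * τ * (3 * (1 + s)) * ((d : ℝ) ^ (3 / 2 : ℝ) * ‖β‖ * a * p ^ 2 * Real.log (1 / η) /
          (√ρ * nA * q ^ 4) * ((1 + Real.log (2 * nA / η)) / L ^ 2)) := by field_simp
    -- Uses `p² ≤ ‖Σ̂_B⁻¹‖`, from `hP2`: one factor `p` comes from the first bound, the other from
    -- undoing the transformation.
    _ ≤ _ := by gcongr

end DPOLS

/-! ### Assembly of the theorem -/

open DPOLS in
theorem mainTheorem1 :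
    -- privacy
    (∀ (d nA nB : ℕ) (τ ρ η : ℝ), 0 < d → 0 < τ → 0 < ρ → 0 < η → η < 1 →
      ∀ pub : Dataset nB d,
        IsZCDP (fun priv : Dataset nA d => dpPMTOLSE τ ρ η pub priv) (2 * ρ)) ∧
    -- utility: the constants depend on the sub-Gaussian norm `K` alone, ...
    ∀ K : ℝ, 0 < K →
      ∃ τ₀ : ℝ, 0 < τ₀ ∧ ∃ C₁ : ℝ, 0 < C₁ ∧ ∃ C₂ : ℝ, 0 < C₂ ∧ ∃ C₃ : ℝ, 0 < C₃ ∧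
      ∃ c₁ : ℝ, 0 < c₁ ∧
      -- no truncation loss
      (∀ (d nA nB : ℕ) (τ η σ : ℝ) (ν : Measure (Vec d)) (S : Matrix (Fin d) (Fin d) ℝ)
        (β : Vec d),
        0 < d → d < nA → d < nB → τ₀ ≤ τ → 0 < η → η < 1 → 0 ≤ σ → IsSubG ν S K →
        (β ≠ 0 ∨ σ ≠ 0) →
        C₁ * (√d + √(2 * Real.log (1 / η))) ≤ √nB →
        dataLaw nA nB ν β σ {ω | ¬ NoTruncationLoss τ η ω.2 ω.1} ≤ ENNReal.ofReal (c₁ * η)) ∧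
      -- accuracy: ... except that `c₂` may depend on `τ`, and `C` on `τ` and on the bound `s`
      -- for the noise-to-signal ratio
      (∀ τ : ℝ, τ₀ ≤ τ → ∃ c₂ : ℝ, 0 < c₂ ∧ ∀ s : ℝ, 0 < s → ∃ C : ℝ, 0 < C ∧
        ∀ (d nA nB : ℕ) (ρ η σ : ℝ) (ν : Measure (Vec d)) (S : Matrix (Fin d) (Fin d) ℝ)
          (β : Vec d),
          0 < d → d < nA → d < nB → 0 < ρ → 0 < η → η < 1 → 0 ≤ σ → IsSubG ν S K →
          β ≠ 0 → σ ≤ s * (√(opNorm S) * ‖β‖) →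
          C₁ * (√d + √(2 * Real.log (1 / η))) ≤ √nB →
          0 < shrink C₃ d nA η →
          (d : ℝ) ^ (3 / 2 : ℝ) * (1 + Real.log (2 * nA / η)) * Real.log (1 / η) /
            (√ρ * nA * lowerEig C₂ d nB η * shrink C₃ d nA η ^ 2) ≤ 1 / 2 →
          ((dataLaw nA nB ν β σ).prod (noiseLaw τ ρ η d nA))
            {ω | ¬ ((secondMoment ω.1.2).PosDef ∧ 0 < responseScale ω.1.2 ∧
              (secondMoment ω.1.1).PosDef ∧ IsUnit (noisyMoment τ η ω.1.2 ω.1.1 ω.2).det ∧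
              ‖dpTransformed τ η ω.1.2 ω.1.1 ω.2 - transformedOLS ω.1.2 ω.1.1‖ ≤
                C * ((d : ℝ) ^ (3 / 2 : ℝ) * ‖β‖ * opNorm (secondMoment ω.1.1) *
                    opNorm (invSqrt (secondMoment ω.1.2)) * Real.log (1 / η) /
                  (responseScale ω.1.2 * √ρ * nA * shrink C₃ d nA η ^ 4) *
                  ((1 + Real.log (2 * nA / η)) / lowerEig C₂ d nB η ^ 2)) ∧
              ‖dpRecovered τ η ω.1.2 ω.1.1 ω.2 - ols ω.1.1‖ ≤
                C * ((d : ℝ) ^ (3 / 2 : ℝ) * ‖β‖ * opNorm (secondMoment ω.1.1) *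
                    opNorm (secondMoment ω.1.2)⁻¹ * Real.log (1 / η) /
                  (√ρ * nA * shrink C₃ d nA η ^ 4) *
                  ((1 + Real.log (2 * nA / η)) / lowerEig C₂ d nB η ^ 2)))} ≤
            ENNReal.ofReal (c₂ * η)) := by
  refine ⟨fun d nA nB τ ρ η hd hτ hρ hη hη1 pub =>
    isZCDP_dpPMTOLSE d nA nB τ ρ η hd hτ hρ hη hη1 pub, fun K hK => ?_⟩
  obtain ⟨C₀, hC₀, hclose⟩ := exists_measure_not_close_le hK
  have hpub : ∀ {d nB : ℕ} {η : ℝ}, 0 < η → η < 1 →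
      C₀ * (√d + √(2 * Real.log (1 / η))) ≤ √nB → C₀ * (√d + √(Real.log (1 / η))) ≤ √nB := by
    intro d nB η hη hη1 h
    have : 0 ≤ Real.log (1 / η) := Real.log_nonneg (by rw [le_div_iff₀ hη]; linarith)
    refine le_trans ?_ h
    gcongr
    linarith
  -- The witnesses are `τ₀`, `C₁`, `C₂`, `C₃`, `c₁` in this order. `C₂` is arbitrary, as only `0 < L
  -- ≤ 1` is used; with `C₃ = C₀`, positivity of `q` is the sample-size condition for the private
  -- moments.
  refine ⟨4 * (4 * K ^ 2 + 16), by positivity, C₀, hC₀, 1, one_pos, C₀, hC₀, 5, by norm_num,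
    ?_, ?_⟩
  · intro d nA nB τ η σ ν S β hd hdA hdB hτ hη hη1 hσ hν hβσ hnB
    have hv := responseVar_pos hν.posDef hβσ
    refine (MeasureTheory.measure_mono fun D hD => ?_).trans
      (dataLaw_not_dataGood_le hK hclose hν hη hη1 hd hdA hv (hpub hη hη1 hnB))
    exact fun hgood => hD (noTruncationLoss_of_close hν.posDef hv (hd.trans hdA) hη hη1 hτ
      hgood.1 hgood.2.1 hgood.2.2)
  · intro τ hτ
    have hτ0 : 0 < τ := lt_of_lt_of_le (by positivity) hτ
    -- The exponential makes `c₂ η ≥ 1` for those `η` not small enough for `noise_bounds`. The `13`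
    -- adds the failure probabilities `4η` (private moments), `5η` (`DataGood`) and `4η` (noise).
    refine ⟨Real.exp (1 + (216 * τ) ^ 2) + 13, by positivity, fun s hs =>
      ⟨1512 * τ * (3 * (1 + s)), by positivity, ?_⟩⟩
    intro d nA nB ρ η σ ν S β hd hdA hdB hρ hη hη1 hσ0 hν hβ hσ hnB hq hsmall
    have := hν.isProbabilityMeasure
    have hp := isProbabilityMeasure_sampleLaw (ν := ν) β σ
    have hpD := isProbabilityMeasure_dataLaw (nA := nA) (nB := nB) (ν := ν) β σ
    have hS := hν.posDef
    have hv := responseVar_pos (σ := σ) hS (Or.inl hβ)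
    have hn : 0 < nA := hd.trans hdA
    by_cases hlog : 1 + (216 * τ) ^ 2 ≤ Real.log (1 / η)
    · have hnA : C₀ * (√d + √(Real.log (1 / η))) ≤ √nA := by
        have hn0 : (0 : ℝ) < √nA := Real.sqrt_pos.2 (by exact_mod_cast hn)
        rw [shrink, ← mul_div_assoc, sub_pos, div_lt_one hn0] at hq
        exact hq.le
      have hA := hclose d nA η σ ν S β hν hη hη1 hv hnA
      have hB := dataLaw_not_dataGood_le hK hclose hν hη hη1 hd hdA hv (hpub hη hη1 hnB)
      have hN := noiseLaw_not_noiseBounded_le hd hn hτ0 hρ hη hη1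
      have hL := lowerEig_pos_le_one (C := 1) (η := η) zero_le_one (d := d) (hd.trans hdB)
      have hD := measure_le_ofReal_add (by positivity) (by positivity) subset_rfl
        ((measure_prod_fst_mem _ _ _).trans_le hA) hB
      have hall := measure_le_ofReal_add (by positivity) (by positivity) subset_rfl
        ((measure_prod_fst_mem (dataLaw nA nB ν β σ) (noiseLaw τ ρ η d nA) _).trans_le hD)
        ((measure_prod_snd_mem (dataLaw nA nB ν β σ) (noiseLaw τ ρ η d nA) _).trans_le hN)
      refine (MeasureTheory.measure_mono fun ω hω => ?_).trans
        (hall.trans (ENNReal.ofReal_le_ofReal ?_))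
      · by_contra hcon
        simp only [Set.mem_union, Set.mem_ofPred_eq, not_or, not_not] at hcon
        exact hω (accuracy_of_good hd hn hρ hη hη1 hτ0 hτ hlog hS hβ hσ0 hs hσ hL.1 hL.2 hq
          (shrink_le_one hC₀.le) hsmall hcon.1.2 hcon.1.1.1 hcon.1.1.2 hcon.2)
      · have := Real.exp_pos (1 + (216 * τ) ^ 2)
        nlinarith
    -- Here `η > exp (-(1 + (216 τ)²))`, so the claimed probability bound is at least one.
    · refine MeasureTheory.prob_le_one.trans ?_
      rw [ENNReal.one_le_ofReal]
      have h1 : Real.exp (-(1 + (216 * τ) ^ 2)) ≤ η := by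
        rw [← Real.le_log_iff_exp_le hη]
        rw [one_div, Real.log_inv] at hlog
        linarith
      calc (1 : ℝ) = Real.exp (1 + (216 * τ) ^ 2) * Real.exp (-(1 + (216 * τ) ^ 2)) := by
            rw [← Real.exp_add]; simp
        _ ≤ Real.exp (1 + (216 * τ) ^ 2) * η := by gcongr
        _ ≤ (Real.exp (1 + (216 * τ) ^ 2) + 13) * η := by gcongr; linarith
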